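/- Let $d\ge 2$ be an integer, $s>0$ and $\beta>\frac{1-d}{4}$. Put $\phi_s(r)=\sqrt{s^2+r^2}$ and $\widehat f(\xi)=\int_{\mathbb R^d}e^{-ix\cdot\xi}f(x)\,dx$ (extended to $L^2(\mathbb R^d)$ by continuity). For $f\in L^2(\mathbb R^d)$ let $e^{it\phi_s(D)}f$ be the function with spatial Fourier transform $e^{it\phi_s(|\xi|)}\widehat f(\xi)$. For $F$ on $\mathbb R\times\mathbb R^d$ let $\widetilde F$ be its space-time Fourier transform $\widetilde F(\tau,\xi)=\int e^{-i(t\tau+x\cdot\xi)}F(t,x)\,dt\,dx$, in the sense of tempered distributions, and let $|\square|^\beta F$ be given by $\widetilde{|\square|^\beta F}(\tau,\xi)=|\tau^2-|\xi|^2|^\beta\,\widetilde F(\tau,\xi)$. Put $$\mathcal K_a^b(\eta_1,\eta_2)=\frac{\left(\phi_s(|\eta_1|)\phi_s(|\eta_2|)-\eta_1\cdot\eta_2-s^2\right)^b}{\left(\phi_s(|\eta_1|)\phi_s(|\eta_2|)-\eta_1\cdot\eta_2+s^2\right)^a},\qquad \mathbf{KG}(\beta,d)=2^{\frac{-5d+1}{2}+2\beta}\,\pi^{\frac{-5d+1}{2}}\,\frac{\Gamma(\frac{d-1}{2}+2\beta)}{\Gamma(d-1+2\beta)}.$$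 Then for all $f,g\in L^2(\mathbb R^d)$ (the right-hand side being possibly infinite; where it is finite, $|\square|^\beta(e^{it\phi_s(D)}f\,\overline{e^{it\phi_s(D)}g})$ exists in $L^2(\mathbb R^{d+1})$) $$\left\||\square|^\beta\left(e^{it\phi_s(D)}f\,\overline{e^{it\phi_s(D)}g}\right)\right\|_{L^2(\mathbb R^{d+1})}^2\le \mathbf{KG}(\beta,d)\int_{\mathbb R^{2d}}|\widehat f(\eta_1)|^2|\widehat g(\eta_2)|^2\phi_s(|\eta_1|)\phi_s(|\eta_2|)\,\mathcal K_{1/2}^{\frac{d-2}{2}+2\beta}(\eta_1,\eta_2)\,d\eta_1\,d\eta_2 .$$ The constant is optimal: for these fixed $d,s,\beta$, if the inequality holds for all $f,g\in L^2(\mathbb R^d)$ with a constant $C$ in place of $\mathbf{KG}(\beta,d)$, then $C\ge\mathbf{KG}(\beta,d)$. Moreover, for every $a>0$, equality holds, with both sides finite and non-zero, for $f=g=f_a$, where $\widehat{f_a}(\xi)=e^{-a\phi_s(|\xi|)}/\phi_s(|\xi|)$. -/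

import Mathlib

open MeasureTheory FourierTransform
open scoped SchwartzMap ENNReal ComplexConjugate

noncomputable section

namespace KleinGordon

/-- `φ_s(r) = √(s² + r²)`. -/
def phi (s r : ℝ) : ℝ := Real.sqrt (s ^ 2 + r ^ 2)

variable {d : ℕ}

/-- The spatial Fourier transform `f̂(ξ) = ∫ e^{-i x·ξ} f(x) dx` of `f ∈ L²(ℝᵈ)`.
Mathlib's `𝓕` is the `L²` extension of `∫ e^{-2πi x·ξ} f(x) dx`, hence the dilation. -/
def hat (f : Lp ℂ 2 (volume : Measure (EuclideanSpace ℝ (Fin d))))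
    (ξ : EuclideanSpace ℝ (Fin d)) : ℂ :=
  (𝓕 f : Lp ℂ 2 (volume : Measure (EuclideanSpace ℝ (Fin d)))) ((2 * Real.pi)⁻¹ • ξ)

theorem continuous_phi (s : ℝ) : Continuous (phi s) := by
  unfold phi
  fun_prop

theorem memLp_mul_phase (s t : ℝ)
    (h : Lp ℂ 2 (volume : Measure (EuclideanSpace ℝ (Fin d)))) :
    MemLp (fun ξ : EuclideanSpace ℝ (Fin d) =>
      Complex.exp (((t * phi s (2 * Real.pi * ‖ξ‖) : ℝ) : ℂ) * Complex.I) * h ξ) 2 volume := by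
  have hc : Continuous (fun ξ : EuclideanSpace ℝ (Fin d) =>
      Complex.exp (((t * phi s (2 * Real.pi * ‖ξ‖) : ℝ) : ℂ) * Complex.I)) := by
    have := continuous_phi s
    fun_prop
  refine (Lp.memLp h).of_le
    (hc.aestronglyMeasurable.mul (Lp.memLp h).aestronglyMeasurable) ?_
  refine Filter.Eventually.of_forall fun ξ => ?_
  rw [norm_mul, Complex.norm_exp_ofReal_mul_I, one_mul]

/-- The Klein--Gordon propagator `e^{itφ_s(D)}` on `L²(ℝᵈ)`: the Fourier multiplier with symbol
`e^{itφ_s(|ξ|)}` in the frequency variable `ξ` of `hat`. -/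
def propagator (s t : ℝ) (f : Lp ℂ 2 (volume : Measure (EuclideanSpace ℝ (Fin d)))) :
    Lp ℂ 2 (volume : Measure (EuclideanSpace ℝ (Fin d))) :=
  𝓕⁻ ((memLp_mul_phase s t (𝓕 f)).toLp _)

/-- The product `e^{itφ_s(D)}f(x) · conj (e^{itφ_s(D)}g(x))`. -/
def bilinear (s : ℝ) (f g : Lp ℂ 2 (volume : Measure (EuclideanSpace ℝ (Fin d))))
    (t : ℝ) (x : EuclideanSpace ℝ (Fin d)) : ℂ :=
  propagator s t f x * conj (propagator s t g x)

/-- The space-time Fourier transform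
`∫ e^{-i(tτ + x·ξ)} ψ(τ, ξ) dτ dξ` of a test function, evaluated at `(t, x)`. -/
def testFourier (ψ : 𝓢(ℝ × EuclideanSpace ℝ (Fin d), ℂ)) (t : ℝ)
    (x : EuclideanSpace ℝ (Fin d)) : ℂ :=
  ∫ p : ℝ × EuclideanSpace ℝ (Fin d),
    Complex.exp (-(((t * p.1 + inner ℝ x p.2 : ℝ) : ℂ) * Complex.I)) * ψ p

/-- `m` is the space-time Fourier transform `F̃` of `F`, in the sense of tempered distributions:
`∫ F ψ̃ = ∫ m ψ` for all Schwartz functions `ψ`, all the integrals being convergent.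
The integral of `F ψ̃` is an iterated one, because `F` may be given as a family indexed by `t` of
functions defined only up to null sets of `x`. -/
def IsSpaceTimeFourier (F : ℝ → EuclideanSpace ℝ (Fin d) → ℂ)
    (m : ℝ × EuclideanSpace ℝ (Fin d) → ℂ) : Prop :=
  ∀ ψ : 𝓢(ℝ × EuclideanSpace ℝ (Fin d), ℂ),
    (∀ᵐ t : ℝ, Integrable fun x => F t x * testFourier ψ t x) ∧
    (Integrable fun t : ℝ => ∫ x, F t x * testFourier ψ t x) ∧
    (Integrable fun p => m p * ψ p) ∧
    ∫ t : ℝ, ∫ x, F t x * testFourier ψ t x = ∫ p, m p * ψ p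

/-- `G = |□|^β F`: the Fourier transform of `F` is a function `F̃`, and that of `G` is
`|τ² - |ξ|²|^β F̃(τ, ξ)`. -/
def IsBoxPow (β : ℝ) (F G : ℝ → EuclideanSpace ℝ (Fin d) → ℂ) : Prop :=
  ∃ m : ℝ × EuclideanSpace ℝ (Fin d) → ℂ, IsSpaceTimeFourier F m ∧
    IsSpaceTimeFourier G fun p => ((|p.1 ^ 2 - ‖p.2‖ ^ 2| ^ β : ℝ) : ℂ) * m p

/-- `‖|□|^β F‖²` in `L²(ℝ^{d+1})`. The function `|□|^β F ∈ L²` is unique up to null sets when it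
exists; the value is `∞` when it does not. -/
def boxNormSq (β : ℝ) (F : ℝ → EuclideanSpace ℝ (Fin d) → ℂ) : ℝ≥0∞ :=
  ⨅ (G : ℝ → EuclideanSpace ℝ (Fin d) → ℂ)
    (_ : MemLp (Function.uncurry G) 2 volume) (_ : IsBoxPow β F G),
    eLpNorm (Function.uncurry G) 2 volume ^ 2

/-- The kernel `𝒦_a^b(η₁, η₂)`. -/
def kernel (s a b : ℝ) (η₁ η₂ : EuclideanSpace ℝ (Fin d)) : ℝ :=
  (phi s ‖η₁‖ * phi s ‖η₂‖ - inner ℝ η₁ η₂ - s ^ 2) ^ b /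
    (phi s ‖η₁‖ * phi s ‖η₂‖ - inner ℝ η₁ η₂ + s ^ 2) ^ a

/-- The integral
`∫ |f̂(η₁)|² |ĝ(η₂)|² φ_s(|η₁|) φ_s(|η₂|) 𝒦_{1/2}^{(d-2)/2+2β}(η₁, η₂) dη₁ dη₂` in `[0, ∞]`;
the integrand is nonnegative. -/
def kernelIntegral (s β : ℝ) (f g : Lp ℂ 2 (volume : Measure (EuclideanSpace ℝ (Fin d)))) :
    ℝ≥0∞ :=
  ∫⁻ η : EuclideanSpace ℝ (Fin d) × EuclideanSpace ℝ (Fin d),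
    ENNReal.ofReal (‖hat f η.1‖ ^ 2 * ‖hat g η.2‖ ^ 2 * phi s ‖η.1‖ * phi s ‖η.2‖ *
      kernel s (1 / 2) (((d : ℝ) - 2) / 2 + 2 * β) η.1 η.2)

/-- The constant `KG(β, d)`. -/
def KG (β : ℝ) (d : ℕ) : ℝ :=
  (2 : ℝ) ^ ((-5 * (d : ℝ) + 1) / 2 + 2 * β) * Real.pi ^ ((-5 * (d : ℝ) + 1) / 2) *
    (Real.Gamma (((d : ℝ) - 1) / 2 + 2 * β) / Real.Gamma ((d : ℝ) - 1 + 2 * β))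

end KleinGordon

end

noncomputable section

set_option linter.unusedSectionVars false

namespace KleinGordon

/-! ### Relativistic kinematics of two particles of mass `s` in the centre-of-mass frame -/

section Geometry

variable {E : Type*} [NormedAddCommGroup E] [InnerProductSpace ℝ E]

/-! The space-time Fourier transform of the product is, up to powers of `2π`, the image of `f̂(η₁)
conj ĝ(η₂) dη₁ dη₂` under the energy-momentum transfer `(φ(η₁) - φ(η₂), η₁ - η₂)`. The square of its
density lives on quadruples with `η₁ - η₂ = η₃ - η₄` on the mass shell. Rewriting this as `η₁ + η₄ =
η₃ + η₂` turns it into an integral over pairs of pairs with the same total energy-momentum `q`.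

For fixed `q` a pair is described by its direction `ω` in the centre-of-mass frame, its momentum
there having length `r = r(q)`. By Lorentz invariance the transfer between the first particle of the
pair `ω` and the second particle of the pair `ω'` has Minkowski square `-2r²(1 + ω·ω')`. So
`|□|^{2β}` becomes `(2r²)^{2β}` times the zonal kernel `(1 + ω·ω')^{2β}`, whose integral over the
sphere is the same for every `ω`, and finite exactly when `β > (1 - d)/4`. The Schur test bounds the
quadratic form on each sphere by that integral times an `L²` norm; undoing the change of variables
gives the kernel `𝒦` and the constant `KG`. The Schur test is an equality when the tested function
is constant on each sphere. For `e^{-aφ}/φ` the two factors `φ` cancel those of the phase space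
measure and leave `e^{-aτ}`, with `τ` the total energy, so equality holds; being finite and
non-zero, it also makes the constant optimal.

The regrouping is made rigorous by Plancherel. With `A`, `B` the transforms of the measures `|f̂|`,
`|ĝ|` on the mass shell, the transfer measure has transform `A conj B`, while the two-particle
density has transform `A B`, of the same modulus. The square of the transfer density and the image
of the measure on pairs of pairs have equal Fourier transforms
(`exists_transferDensity_of_boundedOnBall`); monotone truncation removes boundedness
(`exists_transferDensity`). The geometry is in `minkowski_transfer` and `lintegral_pair`, the
constant in `lintegral_sphere_one_add_inner`, the inequality in `quadIntegral_boxWeight_le`. Complex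
`f̂`, `ĝ` are handled by domination (`exists_complex_density`), and `isSpaceTimeFourier_bilinear`
links densities to the distributional Fourier transform of the product. -/

theorem phi_pos {s : ℝ} (hs : 0 < s) (r : ℝ) : 0 < phi s r := by
  unfold phi; positivity

theorem phi_sq (s r : ℝ) : phi s r ^ 2 = s ^ 2 + r ^ 2 := Real.sq_sqrt (by positivity)

theorem lt_phi {s : ℝ} (hs : 0 < s) (r : ℝ) : r < phi s r :=
  Real.lt_sqrt_of_sq_lt (by nlinarith)

/-- The energy of a pair of particles of total momentum `ξ` and relative momentum `y` in the
centre-of-mass frame. -/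
def totalEnergy (s : ℝ) (ξ y : E) : ℝ := Real.sqrt (‖ξ‖ ^ 2 + 4 * (s ^ 2 + ‖y‖ ^ 2))

/-- Half of the difference of the energies of the two particles. -/
def skewEnergy (s : ℝ) (ξ y : E) : ℝ := inner ℝ y ξ / (2 * phi s ‖y‖)

/-- Coefficient of the Lorentz boost. -/
def boostCoeff (s : ℝ) (ξ y : E) : ℝ :=
  inner ℝ y ξ / (2 * phi s ‖y‖ * (totalEnergy s ξ y + 2 * phi s ‖y‖))

/-- The spatial part of the Lorentz boost of `(0, y)` from the centre-of-mass frame to the frame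
of total momentum `ξ`. -/
def boost (s : ℝ) (ξ y : E) : E := y + boostCoeff s ξ y • ξ

theorem totalEnergy_pos {s : ℝ} (hs : 0 < s) (ξ y : E) : 0 < totalEnergy s ξ y := by
  unfold totalEnergy; positivity

theorem totalEnergy_sq (s : ℝ) (ξ y : E) :
    totalEnergy s ξ y ^ 2 = ‖ξ‖ ^ 2 + 4 * phi s ‖y‖ ^ 2 := by
  rw [totalEnergy, Real.sq_sqrt (by positivity), phi_sq]

theorem boostCoeff_eq (s : ℝ) (ξ y : E) :
    boostCoeff s ξ y = skewEnergy s ξ y / (totalEnergy s ξ y + 2 * phi s ‖y‖) := by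
  rw [boostCoeff, skewEnergy, div_div]

/-- Makes `totalEnergy / 2 ± skewEnergy` positive, so that these numbers can be identified with the
energies of the two particles, which are square roots. -/
theorem abs_skewEnergy_lt {s : ℝ} (hs : 0 < s) (ξ y : E) :
    |skewEnergy s ξ y| < totalEnergy s ξ y / 2 := by
  have h1 := phi_pos hs ‖y‖
  have h2 : |inner ℝ y ξ| ≤ ‖y‖ * ‖ξ‖ := abs_real_inner_le_norm y ξ
  have h3 := lt_phi hs ‖y‖
  have h4 : ‖ξ‖ < totalEnergy s ξ y := by
    apply Real.lt_sqrt_of_sq_lt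
    have := sq_nonneg ‖y‖
    nlinarith
  rw [skewEnergy, abs_div, abs_of_pos (by positivity : 0 < 2 * phi s ‖y‖), div_lt_iff₀ (by positivity)]
  nlinarith [norm_nonneg y, norm_nonneg ξ]

/-- The boosted vector is `(skewEnergy, boost)`. It stays Minkowski-orthogonal to the total momentum
`(totalEnergy, ξ)`, as `(0, y)` is to the total momentum at rest. -/
theorem inner_boost {s : ℝ} (hs : 0 < s) (ξ y : E) :
    inner ℝ (boost s ξ y) ξ = totalEnergy s ξ y * skewEnergy s ξ y := by
  have h1 := phi_pos hs ‖y‖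
  have h2 := totalEnergy_pos hs ξ y
  have h3 := totalEnergy_sq s ξ y
  have h4 : inner ℝ y ξ = 2 * phi s ‖y‖ * skewEnergy s ξ y := by
    rw [skewEnergy]; field_simp
  rw [boost, inner_add_left, real_inner_smul_left, real_inner_self_eq_norm_sq, boostCoeff_eq, h4,
    show ‖ξ‖ ^ 2 = totalEnergy s ξ y ^ 2 - 4 * phi s ‖y‖ ^ 2 by linarith]
  field_simp
  ring

/-- The boost preserves the Minkowski square `-‖y‖²` of `(0, y)`. -/
theorem norm_boost_sq {s : ℝ} (hs : 0 < s) (ξ y : E) :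
    ‖boost s ξ y‖ ^ 2 = ‖y‖ ^ 2 + skewEnergy s ξ y ^ 2 := by
  have h1 := phi_pos hs ‖y‖
  have h2 := totalEnergy_pos hs ξ y
  have h3 := totalEnergy_sq s ξ y
  have h4 : inner ℝ y ξ = 2 * phi s ‖y‖ * skewEnergy s ξ y := by
    rw [skewEnergy]; field_simp
  rw [boost, norm_add_sq_real, real_inner_smul_right, norm_smul, mul_pow, Real.norm_eq_abs, sq_abs,
    boostCoeff_eq, h4, show ‖ξ‖ ^ 2 = totalEnergy s ξ y ^ 2 - 4 * phi s ‖y‖ ^ 2 by linarith]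
  field_simp
  ring

/-- The momentum of the first particle of the pair. -/
def legPlus (s : ℝ) (ξ y : E) : E := (2⁻¹ : ℝ) • ξ + boost s ξ y

/-- The momentum of the second particle of the pair. -/
def legMinus (s : ℝ) (ξ y : E) : E := (2⁻¹ : ℝ) • ξ - boost s ξ y

theorem legPlus_add_legMinus (s : ℝ) (ξ y : E) : legPlus s ξ y + legMinus s ξ y = ξ := by
  rw [legPlus, legMinus, add_add_sub_cancel, ← add_smul]; norm_num

/-- The four-momentum of the particle is half of `(totalEnergy, ξ)` plus the boosted `(0, y)`;
orthogonality and the two Minkowski squares put it on the mass shell. -/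
theorem phi_legPlus {s : ℝ} (hs : 0 < s) (ξ y : E) :
    phi s ‖legPlus s ξ y‖ = totalEnergy s ξ y / 2 + skewEnergy s ξ y := by
  have h := abs_lt.1 (abs_skewEnergy_lt hs ξ y)
  rw [phi, Real.sqrt_eq_iff_mul_self_eq (by positivity) (by linarith)]
  rw [legPlus, norm_add_sq_real, real_inner_smul_left, real_inner_comm, inner_boost hs,
    norm_boost_sq hs, norm_smul, mul_pow]
  have := totalEnergy_sq s ξ y
  rw [phi_sq] at this
  norm_num
  linarith

theorem phi_legMinus {s : ℝ} (hs : 0 < s) (ξ y : E) :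
    phi s ‖legMinus s ξ y‖ = totalEnergy s ξ y / 2 - skewEnergy s ξ y := by
  have h := abs_lt.1 (abs_skewEnergy_lt hs ξ y)
  rw [phi, Real.sqrt_eq_iff_mul_self_eq (by positivity) (by linarith)]
  rw [legMinus, norm_sub_sq_real, real_inner_smul_left, real_inner_comm, inner_boost hs,
    norm_boost_sq hs, norm_smul, mul_pow]
  have := totalEnergy_sq s ξ y
  rw [phi_sq] at this
  norm_num
  linarith

theorem phi_legPlus_add_phi_legMinus {s : ℝ} (hs : 0 < s) (ξ y : E) :
    phi s ‖legPlus s ξ y‖ + phi s ‖legMinus s ξ y‖ = totalEnergy s ξ y := by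
  rw [phi_legPlus hs, phi_legMinus hs]; ring

/-- The Minkowski product of the two momenta is a function of the relative momentum. -/
theorem minkowski_legs {s : ℝ} (hs : 0 < s) (ξ y : E) :
    phi s ‖legPlus s ξ y‖ * phi s ‖legMinus s ξ y‖ - inner ℝ (legPlus s ξ y) (legMinus s ξ y) =
      s ^ 2 + 2 * ‖y‖ ^ 2 := by
  rw [phi_legPlus hs, phi_legMinus hs, legPlus, legMinus, inner_sub_right, inner_add_left,
    inner_add_left, real_inner_smul_left, real_inner_smul_right, real_inner_smul_left,
    real_inner_smul_right, real_inner_self_eq_norm_sq, real_inner_self_eq_norm_sq,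
    real_inner_comm ξ, norm_boost_sq hs]
  have := totalEnergy_sq s ξ y
  rw [phi_sq] at this
  linear_combination this / 4

/-- Lorentz invariance of the momentum transfer. -/
theorem minkowski_transfer {s : ℝ} (hs : 0 < s) (ξ y z : E) (h : ‖y‖ = ‖z‖) :
    (phi s ‖legPlus s ξ y‖ - phi s ‖legMinus s ξ z‖) ^ 2 -
      ‖legPlus s ξ y - legMinus s ξ z‖ ^ 2 = -‖y + z‖ ^ 2 := by
  have e1 : totalEnergy s ξ z = totalEnergy s ξ y := by rw [totalEnergy, totalEnergy, h]
  have e2 : skewEnergy s ξ y + skewEnergy s ξ z = inner ℝ (y + z) ξ / (2 * phi s ‖y‖) := by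
    rw [skewEnergy, skewEnergy, ← h, inner_add_left, add_div]
  have e3 : legPlus s ξ y - legMinus s ξ z = (y + z) + (inner ℝ (y + z) ξ / (2 * phi s ‖y‖) /
      (totalEnergy s ξ y + 2 * phi s ‖y‖)) • ξ := by
    rw [← e2, add_div, add_smul, legPlus, legMinus, boost, boost, boostCoeff_eq, boostCoeff_eq,
      e1, ← h]
    abel
  have h1 := phi_pos hs ‖y‖
  have h2 := totalEnergy_pos hs ξ y
  have h3 := totalEnergy_sq s ξ y
  rw [phi_legPlus hs, phi_legMinus hs, e1, show totalEnergy s ξ y / 2 + skewEnergy s ξ y -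
    (totalEnergy s ξ y / 2 - skewEnergy s ξ z) = skewEnergy s ξ y + skewEnergy s ξ z by ring, e2, e3,
    norm_add_sq_real, real_inner_smul_right, norm_smul, mul_pow, Real.norm_eq_abs, sq_abs,
    show ‖ξ‖ ^ 2 = totalEnergy s ξ y ^ 2 - 4 * phi s ‖y‖ ^ 2 by linarith]
  field_simp
  ring

/-- The two legs determine the total and the skew energy, hence `phi s ‖y‖` and the boost
coefficient, and then `y` by subtraction. -/
theorem boost_injective {s : ℝ} (hs : 0 < s) (ξ : E) : Function.Injective (boost s ξ) := by
  intro y z h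
  have hp : legPlus s ξ y = legPlus s ξ z := by rw [legPlus, legPlus, h]
  have hm : legMinus s ξ y = legMinus s ξ z := by rw [legMinus, legMinus, h]
  have h1 : totalEnergy s ξ y = totalEnergy s ξ z := by
    rw [← phi_legPlus_add_phi_legMinus hs, hp, hm, phi_legPlus_add_phi_legMinus hs]
  have h2 : skewEnergy s ξ y = skewEnergy s ξ z := by
    have a := phi_legPlus hs ξ y
    rw [hp, phi_legPlus hs] at a
    linarith
  have h3 : phi s ‖y‖ = phi s ‖z‖ := by
    have a := totalEnergy_sq s ξ y
    rw [h1, totalEnergy_sq s ξ z] at a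
    rw [← sq_eq_sq₀ (phi_pos hs _).le (phi_pos hs _).le]
    linarith
  have h4 : boostCoeff s ξ y = boostCoeff s ξ z := by
    rw [boostCoeff_eq, boostCoeff_eq, h1, h2, h3]
  simpa [boost, h4] using h

theorem boost_surjective {s : ℝ} (hs : 0 < s) (ξ : E) : Function.Surjective (boost s ξ) := by
  intro ζ
  set a := phi s ‖(2⁻¹ : ℝ) • ξ + ζ‖ with ha
  set b := phi s ‖(2⁻¹ : ℝ) • ξ - ζ‖ with hb
  have ha0 : 0 < a := phi_pos hs _
  have hb0 : 0 < b := phi_pos hs _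
  have ha2 : a ^ 2 = s ^ 2 + (‖ξ‖ ^ 2 / 4 + inner ℝ ζ ξ + ‖ζ‖ ^ 2) := by
    rw [ha, phi_sq, norm_add_sq_real, real_inner_smul_left, norm_smul, mul_pow, real_inner_comm]
    norm_num; ring
  have hb2 : b ^ 2 = s ^ 2 + (‖ξ‖ ^ 2 / 4 - inner ℝ ζ ξ + ‖ζ‖ ^ 2) := by
    rw [hb, phi_sq, norm_sub_sq_real, real_inner_smul_left, norm_smul, mul_pow, real_inner_comm]
    norm_num; ring
  have hξ : ‖ξ‖ < a + b := by
    have h1 := lt_phi hs ‖(2⁻¹ : ℝ) • ξ + ζ‖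
    have h2 := lt_phi hs ‖(2⁻¹ : ℝ) • ξ - ζ‖
    have h3 := norm_add_le ((2⁻¹ : ℝ) • ξ + ζ) ((2⁻¹ : ℝ) • ξ - ζ)
    rw [add_add_sub_cancel, ← add_smul] at h3
    norm_num at h3
    linarith
  -- The energies of the legs are `a` and `b`, so `q` is the invariant mass of the pair and must
  -- equal `2 * phi s ‖y‖`.
  set q := Real.sqrt ((a + b) ^ 2 - ‖ξ‖ ^ 2) with hq
  have hq0 : 0 < q := Real.sqrt_pos.2 (by nlinarith [norm_nonneg ξ])
  have hq2 : q ^ 2 = (a + b) ^ 2 - ‖ξ‖ ^ 2 := Real.sq_sqrt (by nlinarith [norm_nonneg ξ])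
  have hin : inner ℝ ζ ξ = (a + b) * ((a - b) / 2) := by linarith
  -- The inverse boost applied to `((a - b) / 2, ζ)`.
  set y := ζ - ((a - b) / 2 / (a + b + q)) • ξ with hy
  have hyξ : inner ℝ y ξ = (a - b) / 2 * q := by
    rw [hy, inner_sub_left, real_inner_smul_left, real_inner_self_eq_norm_sq, hin,
      show ‖ξ‖ ^ 2 = (a + b) ^ 2 - q ^ 2 by linarith]
    field_simp
    ring
  have hyn : s ^ 2 + ‖y‖ ^ 2 = q ^ 2 / 4 := by
    have : ‖y‖ ^ 2 = ‖ζ‖ ^ 2 - ((a - b) / 2) ^ 2 := by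
      rw [hy, norm_sub_sq_real, real_inner_smul_right, norm_smul, mul_pow, Real.norm_eq_abs, sq_abs,
        hin, show ‖ξ‖ ^ 2 = (a + b) ^ 2 - q ^ 2 by linarith]
      field_simp
      ring
    rw [this]
    linarith
  have hphi : phi s ‖y‖ = q / 2 := by
    rw [phi, hyn, show q ^ 2 / 4 = (q / 2) ^ 2 by ring, Real.sqrt_sq (by positivity)]
  have htot : totalEnergy s ξ y = a + b := by
    rw [totalEnergy, hyn, show ‖ξ‖ ^ 2 + 4 * (q ^ 2 / 4) = (a + b) ^ 2 by linarith,
      Real.sqrt_sq (by positivity)]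
  refine ⟨y, ?_⟩
  have : boostCoeff s ξ y = (a - b) / 2 / (a + b + q) := by
    rw [boostCoeff, hyξ, hphi, htot]
    field_simp
  rw [boost, this, hy, sub_add_cancel]

/-- The boost moves `y` only along the fixed vector `ξ`, so its derivative is a rank-one
perturbation of the identity. The number `1 + L ξ` is its determinant, and it simplifies to the
ratio of energies that makes the phase space measure invariant. -/
theorem hasFDerivAt_boost {s : ℝ} (hs : 0 < s) (ξ y : E) :
    ∃ L : E →L[ℝ] ℝ, HasFDerivAt (boost s ξ) (ContinuousLinearMap.id ℝ E + L.smulRight ξ) y ∧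
      1 + L ξ = 4 * (phi s ‖legPlus s ξ y‖ * phi s ‖legMinus s ξ y‖) /
        (totalEnergy s ξ y * (2 * phi s ‖y‖)) := by
  have h1 := phi_pos hs ‖y‖
  have h2 := totalEnergy_pos hs ξ y
  have h3 := totalEnergy_sq s ξ y
  have dN : HasFDerivAt (fun y : E => ‖y‖ ^ 2) (2 • (innerSL ℝ y)) y :=
    (hasStrictFDerivAt_norm_sq y).hasFDerivAt
  have dphi := (dN.const_add (s ^ 2)).sqrt (by positivity)
  have dtot := (((dN.const_add (s ^ 2)).const_mul 4).const_add (‖ξ‖ ^ 2)).sqrt (by positivity)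
  have din : HasFDerivAt (fun y : E => inner ℝ y ξ) (innerSL ℝ ξ) y := by
    have := (innerSL ℝ ξ).hasFDerivAt (x := y)
    refine this.congr_of_eventuallyEq (Filter.Eventually.of_forall fun z => ?_)
    simp [real_inner_comm]
  have dden := (dphi.const_mul 2).mul (dtot.add (dphi.const_mul 2))
  have dinv := (hasDerivAt_inv (x := (2 * phi s ‖y‖) * (totalEnergy s ξ y + 2 * phi s ‖y‖))
    (by positivity)).comp_hasFDerivAt y dden
  have dk := din.mul dinv
  have hb := (hasFDerivAt_id y).add (dk.smul_const ξ)
  refine ⟨_, hb.congr_of_eventuallyEq (Filter.Eventually.of_forall fun z => ?_), ?_⟩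
  · simp [boost, boostCoeff, phi, totalEnergy, div_eq_mul_inv]
  · have e1 : √(s ^ 2 + ‖y‖ ^ 2) = phi s ‖y‖ := rfl
    have e2 : √(‖ξ‖ ^ 2 + 4 * (s ^ 2 + ‖y‖ ^ 2)) = totalEnergy s ξ y := rfl
    rw [phi_legPlus hs, phi_legMinus hs]
    simp only [e1, e2, Function.comp_apply, add_apply, smul_apply, innerSL_apply_apply, smul_eq_mul, nsmul_eq_mul, skewEnergy,
      real_inner_self_eq_norm_sq, Nat.cast_ofNat, Pi.add_apply, Pi.mul_apply]
    rw [show ‖ξ‖ ^ 2 = totalEnergy s ξ y ^ 2 - 4 * phi s ‖y‖ ^ 2 by linarith]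
    field_simp
    ring

end Geometry

/-! ### Two-particle phase space in centre-of-mass coordinates -/

section CentreOfMass

variable {E : Type*} [NormedAddCommGroup E] [InnerProductSpace ℝ E] [FiniteDimensional ℝ E]
  [MeasurableSpace E] [BorelSpace E]

theorem continuous_totalEnergy (s : ℝ) : Continuous fun p : E × E => totalEnergy s p.1 p.2 := by
  unfold totalEnergy; fun_prop

theorem continuous_boost {s : ℝ} (hs : 0 < s) : Continuous fun p : E × E => boost s p.1 p.2 := by
  unfold boost boostCoeff
  have h1 := continuous_totalEnergy (E := E) s
  have h2 := continuous_phi s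
  have h3 : ∀ p : E × E, 2 * phi s ‖p.2‖ * (totalEnergy s p.1 p.2 + 2 * phi s ‖p.2‖) ≠ 0 := by
    intro p
    have := phi_pos hs ‖p.2‖
    have := totalEnergy_pos hs p.1 p.2
    positivity
  fun_prop (disch := assumption)

theorem continuous_legPlus {s : ℝ} (hs : 0 < s) :
    Continuous fun p : E × E => legPlus s p.1 p.2 :=
  (continuous_fst.const_smul _).add (continuous_boost hs)

theorem continuous_legMinus {s : ℝ} (hs : 0 < s) :
    Continuous fun p : E × E => legMinus s p.1 p.2 :=
  (continuous_fst.const_smul _).sub (continuous_boost hs)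

theorem lintegral_boost {s : ℝ} (hs : 0 < s) (ξ : E) (g : E → ℝ≥0∞) :
    ∫⁻ ζ, g ζ = ∫⁻ y, ENNReal.ofReal (4 * (phi s ‖legPlus s ξ y‖ * phi s ‖legMinus s ξ y‖) /
        (totalEnergy s ξ y * (2 * phi s ‖y‖))) * g (boost s ξ y) := by
  choose L hL hL' using hasFDerivAt_boost hs ξ
  have := lintegral_image_eq_lintegral_abs_det_fderiv_mul volume MeasurableSet.univ
    (fun y _ => (hL y).hasFDerivWithinAt) (boost_injective hs ξ).injOn g
  rw [Set.image_univ, (boost_surjective hs ξ).range_eq, Measure.restrict_univ] at this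
  rw [this]
  refine lintegral_congr fun y => ?_
  -- The derivative is a transvection map `z ↦ z + L(z) ξ`, of determinant `1 + L ξ`.
  have e : ((ContinuousLinearMap.id ℝ E + (L y).smulRight ξ).toLinearMap) =
      LinearMap.transvection (L y).toLinearMap ξ := by
    ext z; simp [LinearMap.transvection]
  have hd : (ContinuousLinearMap.id ℝ E + (L y).smulRight ξ).det = 1 + L y ξ := by
    rw [ContinuousLinearMap.det, e, LinearMap.transvection.det]; rfl
  have h1 := phi_pos hs ‖y‖
  have h2 := totalEnergy_pos hs ξ y
  have h3 := phi_pos hs ‖legPlus s ξ y‖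
  have h4 := phi_pos hs ‖legMinus s ξ y‖
  rw [hd, hL' y, abs_of_pos (by positivity)]

theorem lintegral_polar [Nontrivial E] {g : E → ℝ≥0∞} (hg : Measurable g) :
    ∫⁻ y, g y = ∫⁻ ω : Metric.sphere (0 : E) 1, (∫⁻ r in Set.Ioi (0 : ℝ),
      ENNReal.ofReal (r ^ (Module.finrank ℝ E - 1)) * g (r • (ω : E))) ∂volume.toSphere := by
  have hmp := (volume : Measure E).measurePreserving_homeomorphUnitSphereProd
  have hm : Measurable fun p : Metric.sphere (0 : E) 1 × Set.Ioi (0 : ℝ) =>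
      g ((p.2 : ℝ) • (p.1 : E)) := by
    refine hg.comp (Continuous.measurable ?_)
    fun_prop
  calc ∫⁻ y, g y = ∫⁻ y in {(0 : E)}ᶜ, g y := by rw [restrict_compl_singleton]
    _ = ∫⁻ y : ({(0 : E)}ᶜ : Set E), g (y : E) ∂((volume : Measure E).comap Subtype.val) := by
      rw [lintegral_subtype_comap (measurableSet_singleton _).compl]
    _ = ∫⁻ p : Metric.sphere (0 : E) 1 × Set.Ioi (0 : ℝ), g ((p.2 : ℝ) • (p.1 : E))
        ∂((volume : Measure E).toSphere.prod (Measure.volumeIoiPow (Module.finrank ℝ E - 1))) := by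
      rw [← hmp.lintegral_comp hm]
      refine lintegral_congr fun y => ?_
      congr 1
      have : ‖(y : E)‖ ≠ 0 := norm_ne_zero_iff.2 y.2
      simp [smul_smul, this]
    _ = _ := by
      rw [lintegral_prod _ hm.aemeasurable]
      refine lintegral_congr fun ω => ?_
      have hm' : Measurable fun r : ℝ => g (r • (ω : E)) := by fun_prop
      change ∫⁻ r, ((fun r : ℝ => g (r • (ω : E))) ∘ Subtype.val) r ∂_ = _
      rw [Measure.volumeIoiPow, lintegral_withDensity_eq_lintegral_mul _ (by fun_prop)
        (hm'.comp measurable_subtype_coe)]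
      simp only [Pi.mul_apply, Function.comp_apply]
      rw [lintegral_subtype_comap measurableSet_Ioi
        fun r : ℝ => ENNReal.ofReal (r ^ (Module.finrank ℝ E - 1)) * g (r • (ω : E))]

/-- The momentum in the centre-of-mass frame of two particles with total energy-momentum `q`. -/
def cmRadius (s : ℝ) (q : ℝ × E) : ℝ := Real.sqrt ((q.1 ^ 2 - ‖q.2‖ ^ 2) / 4 - s ^ 2)

/-- Two-body phase space density at total energy-momentum `q`. -/
def cmDensity (s : ℝ) (q : ℝ × E) : ℝ :=
  if Real.sqrt (‖q.2‖ ^ 2 + 4 * s ^ 2) < q.1 then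
    cmRadius s q ^ (Module.finrank ℝ E - 2) / Real.sqrt (q.1 ^ 2 - ‖q.2‖ ^ 2) else 0

theorem cmDensity_nonneg (s : ℝ) (q : ℝ × E) : 0 ≤ cmDensity s q := by
  unfold cmDensity cmRadius
  split_ifs <;> positivity

theorem measurable_cmRadius (s : ℝ) : Measurable (cmRadius (E := E) s) := by
  unfold cmRadius; fun_prop

theorem measurable_cmDensity (s : ℝ) : Measurable (cmDensity (E := E) s) := by
  unfold cmDensity
  refine Measurable.ite (measurableSet_lt (by fun_prop) (by fun_prop)) ?_ measurable_const
  have := measurable_cmRadius (E := E) s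
  fun_prop

/-- At fixed total momentum, `τ² = ‖ξ‖² + 4s² + 4r²`, whence `dr = τ / (4r) dτ`. -/
theorem lintegral_radius_eq_lintegral_energy {s : ℝ} (hs : 0 < s) (ξ : E) (g : ℝ → ℝ≥0∞) :
    ∫⁻ r in Set.Ioi (0 : ℝ), g r = ∫⁻ τ in Set.Ioi (Real.sqrt (‖ξ‖ ^ 2 + 4 * s ^ 2)),
      ENNReal.ofReal (τ / (4 * cmRadius s (τ, ξ))) * g (cmRadius s (τ, ξ)) := by
  set a := Real.sqrt (‖ξ‖ ^ 2 + 4 * s ^ 2) with ha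
  have ha2 : a ^ 2 = ‖ξ‖ ^ 2 + 4 * s ^ 2 := Real.sq_sqrt (by positivity)
  have ha0 : 0 < a := Real.sqrt_pos.2 (by positivity)
  have hpos : ∀ τ ∈ Set.Ioi a, 0 < (τ ^ 2 - ‖ξ‖ ^ 2) / 4 - s ^ 2 := by
    intro τ hτ
    have : a < τ := hτ
    nlinarith
  have himg : (fun τ => cmRadius s (τ, ξ)) '' Set.Ioi a = Set.Ioi 0 := by
    ext r
    constructor
    · rintro ⟨τ, hτ, rfl⟩
      exact Real.sqrt_pos.2 (hpos τ hτ)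
    · intro hr
      have hr : 0 < r := hr
      refine ⟨Real.sqrt (‖ξ‖ ^ 2 + 4 * s ^ 2 + 4 * r ^ 2), ?_, ?_⟩
      · exact Real.sqrt_lt_sqrt (by positivity) (by nlinarith)
      · simp only [cmRadius]
        rw [Real.sq_sqrt (by positivity), show (‖ξ‖ ^ 2 + 4 * s ^ 2 + 4 * r ^ 2 - ‖ξ‖ ^ 2) / 4 - s ^ 2
          = r ^ 2 by ring, Real.sqrt_sq hr.le]
  have hder : ∀ τ ∈ Set.Ioi a, HasDerivWithinAt (fun τ => cmRadius s (τ, ξ))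
      (τ / (4 * cmRadius s (τ, ξ))) (Set.Ioi a) τ := by
    intro τ hτ
    have h1 : HasDerivAt (fun τ : ℝ => (τ ^ 2 - ‖ξ‖ ^ 2) / 4 - s ^ 2) (2 * τ / 4) τ := by
      simpa using (((hasDerivAt_pow 2 τ).sub_const (‖ξ‖ ^ 2)).div_const 4).sub_const (s ^ 2)
    have h2 := h1.sqrt (hpos τ hτ).ne'
    have h3 : 0 < cmRadius s (τ, ξ) := Real.sqrt_pos.2 (hpos τ hτ)
    convert! h2.hasDerivWithinAt using 1
    change _ = 2 * τ / 4 / (2 * cmRadius s (τ, ξ))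
    field_simp
  have hinj : Set.InjOn (fun τ => cmRadius s (τ, ξ)) (Set.Ioi a) := by
    intro τ hτ τ' hτ' h
    have h1 : a < τ := hτ
    have h2 : a < τ' := hτ'
    have := (Real.sqrt_inj (hpos τ hτ).le (hpos τ' hτ').le).1 h
    rw [← sq_eq_sq₀ (by linarith) (by linarith)]
    linarith
  have := lintegral_image_eq_lintegral_abs_deriv_mul measurableSet_Ioi hder hinj g
  rw [himg] at this
  rw [this]
  refine setLIntegral_congr_fun measurableSet_Ioi fun τ hτ => ?_
  have h1 : a < τ := hτ
  have h3 : 0 < cmRadius s (τ, ξ) := Real.sqrt_pos.2 (hpos τ hτ)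
  rw [abs_of_nonneg (div_nonneg (by linarith) (by positivity))]

theorem totalEnergy_cmRadius_smul {s : ℝ} {q : ℝ × E}
    (hq : Real.sqrt (‖q.2‖ ^ 2 + 4 * s ^ 2) < q.1) (ω : Metric.sphere (0 : E) 1) :
    totalEnergy s q.2 (cmRadius s q • (ω : E)) = q.1 := by
  have h0 : 0 ≤ Real.sqrt (‖q.2‖ ^ 2 + 4 * s ^ 2) := Real.sqrt_nonneg _
  have h1 : ‖q.2‖ ^ 2 + 4 * s ^ 2 < q.1 ^ 2 := (Real.sqrt_lt' (by linarith)).1 hq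
  have h2 : ‖(ω : E)‖ = 1 := by simp
  rw [totalEnergy, norm_smul, h2, mul_one, Real.norm_eq_abs, sq_abs, cmRadius,
    Real.sq_sqrt (by linarith), show ‖q.2‖ ^ 2 + 4 * (s ^ 2 + ((q.1 ^ 2 - ‖q.2‖ ^ 2) / 4 - s ^ 2)) =
      q.1 ^ 2 by ring, Real.sqrt_sq (by linarith)]

theorem phi_cmRadius {s : ℝ} {q : ℝ × E}
    (hq : Real.sqrt (‖q.2‖ ^ 2 + 4 * s ^ 2) < q.1) :
    2 * phi s (cmRadius s q) = Real.sqrt (q.1 ^ 2 - ‖q.2‖ ^ 2) := by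
  have h0 : 0 ≤ Real.sqrt (‖q.2‖ ^ 2 + 4 * s ^ 2) := Real.sqrt_nonneg _
  have h1 : ‖q.2‖ ^ 2 + 4 * s ^ 2 < q.1 ^ 2 := (Real.sqrt_lt' (by linarith)).1 hq
  symm
  have h2 : 0 ≤ phi s (cmRadius s q) := Real.sqrt_nonneg _
  rw [Real.sqrt_eq_iff_mul_self_eq (by nlinarith) (by positivity)]
  have := phi_sq s (cmRadius s q)
  rw [cmRadius, Real.sq_sqrt (by linarith), ← cmRadius] at this
  linarith

/-- Momenta of the two particles with total energy-momentum `q` and direction `ω` in the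
centre-of-mass frame. -/
def pairPlus (s : ℝ) (q : ℝ × E) (ω : Metric.sphere (0 : E) 1) : E :=
  legPlus s q.2 (cmRadius s q • (ω : E))

/-- The second momentum of a pair of total energy-momentum `q` and direction `ω`. -/
def pairMinus (s : ℝ) (q : ℝ × E) (ω : Metric.sphere (0 : E) 1) : E :=
  legMinus s q.2 (cmRadius s q • (ω : E))

theorem measurable_pairPlus {s : ℝ} (hs : 0 < s) :
    Measurable fun p : (ℝ × E) × Metric.sphere (0 : E) 1 => pairPlus s p.1 p.2 := by
  have := measurable_cmRadius (E := E) s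
  exact (continuous_legPlus hs).measurable.comp (by fun_prop :
    Measurable fun p : (ℝ × E) × Metric.sphere (0 : E) 1 => (p.1.2, cmRadius s p.1 • (p.2 : E)))

theorem measurable_pairMinus {s : ℝ} (hs : 0 < s) :
    Measurable fun p : (ℝ × E) × Metric.sphere (0 : E) 1 => pairMinus s p.1 p.2 := by
  have := measurable_cmRadius (E := E) s
  exact (continuous_legMinus hs).measurable.comp (by fun_prop :
    Measurable fun p : (ℝ × E) × Metric.sphere (0 : E) 1 => (p.1.2, cmRadius s p.1 • (p.2 : E)))

/-- The total momentum `ξ` and the deviation `ζ` from `ξ/2` are coordinates of unit Jacobian; `ζ` is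
then replaced by the centre-of-mass momentum through the boost. -/
theorem lintegral_pair_eq_lintegral_legs {s : ℝ} (hs : 0 < s) {H : E × E → ℝ≥0∞}
    (hH : Measurable H) :
    ∫⁻ p, H p = ∫⁻ ξ : E, ∫⁻ y : E,
      ENNReal.ofReal (4 * (phi s ‖legPlus s ξ y‖ * phi s ‖legMinus s ξ y‖) /
        (totalEnergy s ξ y * (2 * phi s ‖y‖))) * H (legPlus s ξ y, legMinus s ξ y) := by
  calc ∫⁻ p, H p = ∫⁻ x : E, ∫⁻ ξ : E, H (x, ξ - x) := by
        rw [Measure.volume_eq_prod, lintegral_prod _ hH.aemeasurable]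
        refine lintegral_congr fun x => ?_
        rw [lintegral_sub_right_eq_self (fun z => H (x, z)) x]
    _ = ∫⁻ ξ : E, ∫⁻ x : E, H (x, ξ - x) := by
        rw [lintegral_lintegral_swap]
        exact (hH.comp (by fun_prop : Measurable fun p : E × E => (p.1, p.2 - p.1))).aemeasurable
    _ = ∫⁻ ξ : E, ∫⁻ ζ : E, H ((2⁻¹ : ℝ) • ξ + ζ, (2⁻¹ : ℝ) • ξ - ζ) := by
        refine lintegral_congr fun ξ => ?_
        rw [← lintegral_add_left_eq_self _ ((2⁻¹ : ℝ) • ξ)]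
        refine lintegral_congr fun ζ => ?_
        congr 2
        rw [← sub_sub]
        congr 1
        rw [sub_eq_iff_eq_add, ← add_smul]
        norm_num
    _ = _ := by
        refine lintegral_congr fun ξ => ?_
        rw [lintegral_boost hs ξ]
        rfl

/-- After the boost, polar coordinates in the centre-of-mass momentum and the passage from radius to
total energy leave only the direction as a fibre variable. Apart from the two particle energies the
resulting density depends on `q` alone, which is what makes the later problem one on a sphere with a
rotation-invariant kernel. -/
theorem lintegral_pair {s : ℝ} (hs : 0 < s) (hd : 2 ≤ Module.finrank ℝ E) {H : E × E → ℝ≥0∞}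
    (hH : Measurable H) :
    ∫⁻ p, H p = ∫⁻ q : ℝ × E, ∫⁻ ω, ENNReal.ofReal (cmDensity s q *
      (phi s ‖pairPlus s q ω‖ * phi s ‖pairMinus s q ω‖)) *
        H (pairPlus s q ω, pairMinus s q ω) ∂volume.toSphere := by
  have : Nontrivial E := Module.nontrivial_of_finrank_pos (R := ℝ) (by omega)
  have hphi := continuous_phi s
  have hp := measurable_pairPlus (E := E) hs
  have hm := measurable_pairMinus (E := E) hs
  have hD := measurable_cmDensity (E := E) s
  have hmeas : Measurable fun p : (ℝ × E) × Metric.sphere (0 : E) 1 =>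
      ENNReal.ofReal (cmDensity s p.1 *
      (phi s ‖pairPlus s p.1 p.2‖ * phi s ‖pairMinus s p.1 p.2‖)) *
        H (pairPlus s p.1 p.2, pairMinus s p.1 p.2) := by
    have := hphi.measurable
    fun_prop
  rw [lintegral_pair_eq_lintegral_legs hs hH, Measure.volume_eq_prod,
    lintegral_prod_symm _ (hmeas.lintegral_prod_right').aemeasurable]
  refine lintegral_congr fun ξ => ?_
  have hlp := continuous_legPlus (E := E) hs
  have hlm := continuous_legMinus (E := E) hs
  have hlp' : Continuous fun y : E => legPlus s ξ y :=
    hlp.comp (by fun_prop : Continuous fun y : E => (ξ, y))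
  have hlm' : Continuous fun y : E => legMinus s ξ y :=
    hlm.comp (by fun_prop : Continuous fun y : E => (ξ, y))
  have hte : Continuous fun y : E => totalEnergy s ξ y :=
    (continuous_totalEnergy s).comp (by fun_prop : Continuous fun y : E => (ξ, y))
  rw [lintegral_polar (by have := hphi.measurable; have := hlp'.measurable
                          have := hlm'.measurable; have := hte.measurable; fun_prop)]
  symm
  rw [lintegral_lintegral_swap]
  swap
  · exact (hmeas.comp (by fun_prop :
      Measurable fun p : ℝ × Metric.sphere (0 : E) 1 => ((p.1, ξ), p.2))).aemeasurable
  refine lintegral_congr fun ω => ?_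
  symm
  rw [lintegral_radius_eq_lintegral_energy hs ξ, ← lintegral_indicator measurableSet_Ioi]
  refine lintegral_congr fun τ => ?_
  by_cases hτ : Real.sqrt (‖ξ‖ ^ 2 + 4 * s ^ 2) < τ
  · rw [Set.indicator_of_mem (show τ ∈ Set.Ioi _ from hτ)]
    have hr : 0 < cmRadius s (τ, ξ) := by
      refine Real.sqrt_pos.2 ?_
      have := (Real.sqrt_lt' (by have := Real.sqrt_nonneg (‖ξ‖ ^ 2 + 4 * s ^ 2); linarith)).1 hτ
      simp only
      linarith
    have h1 := totalEnergy_cmRadius_smul (q := (τ, ξ)) hτ ω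
    have h2 : ‖cmRadius s (τ, ξ) • (ω : E)‖ = cmRadius s (τ, ξ) := by
      rw [norm_smul, Real.norm_of_nonneg hr.le]; simp
    have h3 := phi_cmRadius (q := (τ, ξ)) hτ
    have hτ0 : 0 < τ := lt_of_le_of_lt (Real.sqrt_nonneg _) hτ
    have h4 : 0 < √(τ ^ 2 - ‖ξ‖ ^ 2) := by
      have h3' : 2 * phi s (cmRadius s (τ, ξ)) = √(τ ^ 2 - ‖ξ‖ ^ 2) := h3
      rw [← h3']; have := phi_pos hs (cmRadius s (τ, ξ)); positivity
    rw [← mul_assoc, ← mul_assoc, ← ENNReal.ofReal_mul (by positivity),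
      ← ENNReal.ofReal_mul (by positivity)]
    simp only [pairPlus, pairMinus] at *
    rw [h1, h2, h3, cmDensity, if_pos hτ]
    -- The powers of the radius combine as `r^(n-1) · τ/(4r)`, and `τ` cancels the total energy in
    -- the Jacobian of the boost; what remains is `r^(n-2) / √(τ² - ‖ξ‖²)`.
    congr 2
    obtain ⟨k, hk⟩ : ∃ k, Module.finrank ℝ E = k + 2 := ⟨_, (Nat.sub_add_cancel hd).symm⟩
    rw [hk, show k + 2 - 1 = k + 1 by omega, Nat.add_sub_cancel]
    simp only
    field_simp
    ring
  · rw [Set.indicator_of_notMem (by simpa using hτ), cmDensity, if_neg hτ]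
    simp

end CentreOfMass

/-- The character `e^{2πit}`. -/
def wave (t : ℝ) : ℂ := Complex.exp ((2 * Real.pi * t : ℝ) * Complex.I)

@[simp]
theorem norm_wave (t : ℝ) : ‖wave t‖ = 1 := Complex.norm_exp_ofReal_mul_I _

theorem wave_add (t u : ℝ) : wave (t + u) = wave t * wave u := by
  rw [wave, wave, wave, ← Complex.exp_add]
  congr 1
  push_cast
  ring

theorem conj_wave (t : ℝ) : conj (wave t) = wave (-t) := by
  rw [wave, wave, ← Complex.exp_conj, map_mul, Complex.conj_I, Complex.conj_ofReal]
  congr 1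
  push_cast
  ring

@[fun_prop]
theorem continuous_wave : Continuous wave := by
  unfold wave; fun_prop

theorem fourierChar_smul (t : ℝ) (z : ℂ) : Real.fourierChar t • z = wave t * z := by
  rw [Circle.smul_def, Real.fourierChar_apply, smul_eq_mul, wave]

/-! ### Schwartz cutoffs and identification of functions by testing -/

section TestFunctions

variable {V : Type*} [NormedAddCommGroup V] [NormedSpace ℝ V] [FiniteDimensional ℝ V]

open scoped Manifold in
/-- Smooth Urysohn lemma, with a Schwartz function. -/
theorem exists_schwartz_cutoff {K U : Set V} (hK : IsCompact K) (hU : IsOpen U) (hKU : K ⊆ U) :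
    ∃ (ψ : 𝓢(V, ℂ)) (g : V → ℝ), (∀ x, ψ x = g x) ∧ (∀ x, g x ∈ Set.Icc (0 : ℝ) 1) ∧
      (∀ x ∈ K, g x = 1) ∧ ∀ x ∉ U, g x = 0 := by
  obtain ⟨R, hR⟩ := hK.isBounded.subset_ball (0 : V)
  obtain ⟨f, h0, h1, hf⟩ := exists_contMDiffMap_zero_one_of_isClosed (n := (⊤ : ℕ∞)) 𝓘(ℝ, V)
    (s := (U ∩ Metric.ball 0 R)ᶜ) (t := K) (hU.inter Metric.isOpen_ball).isClosed_compl
    hK.isClosed (Set.disjoint_left.2 fun x hx hx' => hx ⟨hKU hx', hR hx'⟩)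
  have hsm : ContDiff ℝ (⊤ : ℕ∞) f := f.contMDiff.contDiff
  have hcpt : HasCompactSupport f := by
    refine HasCompactSupport.of_support_subset_isCompact (isCompact_closedBall (0 : V) R) ?_
    intro x hx
    by_contra hx'
    refine hx (h0 fun hx'' => hx' (Metric.ball_subset_closedBall hx''.2))
  have hg₁ : HasCompactSupport (Complex.ofRealCLM ∘ f) := hcpt.comp_left rfl
  have hg₂ : ContDiff ℝ (⊤ : ℕ∞) (Complex.ofRealCLM ∘ f) := Complex.ofRealCLM.contDiff.comp hsm
  refine ⟨hg₁.toSchwartzMap hg₂, f, fun x => rfl, hf, fun x hx => h1 hx, fun x hx => ?_⟩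
  exact h0 fun hx' => hx hx'.1

variable [MeasurableSpace V] [BorelSpace V] {μ : Measure V}

theorem locallyIntegrable_of_schwartz {u : V → ℂ} (h : ∀ ψ : 𝓢(V, ℂ), Integrable (fun x => u x * ψ x) μ) :
    LocallyIntegrable u μ := by
  rw [locallyIntegrable_iff]
  intro K hK
  obtain ⟨ψ, g, hψ, -, h1, -⟩ := exists_schwartz_cutoff hK isOpen_univ (Set.subset_univ _)
  refine (h ψ).integrableOn.congr_fun (fun x hx => ?_) hK.measurableSet
  simp [hψ, h1 x hx]

theorem ae_eq_of_integral_schwartz {u v : V → ℂ} (hu : LocallyIntegrable u μ)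
    (hv : LocallyIntegrable v μ) (h : ∀ ψ : 𝓢(V, ℂ), ∫ x, u x * ψ x ∂μ = ∫ x, v x * ψ x ∂μ) :
    u =ᵐ[μ] v := by
  refine ae_eq_of_integral_contDiff_smul_eq hu hv fun g hg hgc => ?_
  have hg₁ : HasCompactSupport (Complex.ofRealCLM ∘ g) := hgc.comp_left rfl
  have hg₂ : ContDiff ℝ (⊤ : ℕ∞) (Complex.ofRealCLM ∘ g) := Complex.ofRealCLM.contDiff.comp hg
  have := h (hg₁.toSchwartzMap hg₂)
  simpa [mul_comm] using this

end TestFunctions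

/-! ### Fourier transform on `L²` by duality with Schwartz functions -/

section Plancherel

variable {V : Type*} [NormedAddCommGroup V] [InnerProductSpace ℝ V] [FiniteDimensional ℝ V]
  [MeasurableSpace V] [BorelSpace V]

theorem integral_fourier_Lp_mul (h : Lp ℂ 2 (volume : Measure V)) (ψ : 𝓢(V, ℂ)) :
    ∫ x, (𝓕 h : Lp ℂ 2 (volume : Measure V)) x * ψ x = ∫ x, h x * (𝓕 ψ) x := by
  have := congrArg (fun T => T ψ) (Lp.fourier_toTemperedDistribution_eq h)
  simp only [TemperedDistribution.fourier_apply, Lp.toTemperedDistribution_apply, smul_eq_mul] at this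
  simpa [mul_comm] using this.symm

/-- The criterion by which every concrete `L²` Fourier transform below is identified: it is enough
to know its pairing with Schwartz functions. -/
theorem fourier_Lp_ae_eq {h : Lp ℂ 2 (volume : Measure V)} {k : V → ℂ}
    (hk : LocallyIntegrable k) (H : ∀ ψ : 𝓢(V, ℂ), ∫ x, h x * (𝓕 ψ) x = ∫ x, k x * ψ x) :
    (𝓕 h : Lp ℂ 2 (volume : Measure V)) =ᵐ[volume] k := by
  refine ae_eq_of_integral_schwartz ((Lp.memLp _).locallyIntegrable (by norm_num)) hk fun ψ => ?_
  rw [integral_fourier_Lp_mul, H]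

theorem integral_mul_fourier_schwartz {f : V → ℂ} (hf : Integrable f) (ψ : 𝓢(V, ℂ)) :
    ∫ x, f x * (𝓕 ψ) x = ∫ x, 𝓕 f x * ψ x := by
  have := VectorFourier.integral_fourierIntegral_smul_eq_flip (L := innerₗ V)
      Real.continuous_fourierChar continuous_inner hf (ψ.integrable (μ := volume))
  simp only [smul_eq_mul, flip_innerₗ] at this
  exact this.symm

theorem fourier_toLp_ae_eq {f : V → ℂ} (hf : Integrable f) (hf2 : MemLp f 2) :
    (𝓕 (hf2.toLp f) : Lp ℂ 2 (volume : Measure V)) =ᵐ[volume] 𝓕 f := by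
  have hc : Continuous (𝓕 f) := VectorFourier.fourierIntegral_continuous
    Real.continuous_fourierChar continuous_inner hf
  refine fourier_Lp_ae_eq hc.locallyIntegrable fun ψ => ?_
  rw [← integral_mul_fourier_schwartz hf]
  refine integral_congr_ae ?_
  filter_upwards [hf2.coeFn_toLp] with x hx
  rw [hx]

theorem memLp_fourierChar_mul {h : V → ℂ} (hh : MemLp h 2) (a : V) :
    MemLp (fun x => wave (-inner ℝ x a) * h x) 2 := by
  refine hh.of_le (AEStronglyMeasurable.mul ?_ hh.aestronglyMeasurable) ?_
  · exact Continuous.aestronglyMeasurable (by fun_prop)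
  · exact Filter.Eventually.of_forall fun x => by simp

/-- Modulation becomes translation; by duality this reduces to the same rule for Schwartz test
functions. -/
theorem fourier_modulation (h : Lp ℂ 2 (volume : Measure V)) (a : V) :
    (𝓕 ((memLp_fourierChar_mul (Lp.memLp h) a).toLp _) : Lp ℂ 2 (volume : Measure V))
      =ᵐ[volume] fun κ => (𝓕 h : Lp ℂ 2 (volume : Measure V)) (κ + a) := by
  have hm : MemLp (fun κ => (𝓕 h : Lp ℂ 2 (volume : Measure V)) (κ + a)) 2 :=
    (Lp.memLp (𝓕 h)).comp_measurePreserving (measurePreserving_add_right volume a)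
  refine fourier_Lp_ae_eq (hm.locallyIntegrable (by norm_num)) fun ψ => ?_
  rw [← integral_sub_right_eq_self (fun κ => (𝓕 h : Lp ℂ 2 (volume : Measure V)) (κ + a) * ψ κ) a]
  simp only [sub_add_cancel]
  have := integral_fourier_Lp_mul h (ψ.compSubConstCLM ℂ a)
  simp only [SchwartzMap.compSubConstCLM_apply] at this
  rw [this]
  refine integral_congr_ae ?_
  filter_upwards [(memLp_fourierChar_mul (Lp.memLp h) a).coeFn_toLp] with x hx
  rw [hx, mul_comm (wave _), mul_assoc]
  congr 1
  rw [SchwartzMap.fourier_coe, SchwartzMap.fourier_coe, Real.fourier_eq, Real.fourier_eq,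
    ← integral_sub_right_eq_self (fun v => Real.fourierChar (-inner ℝ v x) • ψ v) a,
    ← integral_const_mul]
  refine integral_congr_ae (Filter.Eventually.of_forall fun v => ?_)
  simp only [SchwartzMap.compSubConstCLM_apply, fourierChar_smul, inner_sub_left]
  rw [← mul_assoc, ← wave_add, real_inner_comm]
  congr 2
  ring

/-- The Fourier transform of the product of an `L²` function and a conjugate `L²` function. -/
theorem integral_mul_conj_fourierChar (u v : Lp ℂ 2 (volume : Measure V)) (a : V) :
    ∫ x, wave (-inner ℝ x a) * (u x * conj (v x)) =
      ∫ κ, (𝓕 u : Lp ℂ 2 (volume : Measure V)) (κ + a) *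
        conj ((𝓕 v : Lp ℂ 2 (volume : Measure V)) κ) := by
  have := Lp.inner_fourier_eq v ((memLp_fourierChar_mul (Lp.memLp u) a).toLp _)
  rw [L2.inner_def, L2.inner_def] at this
  simp only [RCLike.inner_apply] at this
  calc _ = ∫ x, ((memLp_fourierChar_mul (Lp.memLp u) a).toLp _ : Lp ℂ 2 (volume : Measure V)) x
        * conj (v x) := by
        refine integral_congr_ae ?_
        filter_upwards [(memLp_fourierChar_mul (Lp.memLp u) a).coeFn_toLp] with x hx
        rw [hx, mul_assoc]
    _ = _ := this.symm
    _ = _ := by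
        refine integral_congr_ae ?_
        filter_upwards [fourier_modulation u a] with x hx
        rw [hx]

/-- A finite measure with square integrable Fourier transform has an `L²` density. -/
theorem eq_withDensity_of_memLp_fourier {μ : Measure V} [IsFiniteMeasure μ] {W : V → ℂ}
    (hW : MemLp W 2) (h : ∀ z, ∫ x, wave (-inner ℝ x z) ∂μ = W z) :
    ∃ m : V → ℝ≥0∞, Measurable m ∧ μ = volume.withDensity m ∧
      (𝓕⁻ (hW.toLp W) : Lp ℂ 2 (volume : Measure V)) =ᵐ[volume] fun x => ((m x).toReal : ℂ) := by
  set k : Lp ℂ 2 (volume : Measure V) := 𝓕⁻ (hW.toLp W) with hk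
  -- Parseval against `ψ = 𝓕 (𝓕⁻ ψ)`: Fubini for the finite measure on one side, self-adjointness of
  -- the `L²` transform on the other. As distributions, `μ` and `k` agree.
  have key : ∀ ψ : 𝓢(V, ℂ), ∫ x, ψ x ∂μ = ∫ x, k x * ψ x := by
    intro ψ
    have e1 : (𝓕 (𝓕⁻ ψ) : 𝓢(V, ℂ)) = ψ := fourier_fourierInv_eq ψ
    have e2 : (𝓕 k : Lp ℂ 2 (volume : Measure V)) = hW.toLp W := fourier_fourierInv_eq _
    have e3 := integral_fourier_Lp_mul k (𝓕⁻ ψ)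
    rw [e1, e2] at e3
    rw [← e3]
    have e4 : ∫ x, (hW.toLp W) x * (𝓕⁻ ψ : 𝓢(V, ℂ)) x = ∫ x, W x * (𝓕⁻ ψ : 𝓢(V, ℂ)) x := by
      refine integral_congr_ae ?_
      filter_upwards [hW.coeFn_toLp] with x hx
      rw [hx]
    rw [e4]
    have e5 := VectorFourier.integral_fourierIntegral_smul_eq_flip (L := innerₗ V) (μ := μ)
      (ν := volume) (f := fun _ => (1 : ℂ)) (g := (𝓕⁻ ψ : 𝓢(V, ℂ)))
      Real.continuous_fourierChar continuous_inner (integrable_const _)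
      (SchwartzMap.integrable _)
    simp only [smul_eq_mul, flip_innerₗ, one_mul, VectorFourier.fourierIntegral,
      fourierChar_smul, mul_one, innerₗ_apply_apply, h] at e5
    rw [e5]
    refine integral_congr_ae (Filter.Eventually.of_forall fun x => ?_)
    conv_lhs => rw [← e1, SchwartzMap.fourier_coe, Real.fourier_eq]
    simp only [fourierChar_smul]
  have hk2 : MemLp k 2 := Lp.memLp k
  have hac : μ ≪ volume := by
    -- On a null compact set, test with a cutoff supported in a thin open neighbourhood `U`: then `μ
    -- K ≤ ∫_U ‖k‖ ≤ ∫_U (‖k‖² + 1)`, and both terms are small with `volume U` because `‖k‖²` is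
    -- integrable. Inner regularity then extends the conclusion to all Borel sets.
    have hcpt : ∀ K : Set V, IsCompact K → volume K = 0 → μ K = 0 := by
      intro K hK hK0
      refine le_antisymm (ENNReal.le_of_forall_pos_le_add fun ε hε _ => ?_) zero_le
      rw [zero_add]
      have hfin : ∫⁻ x, ‖k x‖ₑ ^ 2 ≠ ∞ := by
        have := hk2.2
        rw [eLpNorm_lt_top_iff_lintegral_rpow_enorm_lt_top (by norm_num) (by norm_num)] at this
        simpa using this.ne
      obtain ⟨δ, hδ, hδ'⟩ := exists_pos_setLIntegral_lt_of_measure_lt hfin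
        (ε := ((ε / 2 : NNReal) : ℝ≥0∞)) (by simp [hε.ne'])
      obtain ⟨U, hKU, hU, hUδ⟩ := K.exists_isOpen_lt_of_lt (μ := volume)
        (min δ ((ε / 2 : NNReal) : ℝ≥0∞)) (by rw [hK0]; exact lt_min hδ (by simpa using hε.ne'))
      obtain ⟨ψ, g, hψ, hg01, hg1, hg0⟩ := exists_schwartz_cutoff hK hU hKU
      have hgi : Integrable g μ := by
        have := (ψ.integrable (μ := μ)).re
        simpa [hψ] using this
      have h1 : (μ K).toReal ≤ ∫ x, g x ∂μ := by
        calc (μ K).toReal = ∫ x, K.indicator 1 x ∂μ := by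
              rw [integral_indicator_one hK.measurableSet, measureReal_def]
          _ ≤ _ := by
              refine integral_mono ((integrable_const (1 : ℝ)).indicator hK.measurableSet) hgi ?_
              intro x
              by_cases hx : x ∈ K
              · simp [hx, hg1 x hx]
              · simpa [hx] using (hg01 x).1
      calc μ K = ENNReal.ofReal (μ K).toReal := (ENNReal.ofReal_toReal (measure_ne_top _ _)).symm
        _ ≤ ENNReal.ofReal (∫ x, g x ∂μ) := ENNReal.ofReal_le_ofReal h1
        _ ≤ ‖∫ x, ψ x ∂μ‖ₑ := by
            simp only [hψ, integral_complex_ofReal]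
            rw [← ofReal_norm, Complex.norm_real]
            exact ENNReal.ofReal_le_ofReal (le_abs_self _)
        _ ≤ ∫⁻ x, ‖k x * ψ x‖ₑ := by rw [key]; exact enorm_integral_le_lintegral_enorm _
        _ ≤ ∫⁻ x in U, (‖k x‖ₑ ^ 2 + 1) := by
            rw [← lintegral_indicator hU.measurableSet]
            refine lintegral_mono fun x => ?_
            by_cases hx : x ∈ U
            · rw [Set.indicator_of_mem hx, enorm_mul]
              have hψ1 : ‖ψ x‖ₑ ≤ 1 := by
                rw [hψ, ← ofReal_norm, Complex.norm_real, Real.norm_of_nonneg (hg01 x).1]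
                exact ENNReal.ofReal_le_one.2 (hg01 x).2
              refine (mul_le_of_le_one_right' hψ1).trans ?_
              rcases le_total ‖k x‖ₑ 1 with h | h
              · exact h.trans le_add_self
              · refine le_trans ?_ le_self_add
                rw [sq]
                exact le_mul_of_one_le_left' h
            · simp [Set.indicator_of_notMem hx, hψ, hg0 x hx]
        _ = (∫⁻ x in U, ‖k x‖ₑ ^ 2) + volume U := by
            rw [lintegral_add_right _ measurable_const]; simp
        _ ≤ ((ε / 2 : NNReal) : ℝ≥0∞) + ((ε / 2 : NNReal) : ℝ≥0∞) :=
            add_le_add (hδ' U (hUδ.trans_le (min_le_left _ _))).le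
              (hUδ.trans_le (min_le_right _ _)).le
        _ = ε := by rw [← ENNReal.coe_add, add_halves]
    refine Measure.AbsolutelyContinuous.mk fun A hA hA0 => ?_
    rw [hA.measure_eq_iSup_isCompact]
    simp only [ENNReal.iSup_eq_zero]
    exact fun K hKA hK => hcpt K hK (measure_mono_null hKA hA0)
  refine ⟨μ.rnDeriv volume, Measure.measurable_rnDeriv _ _,
    (Measure.withDensity_rnDeriv_eq _ _ hac).symm, ?_⟩
  have hint : Integrable (fun x => (((μ.rnDeriv volume x).toReal : ℝ) : ℂ)) :=
    Measure.integrable_toReal_rnDeriv.ofReal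
  refine ae_eq_of_integral_schwartz (hk2.locallyIntegrable (by norm_num)) hint.locallyIntegrable
    fun ψ => ?_
  rw [← key]
  conv_lhs => rw [← Measure.withDensity_rnDeriv_eq _ _ hac]
  rw [integral_withDensity_eq_integral_toReal_smul (Measure.measurable_rnDeriv _ _)
    (Measure.rnDeriv_lt_top _ _)]
  simp

end Plancherel

/-! ### Convolution of measures on the mass shell -/

section Bilinear

variable {E : Type*} [NormedAddCommGroup E] [InnerProductSpace ℝ E] [FiniteDimensional ℝ E]
  [MeasurableSpace E] [BorelSpace E]

/-- The point of the mass shell above `η`. -/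
def massShell (s : ℝ) (η : E) : WithLp 2 (ℝ × E) := WithLp.toLp 2 (phi s ‖η‖, η)

theorem continuous_massShell (s : ℝ) : Continuous (massShell (E := E) s) := by
  unfold massShell
  have := continuous_phi s
  exact (WithLp.prod_continuous_toLp 2 ℝ E).comp (by fun_prop)

/-- The weight of the phase space measure with respect to energy-momentum and direction. -/
def pairWeight (s : ℝ) (q : ℝ × E) (ω : Metric.sphere (0 : E) 1) : ℝ :=
  cmDensity s q * (phi s ‖pairPlus s q ω‖ * phi s ‖pairMinus s q ω‖)

theorem pairWeight_nonneg {s : ℝ} (hs : 0 < s) (q : ℝ × E) (ω : Metric.sphere (0 : E) 1) :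
    0 ≤ pairWeight s q ω :=
  mul_nonneg (cmDensity_nonneg s q) (mul_nonneg (phi_pos hs _).le (phi_pos hs _).le)

theorem measurable_pairWeight {s : ℝ} (hs : 0 < s) :
    Measurable fun p : (ℝ × E) × Metric.sphere (0 : E) 1 => pairWeight s p.1 p.2 := by
  have := (continuous_phi s).measurable
  have hp := measurable_pairPlus (E := E) hs
  have hm := measurable_pairMinus (E := E) hs
  have hD := measurable_cmDensity (E := E) s
  unfold pairWeight
  fun_prop

theorem lt_of_pairWeight_ne_zero {s : ℝ} {q : ℝ × E} {ω : Metric.sphere (0 : E) 1}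
    (h : pairWeight s q ω ≠ 0) : Real.sqrt (‖q.2‖ ^ 2 + 4 * s ^ 2) < q.1 := by
  by_contra h'
  exact h (by rw [pairWeight, cmDensity, if_neg h', zero_mul])

theorem pairPlus_add_pairMinus (s : ℝ) (q : ℝ × E) (ω : Metric.sphere (0 : E) 1) :
    pairPlus s q ω + pairMinus s q ω = q.2 := legPlus_add_legMinus _ _ _

theorem phi_pairPlus_add {s : ℝ} (hs : 0 < s) {q : ℝ × E}
    (hq : Real.sqrt (‖q.2‖ ^ 2 + 4 * s ^ 2) < q.1) (ω : Metric.sphere (0 : E) 1) :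
    phi s ‖pairPlus s q ω‖ + phi s ‖pairMinus s q ω‖ = q.1 := by
  rw [pairPlus, pairMinus, phi_legPlus_add_phi_legMinus hs, totalEnergy_cmRadius_smul hq]

/-- The identity that turns a product of two characters on the mass shell into one character of the
total energy-momentum. -/
theorem massShell_add {s : ℝ} (hs : 0 < s) {q : ℝ × E}
    (hq : Real.sqrt (‖q.2‖ ^ 2 + 4 * s ^ 2) < q.1) (ω : Metric.sphere (0 : E) 1) :
    massShell s (pairPlus s q ω) + massShell s (pairMinus s q ω) = WithLp.toLp 2 q := by
  rw [massShell, massShell, ← WithLp.toLp_add, Prod.mk_add_mk, phi_pairPlus_add hs hq,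
    pairPlus_add_pairMinus]

/-- The phase space measure. -/
def pairMeasure (s : ℝ) : Measure ((ℝ × E) × Metric.sphere (0 : E) 1) :=
  ((volume : Measure (ℝ × E)).prod (volume : Measure E).toSphere).withDensity
    fun p => ENNReal.ofReal (pairWeight s p.1 p.2)

theorem measurePreserving_pair {s : ℝ} (hs : 0 < s) (hd : 2 ≤ Module.finrank ℝ E) :
    MeasurePreserving (fun p : (ℝ × E) × Metric.sphere (0 : E) 1 =>
      (pairPlus s p.1 p.2, pairMinus s p.1 p.2)) (pairMeasure s) (volume : Measure (E × E)) := by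
  have hm : Measurable (fun p : (ℝ × E) × Metric.sphere (0 : E) 1 =>
      (pairPlus s p.1 p.2, pairMinus s p.1 p.2)) :=
    (measurable_pairPlus hs).prodMk (measurable_pairMinus hs)
  refine ⟨hm, ?_⟩
  have hw := (measurable_pairWeight (E := E) hs).ennreal_ofReal
  refine Measure.ext fun A hA => ?_
  have hind : Measurable (A.indicator (1 : E × E → ℝ≥0∞)) := measurable_one.indicator hA
  rw [← lintegral_indicator_one hA, lintegral_map hind hm, pairMeasure]
  change ∫⁻ p, (A.indicator 1 ∘ fun p : (ℝ × E) × Metric.sphere (0 : E) 1 =>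
    (pairPlus s p.1 p.2, pairMinus s p.1 p.2)) p ∂_ = _
  rw [lintegral_withDensity_eq_lintegral_mul _ hw (hind.comp hm), ← lintegral_indicator_one hA,
    lintegral_pair hs hd hind, lintegral_prod _ (hw.mul (hind.comp hm)).aemeasurable]
  rfl

/-- Measurable, bounded, and vanishing outside a ball. -/
def BoundedOnBall (f : E → ℝ≥0∞) : Prop :=
  Measurable f ∧ (∃ C : NNReal, ∀ η, f η ≤ C) ∧ ∃ R : ℝ, ∀ η, R < ‖η‖ → f η = 0

theorem BoundedOnBall.lintegral_lt_top {f : E → ℝ≥0∞} (hf : BoundedOnBall f) :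
    ∫⁻ η, f η < ∞ := by
  obtain ⟨-, ⟨C, hC⟩, R, hR⟩ := hf
  calc ∫⁻ η, f η ≤ ∫⁻ _η in Metric.closedBall (0 : E) R, (C : ℝ≥0∞) := by
        rw [← lintegral_indicator measurableSet_closedBall]
        refine lintegral_mono fun η => ?_
        by_cases h : η ∈ Metric.closedBall (0 : E) R
        · rw [Set.indicator_of_mem h]; exact hC η
        · rw [Set.indicator_of_notMem h, hR η (by simpa using h)]
    _ < ∞ := by
        rw [setLIntegral_const]
        exact ENNReal.mul_lt_top ENNReal.coe_lt_top measure_closedBall_lt_top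

/-- The density of the convolution of two measures on the mass shell. -/
def pairDensity (s : ℝ) (f g : E → ℝ≥0∞) (q : ℝ × E) : ℝ≥0∞ :=
  ∫⁻ ω, ENNReal.ofReal (pairWeight s q ω) * (f (pairPlus s q ω) * g (pairMinus s q ω))
    ∂(volume : Measure E).toSphere

theorem measurable_pairDensity_integrand {s : ℝ} (hs : 0 < s) {f g : E → ℝ≥0∞} (hf : Measurable f)
    (hg : Measurable g) : Measurable fun p : (ℝ × E) × Metric.sphere (0 : E) 1 =>
      ENNReal.ofReal (pairWeight s p.1 p.2) * (f (pairPlus s p.1 p.2) * g (pairMinus s p.1 p.2)) := by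
  have hw := measurable_pairWeight (E := E) hs
  have hp := measurable_pairPlus (E := E) hs
  have hm := measurable_pairMinus (E := E) hs
  fun_prop

theorem phi_le_phi {s a b : ℝ} (ha : 0 ≤ a) (h : a ≤ b) : phi s a ≤ phi s b := by
  unfold phi
  gcongr

/-- Bounded momenta bound the total energy-momentum and the centre-of-mass radius, while the
denominator of the phase space density is the invariant mass, at least `2s`. Positivity of the mass
thus rules out any singularity, and every `Lᵖ` norm of the density is finite. -/
theorem exists_pairDensity_le {s : ℝ} (hs : 0 < s) {f g : E → ℝ≥0∞} (hf : BoundedOnBall f)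
    (hg : BoundedOnBall g) : ∃ (C : NNReal) (R : ℝ), ∀ q, pairDensity s f g q ≤
      (Metric.closedBall (0 : ℝ × E) R).indicator (fun _ => (C : ℝ≥0∞)) q := by
  obtain ⟨-, ⟨A, hA⟩, a, ha⟩ := hf
  obtain ⟨-, ⟨B, hB⟩, b, hb⟩ := hg
  set R := max a b with hR
  set P := phi s R with hP
  have hP0 : 0 < P := phi_pos hs _
  set K : ℝ := P ^ (Module.finrank ℝ E - 2) / (2 * s) * (P * P) with hK
  refine ⟨K.toNNReal * (A * B) * ((volume : Measure E).toSphere Set.univ).toNNReal,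
    max (2 * P) (2 * R), fun q => ?_⟩
  have hpt : ∀ ω, ENNReal.ofReal (pairWeight s q ω) * (f (pairPlus s q ω) * g (pairMinus s q ω)) ≤
      (Metric.closedBall (0 : ℝ × E) (max (2 * P) (2 * R))).indicator
        (fun _ => ((K.toNNReal * (A * B) : NNReal) : ℝ≥0∞)) q := by
    intro ω
    by_cases h : ENNReal.ofReal (pairWeight s q ω) *
      (f (pairPlus s q ω) * g (pairMinus s q ω)) = 0
    · rw [h]; exact zero_le
    rw [← ne_eq, mul_ne_zero_iff, mul_ne_zero_iff] at h
    obtain ⟨hw, hf0, hg0⟩ := h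
    have hw' : pairWeight s q ω ≠ 0 := fun h => hw (by rw [h, ENNReal.ofReal_zero])
    have hq := lt_of_pairWeight_ne_zero hw'
    have h1 : ‖pairPlus s q ω‖ ≤ R := le_trans (not_lt.1 fun h => hf0 (ha _ h)) (le_max_left _ _)
    have h2 : ‖pairMinus s q ω‖ ≤ R := le_trans (not_lt.1 fun h => hg0 (hb _ h)) (le_max_right _ _)
    have e1 := phi_le_phi (s := s) (norm_nonneg _) h1
    have e2 := phi_le_phi (s := s) (norm_nonneg _) h2
    have e3 := phi_pairPlus_add hs hq ω
    have hq1 : 0 < q.1 := (Real.sqrt_nonneg _).trans_lt hq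
    have e4 : ‖q.2‖ ≤ 2 * R := by
      rw [← pairPlus_add_pairMinus s q ω]
      exact (norm_add_le _ _).trans (by linarith)
    have hmem : q ∈ Metric.closedBall (0 : ℝ × E) (max (2 * P) (2 * R)) := by
      rw [mem_closedBall_zero_iff, Prod.norm_def, Real.norm_of_nonneg hq1.le]
      exact max_le_max (by linarith) e4
    rw [Set.indicator_of_mem hmem]
    have hr0 : 0 ≤ cmRadius s q := Real.sqrt_nonneg _
    have hphir := phi_cmRadius hq
    have hr1 : s ≤ phi s (cmRadius s q) := Real.le_sqrt_of_sq_le (by nlinarith [sq_nonneg (cmRadius s q)])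
    -- The invariant mass `2 * phi s r` is at most the total energy, hence at most `2 * P`.
    have hr2 : cmRadius s q ≤ P := by
      have t1 := lt_phi hs (cmRadius s q)
      have t2 : √(q.1 ^ 2 - ‖q.2‖ ^ 2) ≤ q.1 := by
        rw [Real.sqrt_le_left hq1.le]
        nlinarith [norm_nonneg q.2]
      linarith
    have hwK : pairWeight s q ω ≤ K := by
      rw [pairWeight, cmDensity, if_pos hq, hK, ← hphir]
      have := phi_pos hs ‖pairPlus s q ω‖
      have := phi_pos hs ‖pairMinus s q ω‖
      gcongr
    rw [ENNReal.coe_mul, ENNReal.coe_mul]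
    refine mul_le_mul' (ENNReal.ofReal_le_ofReal hwK) (mul_le_mul' (hA _) (hB _))
  calc pairDensity s f g q ≤ ∫⁻ _ω : Metric.sphere (0 : E) 1,
      (Metric.closedBall (0 : ℝ × E) (max (2 * P) (2 * R))).indicator
        (fun _ => ((K.toNNReal * (A * B) : NNReal) : ℝ≥0∞)) q ∂(volume : Measure E).toSphere :=
        lintegral_mono hpt
    _ = _ := by
        rw [lintegral_const]
        have hT : ((((volume : Measure E).toSphere Set.univ).toNNReal : NNReal) : ℝ≥0∞) =
          (volume : Measure E).toSphere Set.univ := ENNReal.coe_toNNReal (measure_ne_top _ _)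
        by_cases h : q ∈ Metric.closedBall (0 : ℝ × E) (max (2 * P) (2 * R))
        · rw [Set.indicator_of_mem h, Set.indicator_of_mem h,
            ENNReal.coe_mul (K.toNNReal * (A * B)), hT]
        · simp [Set.indicator_of_notMem h]

/-- A complex function whose modulus is bounded and vanishes outside a ball. -/
def BoundedOnBallC (f : E → ℂ) : Prop := Measurable f ∧ BoundedOnBall fun η => ‖f η‖ₑ

theorem BoundedOnBallC.integrable {f : E → ℂ} (hf : BoundedOnBallC f) : Integrable f :=
  ⟨hf.1.aestronglyMeasurable, hf.2.lintegral_lt_top⟩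

/-- Complex version of `pairDensity`. -/
def pairDensityC (s : ℝ) (f g : E → ℂ) (q : WithLp 2 (ℝ × E)) : ℂ :=
  ∫ ω, (pairWeight s q.ofLp ω : ℂ) * (f (pairPlus s q.ofLp ω) * g (pairMinus s q.ofLp ω))
    ∂(volume : Measure E).toSphere

/-- The inverse space-time Fourier transform of a measure on the mass shell. -/
def shellTransform (s : ℝ) (f : E → ℂ) (z : WithLp 2 (ℝ × E)) : ℂ :=
  ∫ η, wave (-inner ℝ (massShell s η) z) * f η

theorem measurable_pairDensityC_integrand {s : ℝ} (hs : 0 < s) {f g : E → ℂ} (hf : Measurable f)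
    (hg : Measurable g) : Measurable fun p : (ℝ × E) × Metric.sphere (0 : E) 1 =>
      (pairWeight s p.1 p.2 : ℂ) * (f (pairPlus s p.1 p.2) * g (pairMinus s p.1 p.2)) := by
  have hw := measurable_pairWeight (E := E) hs
  have hp := measurable_pairPlus (E := E) hs
  have hm := measurable_pairMinus (E := E) hs
  fun_prop

theorem measurable_pairDensityC {s : ℝ} (hs : 0 < s) {f g : E → ℂ} (hf : Measurable f)
    (hg : Measurable g) : Measurable (pairDensityC s f g) :=
  ((measurable_pairDensityC_integrand hs hf hg).stronglyMeasurable.integral_prod_right'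
    (ν := (volume : Measure E).toSphere)).measurable.comp (WithLp.measurable_ofLp 2 _)

theorem enorm_pairDensityC_le {s : ℝ} (hs : 0 < s) (f g : E → ℂ) (q : WithLp 2 (ℝ × E)) :
    ‖pairDensityC s f g q‖ₑ ≤ pairDensity s (fun η => ‖f η‖ₑ) (fun η => ‖g η‖ₑ) q.ofLp := by
  refine (enorm_integral_le_lintegral_enorm _).trans (lintegral_mono fun ω => ?_)
  rw [enorm_mul, enorm_mul, ← ofReal_norm (pairWeight s q.ofLp ω : ℂ), Complex.norm_real,
    Real.norm_of_nonneg (pairWeight_nonneg hs _ _)]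

theorem memLp_pairDensityC {s : ℝ} (hs : 0 < s) {f g : E → ℂ} (hf : BoundedOnBallC f)
    (hg : BoundedOnBallC g) (p : ℝ≥0∞) : MemLp (pairDensityC s f g) p := by
  obtain ⟨C, R, h⟩ := exists_pairDensity_le hs hf.2 hg.2
  have hmem : MemLp (fun q : WithLp 2 (ℝ × E) =>
      (Metric.closedBall (0 : ℝ × E) R).indicator (fun _ => (C : ℝ)) q.ofLp) p := by
    have : MemLp ((Metric.closedBall (0 : ℝ × E) R).indicator (fun _ => (C : ℝ))) p :=
      memLp_indicator_const p measurableSet_closedBall _ (Or.inr measure_closedBall_lt_top.ne)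
    exact this.comp_measurePreserving (WithLp.volume_preserving_ofLp ℝ E)
  refine hmem.of_le (measurable_pairDensityC hs hf.1 hg.1).aestronglyMeasurable
    (Filter.Eventually.of_forall fun q => ?_)
  have := (enorm_pairDensityC_le hs f g q).trans (h q.ofLp)
  rw [← enorm_le_iff_norm_le]
  refine this.trans (le_of_eq ?_)
  by_cases hq : q.ofLp ∈ Metric.closedBall (0 : ℝ × E) R
  · rw [Set.indicator_of_mem hq, Set.indicator_of_mem hq]; simp
  · rw [Set.indicator_of_notMem hq, Set.indicator_of_notMem hq]; simp

/-- The convolution theorem: on each fibre the phase at `q` splits into the phases of the two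
particles, and the change of variables to pairs of momenta factors the integral. -/
theorem fourier_pairDensityC {s : ℝ} (hs : 0 < s) (hd : 2 ≤ Module.finrank ℝ E) {f g : E → ℂ}
    (hf : BoundedOnBallC f) (hg : BoundedOnBallC g) (z : WithLp 2 (ℝ × E)) :
    𝓕 (pairDensityC s f g) z = shellTransform s f z * shellTransform s g z := by
  have hmp := measurePreserving_pair (E := E) hs hd
  have hms := (continuous_massShell (E := E) s).measurable
  have hf1 := hf.1
  have hg1 := hg.1
  have hw := measurable_pairWeight (E := E) hs
  have hp := measurable_pairPlus (E := E) hs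
  have hm := measurable_pairMinus (E := E) hs
  have hme : Measurable fun p : (ℝ × E) × Metric.sphere (0 : E) 1 =>
      wave (-inner ℝ (WithLp.toLp 2 p.1) z) * ((pairWeight s p.1 p.2 : ℂ) *
        (f (pairPlus s p.1 p.2) * g (pairMinus s p.1 p.2))) := by
    refine Measurable.mul ?_ (measurable_pairDensityC_integrand hs hf.1 hg.1)
    have : Continuous fun q : ℝ × E => WithLp.toLp 2 q := WithLp.prod_continuous_toLp 2 ℝ E
    exact (Continuous.measurable (by fun_prop :
      Continuous fun q : ℝ × E => wave (-inner ℝ (WithLp.toLp 2 q) z))).comp measurable_fst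
  have hfin : Integrable (fun p : (ℝ × E) × Metric.sphere (0 : E) 1 =>
      wave (-inner ℝ (WithLp.toLp 2 p.1) z) * ((pairWeight s p.1 p.2 : ℂ) *
        (f (pairPlus s p.1 p.2) * g (pairMinus s p.1 p.2))))
      ((volume : Measure (ℝ × E)).prod (volume : Measure E).toSphere) := by
    refine ⟨hme.aestronglyMeasurable, ?_⟩
    rw [HasFiniteIntegral, lintegral_prod _ hme.enorm.aemeasurable]
    obtain ⟨C, R, h⟩ := exists_pairDensity_le hs hf.2 hg.2
    calc _ = ∫⁻ q, pairDensity s (fun η => ‖f η‖ₑ) (fun η => ‖g η‖ₑ) q := by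
          refine lintegral_congr fun q => lintegral_congr fun ω => ?_
          rw [enorm_mul, enorm_mul, enorm_mul, ← ofReal_norm (pairWeight s q ω : ℂ),
            Complex.norm_real, Real.norm_of_nonneg (pairWeight_nonneg hs _ _),
            ← ofReal_norm (wave _), norm_wave, ENNReal.ofReal_one, one_mul]
      _ ≤ _ := lintegral_mono h
      _ < ∞ := by
          rw [lintegral_indicator measurableSet_closedBall, setLIntegral_const]
          exact ENNReal.mul_lt_top ENNReal.coe_lt_top measure_closedBall_lt_top
  calc 𝓕 (pairDensityC s f g) z
      = ∫ q : WithLp 2 (ℝ × E), wave (-inner ℝ q z) * pairDensityC s f g q := by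
        rw [Real.fourier_eq]; simp only [fourierChar_smul]
    _ = ∫ q : ℝ × E, wave (-inner ℝ (WithLp.toLp 2 q) z) *
          pairDensityC s f g (WithLp.toLp 2 q) := by
        rw [← (WithLp.volume_preserving_toLp ℝ E).integral_comp
          (MeasurableEquiv.toLp 2 (ℝ × E)).measurableEmbedding]
    _ = ∫ q : ℝ × E, ∫ ω, wave (-inner ℝ (WithLp.toLp 2 q) z) * ((pairWeight s q ω : ℂ) *
          (f (pairPlus s q ω) * g (pairMinus s q ω))) ∂(volume : Measure E).toSphere := by
        simp only [pairDensityC, integral_const_mul]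
    _ = ∫ p, wave (-inner ℝ (WithLp.toLp 2 p.1) z) * ((pairWeight s p.1 p.2 : ℂ) *
          (f (pairPlus s p.1 p.2) * g (pairMinus s p.1 p.2)))
          ∂((volume : Measure (ℝ × E)).prod (volume : Measure E).toSphere) :=
        (integral_prod _ hfin).symm
    _ = ∫ p, (wave (-inner ℝ (massShell s (pairPlus s p.1 p.2)) z) * f (pairPlus s p.1 p.2)) *
          (wave (-inner ℝ (massShell s (pairMinus s p.1 p.2)) z) * g (pairMinus s p.1 p.2))
          ∂(pairMeasure s) := by
        rw [pairMeasure, integral_withDensity_eq_integral_toReal_smul (by fun_prop) (by simp)]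
        refine integral_congr_ae (Filter.Eventually.of_forall fun p => ?_)
        simp only [ENNReal.toReal_ofReal (pairWeight_nonneg hs _ _), Complex.real_smul]
        by_cases h : pairWeight s p.1 p.2 = 0
        · simp [h]
        · rw [← massShell_add hs (lt_of_pairWeight_ne_zero h) p.2, inner_add_left, neg_add, wave_add]
          ring
    _ = ∫ p : E × E, (wave (-inner ℝ (massShell s p.1) z) * f p.1) *
          (wave (-inner ℝ (massShell s p.2) z) * g p.2) := by
        rw [← hmp.map_eq, integral_map hmp.measurable.aemeasurable]
        refine Measurable.aestronglyMeasurable ?_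
        have := continuous_wave.measurable
        fun_prop
    _ = _ := by
        rw [Measure.volume_eq_prod, integral_prod_mul
          (f := fun η => wave (-inner ℝ (massShell s η) z) * f η)
          (g := fun η => wave (-inner ℝ (massShell s η) z) * g η)]
        rfl

theorem continuous_shellTransform {s : ℝ} {f : E → ℂ} (hf : Integrable f) :
    Continuous (shellTransform s f) := by
  have hms := continuous_massShell (E := E) s
  refine continuous_of_dominated (F := fun z η => wave (-inner ℝ (massShell s η) z) * f η)
    (bound := fun η => ‖f η‖) (fun z => ?_) (fun z => ?_) hf.norm ?_
  · exact (Continuous.aestronglyMeasurable (by fun_prop)).mul hf.1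
  · exact Filter.Eventually.of_forall fun η => by simp
  · exact Filter.Eventually.of_forall fun η => by fun_prop

/-- The product is the Fourier transform of a bounded density of compact support, hence square
integrable. -/
theorem memLp_shellTransform_mul {s : ℝ} (hs : 0 < s) (hd : 2 ≤ Module.finrank ℝ E) {f g : E → ℂ}
    (hf : BoundedOnBallC f) (hg : BoundedOnBallC g) :
    MemLp (fun z => shellTransform s f z * shellTransform s g z) 2 := by
  have h1 := memLp_pairDensityC hs hf hg 1
  have h2 := memLp_pairDensityC hs hf hg 2
  refine (memLp_congr_ae ?_).1 (Lp.memLp (𝓕 (h2.toLp _) : Lp ℂ 2 (volume : Measure (WithLp 2 (ℝ × E)))))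
  refine (fourier_toLp_ae_eq (memLp_one_iff_integrable.1 h1) h2).trans ?_
  exact Filter.Eventually.of_forall fun z => fourier_pairDensityC hs hd hf hg z

/-- Plancherel's theorem for convolutions of measures on the mass shell. -/
theorem integral_shellTransform_mul {s : ℝ} (hs : 0 < s) (hd : 2 ≤ Module.finrank ℝ E)
    {f g f' g' : E → ℂ} (hf : BoundedOnBallC f) (hg : BoundedOnBallC g)
    (hf' : BoundedOnBallC f') (hg' : BoundedOnBallC g') :
    ∫ z, (shellTransform s f z * shellTransform s g z) *
      conj (shellTransform s f' z * shellTransform s g' z) =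
    ∫ q, pairDensityC s f g q * conj (pairDensityC s f' g' q) := by
  have h1 := memLp_one_iff_integrable.1 (memLp_pairDensityC hs hf hg 1)
  have h2 := memLp_pairDensityC hs hf hg 2
  have h1' := memLp_one_iff_integrable.1 (memLp_pairDensityC hs hf' hg' 1)
  have h2' := memLp_pairDensityC hs hf' hg' 2
  have := Lp.inner_fourier_eq (h2'.toLp _) (h2.toLp _)
  rw [L2.inner_def, L2.inner_def] at this
  simp only [RCLike.inner_apply] at this
  calc _ = _ := by
        refine integral_congr_ae ?_
        filter_upwards [fourier_toLp_ae_eq h1 h2, fourier_toLp_ae_eq h1' h2'] with z hz hz'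
        rw [← fourier_pairDensityC hs hd hf hg, ← fourier_pairDensityC hs hd hf' hg', ← hz, ← hz']
    _ = _ := this
    _ = _ := by
        refine integral_congr_ae ?_
        filter_upwards [h2.coeFn_toLp, h2'.coeFn_toLp] with q hq hq'
        rw [hq, hq']

end Bilinear

/-! ### The energy-momentum transfer and pairs of pairs -/

section Transfer

variable {E : Type*} [NormedAddCommGroup E] [InnerProductSpace ℝ E] [FiniteDimensional ℝ E]
  [MeasurableSpace E] [BorelSpace E]

/-- The energy-momentum transfer. -/
def transfer (s : ℝ) (p : E × E) : WithLp 2 (ℝ × E) := massShell s p.1 - massShell s p.2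

theorem continuous_transfer (s : ℝ) : Continuous (transfer (E := E) s) := by
  have := continuous_massShell (E := E) s
  unfold transfer
  fun_prop

/-- The distribution of the energy-momentum transfer. -/
def transferMeasure (s : ℝ) (f g : E → ℝ≥0∞) : Measure (WithLp 2 (ℝ × E)) :=
  ((volume : Measure (E × E)).withDensity fun p => f p.1 * g p.2).map (transfer s)

/-- The integral of a function of the energy-momentum transfer over pairs of pairs with the same
total energy-momentum. -/
def quadIntegral (s : ℝ) (w : WithLp 2 (ℝ × E) → ℝ≥0∞) (f g : E → ℝ≥0∞) : ℝ≥0∞ :=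
  ∫⁻ q : ℝ × E, ∫⁻ ω, ∫⁻ ω', ENNReal.ofReal (pairWeight s q ω) * ENNReal.ofReal (pairWeight s q ω') *
    ((f (pairPlus s q ω) * g (pairMinus s q ω)) * (f (pairPlus s q ω') * g (pairMinus s q ω'))) *
      w (transfer s (pairPlus s q ω, pairMinus s q ω'))
    ∂(volume : Measure E).toSphere ∂(volume : Measure E).toSphere

theorem BoundedOnBall.toComplex {f : E → ℝ≥0∞} (hf : BoundedOnBall f) :
    BoundedOnBallC fun η => ((f η).toReal : ℂ) := by
  obtain ⟨h, ⟨C, hC⟩, R, hR⟩ := hf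
  refine ⟨by fun_prop, by fun_prop, ⟨C, fun η => ?_⟩, R, fun η hη => by simp [hR η hη]⟩
  change ‖((f η).toReal : ℂ)‖ₑ ≤ C
  rw [← ofReal_norm, Complex.norm_real, Real.norm_of_nonneg ENNReal.toReal_nonneg,
    ENNReal.ofReal_toReal ((hC η).trans_lt ENNReal.coe_lt_top).ne]
  exact hC η

theorem BoundedOnBallC.wave_mul {s : ℝ} {f : E → ℂ} (hf : BoundedOnBallC f)
    (z : WithLp 2 (ℝ × E)) :
    BoundedOnBallC fun η => wave (-inner ℝ (massShell s η) z) * f η := by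
  have hms := continuous_massShell (E := E) s
  have hc : Continuous fun η => wave (-inner ℝ (massShell s η) z) := by fun_prop
  have he : (fun η => ‖wave (-inner ℝ (massShell s η) z) * f η‖ₑ) = fun η => ‖f η‖ₑ := by
    ext η
    rw [enorm_mul, ← ofReal_norm (wave _), norm_wave, ENNReal.ofReal_one, one_mul]
  exact ⟨hc.measurable.mul hf.1, he ▸ hf.2⟩

theorem shellTransform_add (s : ℝ) (f : E → ℂ) (κ z : WithLp 2 (ℝ × E)) :
    shellTransform s f (κ + z) =
      shellTransform s (fun η => wave (-inner ℝ (massShell s η) z) * f η) κ := by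
  refine integral_congr_ae (Filter.Eventually.of_forall fun η => ?_)
  simp only [inner_add_right, neg_add, wave_add]
  ring

theorem BoundedOnBall.ne_top {f : E → ℝ≥0∞} (hf : BoundedOnBall f) (η : E) : f η ≠ ∞ := by
  obtain ⟨-, ⟨C, hC⟩, -⟩ := hf
  exact ((hC η).trans_lt ENNReal.coe_lt_top).ne

theorem isFiniteMeasure_transferMeasure (s : ℝ) {f g : E → ℝ≥0∞} (hf : BoundedOnBall f)
    (hg : BoundedOnBall g) : IsFiniteMeasure (transferMeasure s f g) := by
  have hf1 := hf.1
  have hg1 := hg.1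
  have : IsFiniteMeasure ((volume : Measure (E × E)).withDensity fun p => f p.1 * g p.2) := by
    refine isFiniteMeasure_withDensity (ne_of_lt ?_)
    rw [Measure.volume_eq_prod, lintegral_prod_mul hf1.aemeasurable hg1.aemeasurable]
    exact ENNReal.mul_lt_top hf.lintegral_lt_top hg.lintegral_lt_top
  unfold transferMeasure
  infer_instance

/-- A difference of points of the mass shell gives the product of one transform with the conjugate
of the other. -/
theorem fourier_transferMeasure (s : ℝ) {f g : E → ℝ≥0∞} (hf : BoundedOnBall f)
    (hg : BoundedOnBall g) (z : WithLp 2 (ℝ × E)) :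
    ∫ x, wave (-inner ℝ x z) ∂(transferMeasure s f g) =
      shellTransform s (fun η => ((f η).toReal : ℂ)) z *
        conj (shellTransform s (fun η => ((g η).toReal : ℂ)) z) := by
  have hf1 := hf.1
  have hg1 := hg.1
  have hc := continuous_transfer (E := E) s
  rw [transferMeasure, integral_map hc.measurable.aemeasurable
    (Continuous.aestronglyMeasurable (by fun_prop)),
    integral_withDensity_eq_integral_toReal_smul (by fun_prop)
    (Filter.Eventually.of_forall fun p => ENNReal.mul_lt_top (hf.ne_top _).lt_top
      (hg.ne_top _).lt_top)]
  have hconj : conj (shellTransform s (fun η => ((g η).toReal : ℂ)) z) =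
      ∫ η, conj (wave (-inner ℝ (massShell s η) z) * ((g η).toReal : ℂ)) := integral_conj.symm
  rw [hconj, shellTransform, ← integral_prod_mul, ← Measure.volume_eq_prod]
  refine integral_congr_ae (Filter.Eventually.of_forall fun p => ?_)
  simp only [ENNReal.toReal_mul, Complex.real_smul, transfer, inner_sub_left, map_mul, conj_wave,
    Complex.conj_ofReal]
  rw [show -(inner ℝ (massShell s p.1) z - inner ℝ (massShell s p.2) z) =
    -inner ℝ (massShell s p.1) z + - -inner ℝ (massShell s p.2) z by ring, wave_add]
  push_cast
  ring

/-- Conjugating one factor leaves the modulus unchanged, so square integrability passes from sums of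
momenta to differences, where no centre-of-mass frame is available. -/
theorem memLp_shellTransform_mul_conj {s : ℝ} (hs : 0 < s) (hd : 2 ≤ Module.finrank ℝ E)
    {f g : E → ℂ} (hf : BoundedOnBallC f) (hg : BoundedOnBallC g) :
    MemLp (fun z => shellTransform s f z * conj (shellTransform s g z)) 2 := by
  have h1 := continuous_shellTransform (s := s) hf.integrable
  have h2 := continuous_shellTransform (s := s) hg.integrable
  refine (memLp_shellTransform_mul hs hd hf hg).of_le
    (Continuous.aestronglyMeasurable (by fun_prop)) (Filter.Eventually.of_forall fun z => ?_)
  simp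

theorem measurable_quad {s : ℝ} (hs : 0 < s) {f g : E → ℝ≥0∞} (hf : Measurable f)
    (hg : Measurable g) : Measurable fun p : (ℝ × E) × Metric.sphere (0 : E) 1 ×
      Metric.sphere (0 : E) 1 => ENNReal.ofReal (pairWeight s p.1 p.2.1) *
      ENNReal.ofReal (pairWeight s p.1 p.2.2) *
      ((f (pairPlus s p.1 p.2.1) * g (pairMinus s p.1 p.2.1)) *
        (f (pairPlus s p.1 p.2.2) * g (pairMinus s p.1 p.2.2))) := by
  have hw := measurable_pairWeight (E := E) hs
  have hp := measurable_pairPlus (E := E) hs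
  have hm := measurable_pairMinus (E := E) hs
  fun_prop

theorem measurable_transfer_quad {s : ℝ} (hs : 0 < s) :
    Measurable fun p : (ℝ × E) × Metric.sphere (0 : E) 1 × Metric.sphere (0 : E) 1 =>
      transfer s (pairPlus s p.1 p.2.1, pairMinus s p.1 p.2.2) := by
  have hp := measurable_pairPlus (E := E) hs
  have hm := measurable_pairMinus (E := E) hs
  exact (continuous_transfer s).measurable.comp (by fun_prop)

/-- The measure on pairs of pairs with the same total energy-momentum. -/
def quadMeasure (s : ℝ) (f g : E → ℝ≥0∞) :
    Measure ((ℝ × E) × Metric.sphere (0 : E) 1 × Metric.sphere (0 : E) 1) :=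
  ((volume : Measure (ℝ × E)).prod
    ((volume : Measure E).toSphere.prod (volume : Measure E).toSphere)).withDensity
    fun p => ENNReal.ofReal (pairWeight s p.1 p.2.1) *
      ENNReal.ofReal (pairWeight s p.1 p.2.2) *
      ((f (pairPlus s p.1 p.2.1) * g (pairMinus s p.1 p.2.1)) *
        (f (pairPlus s p.1 p.2.2) * g (pairMinus s p.1 p.2.2)))

theorem lintegral_quadMeasure {s : ℝ} (hs : 0 < s) {f g : E → ℝ≥0∞} (hf : Measurable f)
    (hg : Measurable g) {w : WithLp 2 (ℝ × E) → ℝ≥0∞} (hw : Measurable w) :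
    ∫⁻ p, w (transfer s (pairPlus s p.1 p.2.1, pairMinus s p.1 p.2.2)) ∂(quadMeasure s f g) =
      quadIntegral s w f g := by
  have h1 := measurable_quad hs hf hg
  have h2 := hw.comp (measurable_transfer_quad (E := E) hs)
  change ∫⁻ p, (w ∘ fun p : (ℝ × E) × Metric.sphere (0 : E) 1 × Metric.sphere (0 : E) 1 =>
      transfer s (pairPlus s p.1 p.2.1, pairMinus s p.1 p.2.2)) p ∂_ = _
  rw [quadMeasure, lintegral_withDensity_eq_lintegral_mul _ h1 h2,
    lintegral_prod _ (h1.mul h2).aemeasurable]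
  refine lintegral_congr fun q => ?_
  exact lintegral_prod _ ((h1.mul h2).comp measurable_prodMk_left).aemeasurable

/-- The total mass is the integral of the square of `pairDensity`, which is bounded with bounded
support. -/
theorem isFiniteMeasure_quadMeasure {s : ℝ} (hs : 0 < s) {f g : E → ℝ≥0∞} (hf : BoundedOnBall f)
    (hg : BoundedOnBall g) : IsFiniteMeasure (quadMeasure s f g) := by
  refine ⟨?_⟩
  have h := lintegral_quadMeasure hs hf.1 hg.1 (w := fun _ => 1) measurable_const
  rw [lintegral_one] at h
  rw [h, quadIntegral]
  obtain ⟨C, R, hC⟩ := exists_pairDensity_le hs hf hg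
  calc _ = ∫⁻ q, pairDensity s f g q * pairDensity s f g q := by
        refine lintegral_congr fun q => ?_
        rw [pairDensity]
        have hm := (measurable_pairDensity_integrand hs hf.1 hg.1).comp
          (measurable_prodMk_left (x := q))
        simp only [Function.comp_def] at hm
        rw [← lintegral_mul_const _ hm]
        refine lintegral_congr fun ω => ?_
        rw [← lintegral_const_mul _ hm]
        refine lintegral_congr fun ω' => ?_
        ring
    _ ≤ ∫⁻ q, (Metric.closedBall (0 : ℝ × E) R).indicator (fun _ => (C : ℝ≥0∞) * C) q := by
        refine lintegral_mono fun q => ?_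
        by_cases hq : q ∈ Metric.closedBall (0 : ℝ × E) R
        · have := hC q
          rw [Set.indicator_of_mem hq] at this ⊢
          exact mul_le_mul' this this
        · have := hC q
          rw [Set.indicator_of_notMem hq] at this ⊢
          rw [nonpos_iff_eq_zero.1 this, zero_mul]
    _ < ∞ := by
        rw [lintegral_indicator measurableSet_closedBall, setLIntegral_const]
        exact ENNReal.mul_lt_top (ENNReal.mul_lt_top ENNReal.coe_lt_top ENNReal.coe_lt_top)
          measure_closedBall_lt_top

/-- The transfer pairs the first particle of `ω` with the second particle of `ω'`, so its phase is a
product of a function of `ω` and a function of `ω'`. For each `q` the double integral therefore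
factors into two modulated pair densities. -/
theorem fourier_quadMeasure {s : ℝ} (hs : 0 < s) {f g : E → ℝ≥0∞} (hf : BoundedOnBall f)
    (hg : BoundedOnBall g) (z : WithLp 2 (ℝ × E)) :
    ∫ x, wave (-inner ℝ x z) ∂((quadMeasure s f g).map
      fun p => transfer s (pairPlus s p.1 p.2.1, pairMinus s p.1 p.2.2)) =
    ∫ q, pairDensityC s (fun η => wave (-inner ℝ (massShell s η) z) * ((f η).toReal : ℂ))
        (fun η => ((g η).toReal : ℂ)) q *
      conj (pairDensityC s (fun η => ((f η).toReal : ℂ))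
        (fun η => wave (-inner ℝ (massShell s η) z) * ((g η).toReal : ℂ)) q) := by
  have hfin := isFiniteMeasure_quadMeasure hs hf hg
  have hm := measurable_transfer_quad (E := E) hs
  have hq := measurable_quad hs hf.1 hg.1
  have hlt : ∀ p : (ℝ × E) × Metric.sphere (0 : E) 1 × Metric.sphere (0 : E) 1,
      ENNReal.ofReal (pairWeight s p.1 p.2.1) * ENNReal.ofReal (pairWeight s p.1 p.2.2) *
      ((f (pairPlus s p.1 p.2.1) * g (pairMinus s p.1 p.2.1)) *
        (f (pairPlus s p.1 p.2.2) * g (pairMinus s p.1 p.2.2))) < ∞ := fun p =>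
    ENNReal.mul_lt_top (ENNReal.mul_lt_top ENNReal.ofReal_lt_top ENNReal.ofReal_lt_top)
      (ENNReal.mul_lt_top (ENNReal.mul_lt_top (hf.ne_top _).lt_top (hg.ne_top _).lt_top)
        (ENNReal.mul_lt_top (hf.ne_top _).lt_top (hg.ne_top _).lt_top))
  have hwm : Measurable fun p : (ℝ × E) × Metric.sphere (0 : E) 1 × Metric.sphere (0 : E) 1 =>
      wave (-inner ℝ (transfer s (pairPlus s p.1 p.2.1, pairMinus s p.1 p.2.2)) z) :=
    (by fun_prop : Continuous fun x : WithLp 2 (ℝ × E) => wave (-inner ℝ x z)).measurable.comp hm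
  have hint : Integrable (fun p : (ℝ × E) × Metric.sphere (0 : E) 1 × Metric.sphere (0 : E) 1 =>
      wave (-inner ℝ (transfer s (pairPlus s p.1 p.2.1, pairMinus s p.1 p.2.2)) z))
      (quadMeasure s f g) :=
    (integrable_const (1 : ℝ)).mono' hwm.aestronglyMeasurable
      (Filter.Eventually.of_forall fun p => by simp)
  rw [integral_map hm.aemeasurable (Continuous.aestronglyMeasurable (by fun_prop))]
  rw [quadMeasure, integrable_withDensity_iff_integrable_smul' hq
    (Filter.Eventually.of_forall hlt)] at hint
  rw [quadMeasure, integral_withDensity_eq_integral_toReal_smul hq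
    (Filter.Eventually.of_forall hlt), integral_prod _ hint,
    ← (WithLp.volume_preserving_toLp ℝ E).integral_comp
          (MeasurableEquiv.toLp 2 (ℝ × E)).measurableEmbedding]
  refine integral_congr_ae (Filter.Eventually.of_forall fun q => ?_)
  have hc : conj (pairDensityC s (fun η => ((f η).toReal : ℂ))
        (fun η => wave (-inner ℝ (massShell s η) z) * ((g η).toReal : ℂ)) (WithLp.toLp 2 q)) =
      ∫ ω, conj ((pairWeight s q ω : ℂ) * (((f (pairPlus s q ω)).toReal : ℂ) *
        (wave (-inner ℝ (massShell s (pairMinus s q ω)) z) * ((g (pairMinus s q ω)).toReal : ℂ))))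
        ∂(volume : Measure E).toSphere := integral_conj.symm
  dsimp only
  rw [hc, pairDensityC, ← integral_prod_mul]
  refine integral_congr_ae (Filter.Eventually.of_forall fun p => ?_)
  simp only [ENNReal.toReal_mul, ENNReal.toReal_ofReal (pairWeight_nonneg hs _ _),
    Complex.real_smul, transfer, inner_sub_left, map_mul, conj_wave, Complex.conj_ofReal]
  rw [show -(inner ℝ (massShell s (pairPlus s q p.1)) z -
      inner ℝ (massShell s (pairMinus s q p.2)) z) =
    -inner ℝ (massShell s (pairPlus s q p.1)) z + - -inner ℝ (massShell s (pairMinus s q p.2)) z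
    by ring, wave_add]
  push_cast
  ring

/-- Uniqueness of characteristic functions; `t = -2π z` matches the two normalisations. -/
theorem ext_of_integral_wave {V : Type*} [NormedAddCommGroup V] [InnerProductSpace ℝ V]
    [FiniteDimensional ℝ V] [MeasurableSpace V] [BorelSpace V] {μ ν : Measure V}
    [IsFiniteMeasure μ] [IsFiniteMeasure ν]
    (h : ∀ z, ∫ x, wave (-inner ℝ x z) ∂μ = ∫ x, wave (-inner ℝ x z) ∂ν) : μ = ν := by
  refine Measure.ext_of_charFun (funext fun t => ?_)
  have := h (-(2 * Real.pi)⁻¹ • t)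
  rw [charFun_apply, charFun_apply]
  convert this using 3 with x x <;>
  · rw [wave, inner_smul_right]
    congr 1
    push_cast
    have : (Real.pi : ℂ) ≠ 0 := by exact_mod_cast Real.pi_ne_zero
    field_simp

/-- The density of the energy-momentum transfer is square integrable against a weight if the
corresponding integral over pairs of pairs is finite. -/
theorem exists_transferDensity_of_boundedOnBall {s : ℝ} (hs : 0 < s)
    (hd : 2 ≤ Module.finrank ℝ E) {f g : E → ℝ≥0∞} (hf : BoundedOnBall f) (hg : BoundedOnBall g) :
    ∃ m : WithLp 2 (ℝ × E) → ℝ≥0∞, Measurable m ∧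
      transferMeasure s f g = volume.withDensity m ∧
      ∀ w : WithLp 2 (ℝ × E) → ℝ≥0∞, Measurable w →
        ∫⁻ x, w x * m x ^ 2 = quadIntegral s w f g := by
  have hfc := hf.toComplex
  have hgc := hg.toComplex
  have hfin := isFiniteMeasure_transferMeasure s hf hg
  have hfin' := isFiniteMeasure_quadMeasure hs hf hg
  have hW := memLp_shellTransform_mul_conj hs hd hfc hgc
  obtain ⟨m, hm, hμ, hmk⟩ := eq_withDensity_of_memLp_fourier hW (fourier_transferMeasure s hf hg)
  refine ⟨m, hm, hμ, fun w hw => ?_⟩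
  set k : Lp ℂ 2 (volume : Measure (WithLp 2 (ℝ × E))) := 𝓕⁻ (hW.toLp _) with hk
  have hFk : (𝓕 k : Lp ℂ 2 (volume : Measure (WithLp 2 (ℝ × E)))) = hW.toLp _ :=
    fourier_fourierInv_eq _
  have hmtop : ∀ᵐ x, m x < ∞ := by
    have : ∫⁻ x, m x ≠ ∞ := by
      rw [← setLIntegral_univ, ← withDensity_apply _ MeasurableSet.univ, ← hμ]
      exact measure_ne_top _ _
    exact ae_lt_top hm this
  have hk2 : ∫⁻ x, m x ^ 2 ≠ ∞ := by
    have := (Lp.memLp k).2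
    rw [eLpNorm_lt_top_iff_lintegral_rpow_enorm_lt_top (by norm_num) (by norm_num)] at this
    refine ne_of_lt (lt_of_eq_of_lt ?_ this)
    refine lintegral_congr_ae ?_
    filter_upwards [hmk, hmtop] with x hx hx'
    rw [hx, ← ofReal_norm, Complex.norm_real, Real.norm_of_nonneg ENNReal.toReal_nonneg,
      ENNReal.ofReal_toReal hx'.ne]
    simp
  have hfin2 : IsFiniteMeasure (volume.withDensity fun x => m x ^ 2) :=
    isFiniteMeasure_withDensity hk2
  have hmt := measurable_transfer_quad (E := E) hs
  -- The exchange of partners, proved by comparing Fourier transforms. With `A`, `B` the shell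
  -- transforms, the transform of `m²` at `z` is the integral in `κ` of `A(κ+z) conj B(κ+z) · conj
  -- A(κ) B(κ)`; regrouped as `A(κ+z) B(κ)` times the conjugate of `A(κ) B(κ+z)`, it is given by
  -- Plancherel for pair densities. Equality of measures gives the identity for every weight at
  -- once.
  have key : (volume.withDensity fun x => m x ^ 2) = (quadMeasure s f g).map
      fun p => transfer s (pairPlus s p.1 p.2.1, pairMinus s p.1 p.2.2) := by
    have hfin3 : IsFiniteMeasure ((quadMeasure s f g).map
      fun p => transfer s (pairPlus s p.1 p.2.1, pairMinus s p.1 p.2.2)) := inferInstance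
    refine ext_of_integral_wave fun z => ?_
    rw [fourier_quadMeasure hs hf hg z,
      ← integral_shellTransform_mul hs hd (hfc.wave_mul z) hgc hfc (hgc.wave_mul z),
      integral_withDensity_eq_integral_toReal_smul (by fun_prop)
      (by filter_upwards [hmtop] with x hx using ENNReal.pow_lt_top hx)]
    have h1 := integral_mul_conj_fourierChar k k z
    rw [hFk] at h1
    have h2 := hW.coeFn_toLp
    have h3 := (measurePreserving_add_right volume z).quasiMeasurePreserving.ae_eq h2
    calc _ = ∫ x, wave (-inner ℝ x z) * (k x * conj (k x)) := by
          refine integral_congr_ae ?_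
          filter_upwards [hmk] with x hx
          rw [hx, Complex.conj_ofReal, ENNReal.toReal_pow, Complex.real_smul]
          push_cast
          ring
      _ = _ := h1
      _ = _ := by
          refine integral_congr_ae ?_
          filter_upwards [h2, h3] with κ h2 h3
          simp only [Function.comp_apply] at h3
          rw [h2, h3, shellTransform_add, shellTransform_add]
          simp only [map_mul, Complex.conj_conj]
          ring
  rw [← lintegral_quadMeasure hs hf.1 hg.1 hw, ← lintegral_map hw hmt, ← key,
    lintegral_withDensity_eq_lintegral_mul _ (by fun_prop) hw]
  simp only [Pi.mul_apply, mul_comm]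

end Transfer

/-! ### Removal of the boundedness assumptions by monotone truncation -/

section Exhaustion

variable {E : Type*} [NormedAddCommGroup E] [InnerProductSpace ℝ E] [FiniteDimensional ℝ E]
  [MeasurableSpace E] [BorelSpace E]

theorem quadIntegral_eq_lintegral_prod {s : ℝ} (hs : 0 < s) {f g : E → ℝ≥0∞} (hf : Measurable f)
    (hg : Measurable g) {w : WithLp 2 (ℝ × E) → ℝ≥0∞} (hw : Measurable w) :
    quadIntegral s w f g = ∫⁻ p, ENNReal.ofReal (pairWeight s p.1 p.2.1) *
      ENNReal.ofReal (pairWeight s p.1 p.2.2) *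
      ((f (pairPlus s p.1 p.2.1) * g (pairMinus s p.1 p.2.1)) *
        (f (pairPlus s p.1 p.2.2) * g (pairMinus s p.1 p.2.2))) *
        w (transfer s (pairPlus s p.1 p.2.1, pairMinus s p.1 p.2.2))
      ∂((volume : Measure (ℝ × E)).prod
        ((volume : Measure E).toSphere.prod (volume : Measure E).toSphere)) := by
  have h1 := measurable_quad hs hf hg
  have h2 := hw.comp (measurable_transfer_quad (E := E) hs)
  rw [← lintegral_quadMeasure hs hf hg hw]
  change ∫⁻ p, (w ∘ fun p : (ℝ × E) × Metric.sphere (0 : E) 1 × Metric.sphere (0 : E) 1 =>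
      transfer s (pairPlus s p.1 p.2.1, pairMinus s p.1 p.2.2)) p ∂_ = _
  rw [quadMeasure, lintegral_withDensity_eq_lintegral_mul _ h1 h2]
  rfl

/-- Truncation of a function in size and support. -/
def truncate (k : ℕ) (f : E → ℝ≥0∞) (η : E) : ℝ≥0∞ :=
  if ‖η‖ ≤ k then min (f η) k else 0

theorem boundedOnBall_truncate (k : ℕ) {f : E → ℝ≥0∞} (hf : Measurable f) :
    BoundedOnBall (truncate k f) := by
  refine ⟨?_, ⟨k, fun η => ?_⟩, k, fun η hη => ?_⟩
  · exact Measurable.ite (measurableSet_le (by fun_prop) (by fun_prop)) (by fun_prop) (by fun_prop)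
  · unfold truncate
    split_ifs
    · simp
    · simp
  · rw [truncate, if_neg (not_le.2 hη)]

theorem truncate_mono (f : E → ℝ≥0∞) (η : E) : Monotone fun k => truncate k f η := by
  intro k l hkl
  have h : (k : ℝ) ≤ l := by exact_mod_cast hkl
  simp only [truncate]
  by_cases h1 : ‖η‖ ≤ k
  · rw [if_pos h1, if_pos (h1.trans h)]
    exact min_le_min_left _ (by exact_mod_cast hkl)
  · rw [if_neg h1]; exact zero_le

theorem eventually_truncate_eq {f : E → ℝ≥0∞} {η : E} (h : f η ≠ ∞) :
    ∀ᶠ k in Filter.atTop, truncate k f η = f η := by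
  obtain ⟨n, hn⟩ := exists_nat_ge ‖η‖
  obtain ⟨l, hl⟩ := ENNReal.exists_nat_gt h
  filter_upwards [Filter.eventually_ge_atTop n, Filter.eventually_ge_atTop l] with k hk hk'
  have h1 : ‖η‖ ≤ k := hn.trans (by exact_mod_cast hk)
  rw [truncate, if_pos h1, min_eq_left]
  exact hl.le.trans (by exact_mod_cast hk')

theorem tendsto_quadIntegral_truncate {s : ℝ} (hs : 0 < s) {f g : E → ℝ≥0∞} (hf : Measurable f)
    (hg : Measurable g) (hf' : ∀ η, f η ≠ ∞) (hg' : ∀ η, g η ≠ ∞)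
    {w : WithLp 2 (ℝ × E) → ℝ≥0∞} (hw : Measurable w) :
    Filter.Tendsto (fun k => quadIntegral s w (truncate k f) (truncate k g)) Filter.atTop
      (nhds (quadIntegral s w f g)) := by
  have hmf := fun k => (boundedOnBall_truncate k hf).1
  have hmg := fun k => (boundedOnBall_truncate k hg).1
  simp only [fun k => quadIntegral_eq_lintegral_prod hs (hmf k) (hmg k) hw]
  rw [quadIntegral_eq_lintegral_prod hs hf hg hw]
  refine lintegral_tendsto_of_tendsto_of_monotone (fun k => ?_) ?_ ?_
  · exact ((measurable_quad hs (hmf k) (hmg k)).mul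
      (hw.comp (measurable_transfer_quad hs))).aemeasurable
  · refine Filter.Eventually.of_forall fun p k l hkl => ?_
    dsimp only
    gcongr <;> exact truncate_mono _ _ hkl
  · refine Filter.Eventually.of_forall fun p => tendsto_const_nhds.congr' ?_
    filter_upwards [eventually_truncate_eq (hf' (pairPlus s p.1 p.2.1)),
      eventually_truncate_eq (hf' (pairPlus s p.1 p.2.2)),
      eventually_truncate_eq (hg' (pairMinus s p.1 p.2.1)),
      eventually_truncate_eq (hg' (pairMinus s p.1 p.2.2))] with k h1 h2 h3 h4
    rw [h1, h2, h3, h4]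

theorem tendsto_transferMeasure_truncate (s : ℝ) {f g : E → ℝ≥0∞} (hf : Measurable f)
    (hg : Measurable g) (hf' : ∀ η, f η ≠ ∞) (hg' : ∀ η, g η ≠ ∞)
    {A : Set (WithLp 2 (ℝ × E))} (hA : MeasurableSet A) :
    Filter.Tendsto (fun k => transferMeasure s (truncate k f) (truncate k g) A) Filter.atTop
      (nhds (transferMeasure s f g A)) := by
  have hmf := fun k => (boundedOnBall_truncate k hf).1
  have hmg := fun k => (boundedOnBall_truncate k hg).1
  have hc := (continuous_transfer (E := E) s).measurable
  simp only [transferMeasure, Measure.map_apply hc hA, withDensity_apply _ (hc hA)]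
  refine lintegral_tendsto_of_tendsto_of_monotone (fun k => ?_) ?_ ?_
  · exact (((hmf k).comp measurable_fst).mul ((hmg k).comp measurable_snd)).aemeasurable
  · exact Filter.Eventually.of_forall fun p k l hkl =>
      mul_le_mul' (truncate_mono _ _ hkl) (truncate_mono _ _ hkl)
  · refine Filter.Eventually.of_forall fun p => tendsto_const_nhds.congr' ?_
    filter_upwards [eventually_truncate_eq (hf' p.1), eventually_truncate_eq (hg' p.2)] with k h1 h2
    rw [h1, h2]

theorem transferMeasure_mono (s : ℝ) {f g f' g' : E → ℝ≥0∞} (hf : ∀ η, f η ≤ f' η)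
    (hg : ∀ η, g η ≤ g' η) : transferMeasure s f g ≤ transferMeasure s f' g' := by
  refine Measure.map_mono ?_ (continuous_transfer s).measurable
  exact withDensity_mono (Filter.Eventually.of_forall fun p => mul_le_mul' (hf _) (hg _))

/-- The energy-momentum transfer has a density, whose weighted `L²` norm is an integral over
pairs of pairs of particles. -/
theorem exists_transferDensity {s : ℝ} (hs : 0 < s) (hd : 2 ≤ Module.finrank ℝ E)
    {f g : E → ℝ≥0∞} (hf : Measurable f) (hg : Measurable g) (hf' : ∀ η, f η ≠ ∞)
    (hg' : ∀ η, g η ≠ ∞) :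
    ∃ m : WithLp 2 (ℝ × E) → ℝ≥0∞, Measurable m ∧
      transferMeasure s f g = volume.withDensity m ∧
      ∀ w : WithLp 2 (ℝ × E) → ℝ≥0∞, Measurable w →
        ∫⁻ x, w x * m x ^ 2 = quadIntegral s w f g := by
  choose m hm hμ hI using fun k : ℕ => exists_transferDensity_of_boundedOnBall hs hd
    (boundedOnBall_truncate k hf) (boundedOnBall_truncate k hg)
  -- The transfer measures increase with the truncation level, so their densities do so almost
  -- everywhere; the density of the limit is the supremum.
  have hmono : ∀ᵐ x, Monotone fun k => m k x := by
    have : ∀ᵐ x, ∀ k, m k x ≤ m (k + 1) x := by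
      refine ae_all_iff.2 fun k => ?_
      refine ae_le_of_forall_setLIntegral_le_of_sigmaFinite (hm k) fun A hA _ => ?_
      rw [← withDensity_apply _ hA, ← withDensity_apply _ hA, ← hμ, ← hμ]
      exact transferMeasure_mono s (fun η => truncate_mono f η (Nat.le_succ k))
        (fun η => truncate_mono g η (Nat.le_succ k)) A
    filter_upwards [this] with x hx using monotone_nat_of_le_succ hx
  have htend : ∀ᵐ x, Filter.Tendsto (fun k => m k x) Filter.atTop (nhds (⨆ k, m k x)) := by
    filter_upwards [hmono] with x hx using tendsto_atTop_iSup hx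
  refine ⟨fun x => ⨆ k, m k x, by fun_prop, ?_, fun w hw => ?_⟩
  · refine Measure.ext fun A hA => ?_
    refine tendsto_nhds_unique (tendsto_transferMeasure_truncate s hf hg hf' hg' hA) ?_
    simp only [hμ, withDensity_apply _ hA]
    exact lintegral_tendsto_of_tendsto_of_monotone (fun k => (hm k).aemeasurable)
      (ae_restrict_of_ae hmono) (ae_restrict_of_ae htend)
  · refine tendsto_nhds_unique ?_ (tendsto_quadIntegral_truncate hs hf hg hf' hg' hw)
    simp only [← hI _ w hw]
    refine lintegral_tendsto_of_tendsto_of_monotone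
      (fun k => (hw.mul ((hm k).pow_const 2)).aemeasurable) ?_ ?_
    · filter_upwards [hmono] with x hx k l hkl
      have := hx hkl
      dsimp only at this ⊢
      gcongr
    · filter_upwards [hmono] with x hx
      have e : w x * (⨆ k, m k x) ^ 2 = ⨆ k, w x * m k x ^ 2 := by
        rw [ENNReal.iSup_pow, ENNReal.mul_iSup]
      rw [e]
      exact tendsto_atTop_iSup fun k l hkl => by
        have := hx hkl
        dsimp only at this ⊢
        gcongr

end Exhaustion

/-! ### The integral of `(1 + ⟨e, ω⟩)^b` over the unit sphere -/

section Angular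

theorem lintegral_rpow_mul_exp_neg_mul {a r : ℝ} (ha : 0 < a) (hr : 0 < r) :
    ∫⁻ t in Set.Ioi (0 : ℝ), ENNReal.ofReal (t ^ (a - 1) * Real.exp (-(r * t))) =
      ENNReal.ofReal ((1 / r) ^ a * Real.Gamma a) := by
  have h := Real.integral_rpow_mul_exp_neg_mul_Ioi ha hr
  have hpos : 0 < (1 / r) ^ a * Real.Gamma a := mul_pos (by positivity) (Real.Gamma_pos_of_pos ha)
  rw [← h, ofReal_integral_eq_lintegral_ofReal]
  · exact Integrable.of_integral_ne_zero (by rw [h]; exact hpos.ne')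
  · filter_upwards [ae_restrict_mem measurableSet_Ioi] with t ht
    have : (0 : ℝ) < t := ht
    positivity

theorem lintegral_exp_neg_mul_sq_norm {F : Type*} [NormedAddCommGroup F] [InnerProductSpace ℝ F]
    [FiniteDimensional ℝ F] [MeasurableSpace F] [BorelSpace F] {b : ℝ} (hb : 0 < b) :
    ∫⁻ y : F, ENNReal.ofReal (Real.exp (-b * ‖y‖ ^ 2)) =
      ENNReal.ofReal ((Real.pi / b) ^ (Module.finrank ℝ F / 2 : ℝ)) := by
  have h := GaussianFourier.integral_rexp_neg_mul_sq_norm (V := F) hb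
  rw [← h, ofReal_integral_eq_lintegral_ofReal]
  · refine Integrable.of_integral_ne_zero ?_
    rw [h]
    have := Real.pi_pos
    positivity
  · exact Filter.Eventually.of_forall fun y => (Real.exp_pos _).le

/-- The light-cone coordinate `u = √(x² + ρ²) + x` has `ρ²/u = √(x² + ρ²) - x` and `dx / √(x² + ρ²)
= du / u`. -/
theorem lintegral_lightCone {ρ : ℝ} (hρ : 0 < ρ) (b : ℝ) :
    ∫⁻ x : ℝ, ENNReal.ofReal ((√(x ^ 2 + ρ ^ 2) + x) ^ b * Real.exp (-√(x ^ 2 + ρ ^ 2)) /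
        √(x ^ 2 + ρ ^ 2)) =
      ∫⁻ u in Set.Ioi (0 : ℝ), ENNReal.ofReal (u ^ (b - 1) * Real.exp (-(u + ρ ^ 2 / u) / 2)) := by
  have hsq : ∀ u : ℝ, 0 < u → √(((u - ρ ^ 2 / u) / 2) ^ 2 + ρ ^ 2) = (u + ρ ^ 2 / u) / 2 := by
    intro u hu
    rw [show ((u - ρ ^ 2 / u) / 2) ^ 2 + ρ ^ 2 = ((u + ρ ^ 2 / u) / 2) ^ 2 by field_simp; ring,
      Real.sqrt_sq (by positivity)]
  have himg : (fun u : ℝ => (u - ρ ^ 2 / u) / 2) '' Set.Ioi 0 = Set.univ := by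
    refine Set.eq_univ_of_forall fun x => ⟨√(x ^ 2 + ρ ^ 2) + x, ?_, ?_⟩
    · have : |x| < √(x ^ 2 + ρ ^ 2) := Real.lt_sqrt_of_sq_lt (by rw [sq_abs]; nlinarith)
      have := neg_abs_le x
      exact Set.mem_Ioi.2 (by linarith)
    · have h1 : |x| < √(x ^ 2 + ρ ^ 2) := Real.lt_sqrt_of_sq_lt (by rw [sq_abs]; nlinarith)
      have h2 := neg_abs_le x
      have h3 : 0 < √(x ^ 2 + ρ ^ 2) + x := by linarith
      have h4 : √(x ^ 2 + ρ ^ 2) ^ 2 = x ^ 2 + ρ ^ 2 := Real.sq_sqrt (by positivity)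
      field_simp
      linear_combination h4
  have hder : ∀ u ∈ Set.Ioi (0 : ℝ), HasDerivWithinAt (fun u : ℝ => (u - ρ ^ 2 / u) / 2)
      ((1 + ρ ^ 2 / u ^ 2) / 2) (Set.Ioi 0) u := by
    intro u hu
    have hu : (0 : ℝ) < u := hu
    have := (((hasDerivAt_id u).sub ((hasDerivAt_inv hu.ne').const_mul (ρ ^ 2))).div_const 2)
    refine (this.congr_deriv ?_).hasDerivWithinAt.congr (fun v _ => ?_) ?_
    · field_simp; ring
    · simp [div_eq_mul_inv]
    · simp [div_eq_mul_inv]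
  have hinj : Set.InjOn (fun u : ℝ => (u - ρ ^ 2 / u) / 2) (Set.Ioi 0) := by
    intro u hu v hv h
    have hu : (0 : ℝ) < u := hu
    have hv : (0 : ℝ) < v := hv
    have h1 := hsq u hu
    dsimp only at h
    rw [h, hsq v hv] at h1
    linarith
  have := lintegral_image_eq_lintegral_abs_deriv_mul measurableSet_Ioi hder hinj
    (fun x => ENNReal.ofReal ((√(x ^ 2 + ρ ^ 2) + x) ^ b * Real.exp (-√(x ^ 2 + ρ ^ 2)) /
        √(x ^ 2 + ρ ^ 2)))
  rw [himg, Measure.restrict_univ] at this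
  rw [this]
  refine setLIntegral_congr_fun measurableSet_Ioi fun u hu => ?_
  have hu : (0 : ℝ) < u := hu
  rw [hsq u hu, ← ENNReal.ofReal_mul (abs_nonneg _), abs_of_pos (by positivity)]
  congr 1
  rw [show (u + ρ ^ 2 / u) / 2 + (u - ρ ^ 2 / u) / 2 = u by ring, Real.rpow_sub_one hu.ne',
    neg_div]
  field_simp

variable {E : Type*} [NormedAddCommGroup E] [InnerProductSpace ℝ E] [FiniteDimensional ℝ E]
  [MeasurableSpace E] [BorelSpace E]

/-- Any isometry onto the product, followed by the reflection that exchanges the image of `e` with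
the unit vector of the first factor. -/
theorem exists_isometry_prod (hd : 2 ≤ Module.finrank ℝ E) (e : E) (he : ‖e‖ = 1) :
    ∃ L : E ≃ₗᵢ[ℝ] WithLp 2 (ℝ × EuclideanSpace ℝ (Fin (Module.finrank ℝ E - 1))),
      L e = WithLp.toLp 2 (1, 0) := by
  set V := WithLp 2 (ℝ × EuclideanSpace ℝ (Fin (Module.finrank ℝ E - 1)))
  have hfin : Module.finrank ℝ V = Module.finrank ℝ E := by
    rw [LinearEquiv.finrank_eq (WithLp.linearEquiv 2 ℝ _), Module.finrank_prod]
    simp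
    omega
  let L₀ : E ≃ₗᵢ[ℝ] V := (stdOrthonormalBasis ℝ E).equiv (stdOrthonormalBasis ℝ V)
    (finCongr hfin.symm)
  have hnorm : ‖L₀ e‖ = ‖(WithLp.toLp 2 (1, 0) : V)‖ := by
    rw [L₀.norm_map, he, WithLp.prod_norm_eq_of_L2]
    simp
  exact ⟨L₀.trans (Submodule.reflection (ℝ ∙ (L₀ e - (WithLp.toLp 2 (1, 0) : V)))ᗮ),
    Submodule.reflection_sub hnorm⟩

/-- The integral of `(1 + ⟨e, ω⟩)^b` over the unit sphere of an `n`-dimensional space. -/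
def angularConst (n : ℕ) (b : ℝ) : ℝ :=
  (2 * Real.pi) ^ (((n : ℝ) - 1) / 2) * 2 ^ (b + ((n : ℝ) - 1) / 2) *
    (Real.Gamma (b + ((n : ℝ) - 1) / 2) / Real.Gamma (b + n - 1))

/-- Split along `e` and pass to the light-cone coordinate `u` in that direction: the exponent
becomes quadratic in the transverse variable. The Gaussian integral contributes `(2πu)^((n-1)/2)`
and a Gamma integral in `u` remains; `hb` is its convergence at `0`. -/
theorem lintegral_norm_add_inner (hd : 2 ≤ Module.finrank ℝ E) (e : E) (he : ‖e‖ = 1) {b : ℝ}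
    (hb : 0 < b + ((Module.finrank ℝ E : ℝ) - 1) / 2) :
    ∫⁻ y : E, ENNReal.ofReal ((‖y‖ + inner ℝ e y) ^ b * Real.exp (-‖y‖) / ‖y‖) =
      ENNReal.ofReal ((2 * Real.pi) ^ (((Module.finrank ℝ E : ℝ) - 1) / 2) *
        2 ^ (b + ((Module.finrank ℝ E : ℝ) - 1) / 2) *
        Real.Gamma (b + ((Module.finrank ℝ E : ℝ) - 1) / 2)) := by
  set n := Module.finrank ℝ E with hn
  set F := EuclideanSpace ℝ (Fin (n - 1)) with hF
  obtain ⟨L, hL⟩ : ∃ L : E ≃ₗᵢ[ℝ] WithLp 2 (ℝ × F), L e = WithLp.toLp 2 (1, 0) :=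
    exists_isometry_prod hd e he
  have hF' : Module.finrank ℝ F = n - 1 := finrank_euclideanSpace_fin
  have hfinF : (Module.finrank ℝ F : ℝ) = n - 1 := by
    rw [hF', Nat.cast_sub (by omega)]; simp
  have : Nontrivial F := Module.nontrivial_of_finrank_pos (R := ℝ) (by omega)
  calc _ = ∫⁻ y : WithLp 2 (ℝ × F), ENNReal.ofReal ((‖y‖ + y.fst) ^ b * Real.exp (-‖y‖) / ‖y‖) := by
        rw [← L.measurePreserving.lintegral_comp_emb L.toHomeomorph.measurableEmbedding]
        refine lintegral_congr fun y => ?_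
        have : inner ℝ e y = (L y).fst := by
          rw [← L.inner_map_map, hL, WithLp.prod_inner_apply]
          simp
        rw [L.norm_map, this]
    _ = ∫⁻ p : ℝ × F, ENNReal.ofReal ((√(p.1 ^ 2 + ‖p.2‖ ^ 2) + p.1) ^ b *
          Real.exp (-√(p.1 ^ 2 + ‖p.2‖ ^ 2)) / √(p.1 ^ 2 + ‖p.2‖ ^ 2)) := by
        rw [← (WithLp.volume_preserving_toLp ℝ F).lintegral_comp_emb
          (MeasurableEquiv.toLp 2 (ℝ × F)).measurableEmbedding]
        simp [WithLp.prod_norm_eq_of_L2]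
    _ = ∫⁻ y : F, ∫⁻ x : ℝ, ENNReal.ofReal ((√(x ^ 2 + ‖y‖ ^ 2) + x) ^ b *
          Real.exp (-√(x ^ 2 + ‖y‖ ^ 2)) / √(x ^ 2 + ‖y‖ ^ 2)) := by
        rw [Measure.volume_eq_prod, lintegral_prod_symm]
        exact Measurable.aemeasurable (by fun_prop)
    _ = ∫⁻ y : F, ∫⁻ u in Set.Ioi (0 : ℝ),
          ENNReal.ofReal (u ^ (b - 1) * Real.exp (-(u + ‖y‖ ^ 2 / u) / 2)) := by
        refine lintegral_congr_ae ?_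
        have : ∀ᵐ y : F, y ≠ 0 := by simp [ae_iff]
        filter_upwards [this] with y hy
        exact lintegral_lightCone (norm_pos_iff.2 hy) b
    _ = ∫⁻ u in Set.Ioi (0 : ℝ), ∫⁻ y : F,
          ENNReal.ofReal (u ^ (b - 1) * Real.exp (-(u + ‖y‖ ^ 2 / u) / 2)) := by
        rw [lintegral_lintegral_swap]
        exact Measurable.aemeasurable (by fun_prop)
    _ = ∫⁻ u in Set.Ioi (0 : ℝ), ENNReal.ofReal ((2 * Real.pi) ^ (((n : ℝ) - 1) / 2)) *
          ENNReal.ofReal (u ^ (b + ((n : ℝ) - 1) / 2 - 1) * Real.exp (-(1 / 2 * u))) := by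
        refine setLIntegral_congr_fun measurableSet_Ioi fun u hu => ?_
        have hu : (0 : ℝ) < u := hu
        have hpi := Real.pi_pos
        calc _ = ∫⁻ y : F, ENNReal.ofReal (u ^ (b - 1) * Real.exp (-(1 / 2 * u))) *
              ENNReal.ofReal (Real.exp (-(1 / (2 * u)) * ‖y‖ ^ 2)) := by
              refine lintegral_congr fun y => ?_
              rw [← ENNReal.ofReal_mul (by positivity), mul_assoc, ← Real.exp_add]
              congr 3
              field_simp
              ring
          _ = _ := by
              rw [lintegral_const_mul _ (by fun_prop), lintegral_exp_neg_mul_sq_norm (by positivity),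
                ← ENNReal.ofReal_mul (by positivity), ← ENNReal.ofReal_mul (by positivity), hfinF]
              congr 1
              rw [show Real.pi / (1 / (2 * u)) = (2 * Real.pi) * u by field_simp,
                Real.mul_rpow (by positivity) hu.le, show b + ((n : ℝ) - 1) / 2 - 1 =
                (b - 1) + ((n : ℝ) - 1) / 2 by ring, Real.rpow_add hu]
              ring
    _ = _ := by
        rw [lintegral_const_mul _ (by fun_prop), lintegral_rpow_mul_exp_neg_mul hb (by norm_num),
          ← ENNReal.ofReal_mul (by have := Real.pi_pos; positivity)]
        norm_num
        ring_nf

/-- In polar coordinates the integral of `lintegral_norm_add_inner` is the spherical integral times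
the radial factor `Γ(b + n - 1)`; dividing gives the constant. -/
theorem lintegral_sphere_one_add_inner (hd : 2 ≤ Module.finrank ℝ E) (e : Metric.sphere (0 : E) 1)
    {b : ℝ} (hb : 0 < b + ((Module.finrank ℝ E : ℝ) - 1) / 2) :
    ∫⁻ ω, ENNReal.ofReal ((1 + inner ℝ (e : E) (ω : E)) ^ b) ∂(volume : Measure E).toSphere =
      ENNReal.ofReal (angularConst (Module.finrank ℝ E) b) := by
  have : Nontrivial E := Module.nontrivial_of_finrank_pos (R := ℝ) (by omega)
  have he : ‖(e : E)‖ = 1 := by simp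
  have h := lintegral_norm_add_inner hd (e : E) he hb
  have hd' : (2 : ℝ) ≤ Module.finrank ℝ E := by exact_mod_cast hd
  have hpos : 0 < b + Module.finrank ℝ E - 1 := by linarith
  have hΓ := Real.Gamma_pos_of_pos hpos
  rw [lintegral_polar (by fun_prop)] at h
  have h2 : ∀ ω : Metric.sphere (0 : E) 1, (∫⁻ r in Set.Ioi (0 : ℝ),
      ENNReal.ofReal (r ^ (Module.finrank ℝ E - 1)) * ENNReal.ofReal
        ((‖r • (ω : E)‖ + inner ℝ (e : E) (r • (ω : E))) ^ b * Real.exp (-‖r • (ω : E)‖) /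
          ‖r • (ω : E)‖)) =
      ENNReal.ofReal ((1 + inner ℝ (e : E) (ω : E)) ^ b) *
        ENNReal.ofReal (Real.Gamma (b + Module.finrank ℝ E - 1)) := by
    intro ω
    have hω : ‖(ω : E)‖ = 1 := by simp
    have h0 : 0 ≤ 1 + inner ℝ (e : E) (ω : E) := by
      have := neg_le_of_abs_le (abs_real_inner_le_norm (e : E) (ω : E))
      rw [he, hω] at this
      linarith
    have h3 := lintegral_rpow_mul_exp_neg_mul hpos one_pos
    rw [div_one, Real.one_rpow, one_mul] at h3
    rw [← h3, ← lintegral_const_mul _ (by fun_prop)]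
    refine setLIntegral_congr_fun measurableSet_Ioi fun r hr => ?_
    have hr : (0 : ℝ) < r := hr
    rw [norm_smul, hω, mul_one, Real.norm_of_nonneg hr.le, real_inner_smul_right,
      ← ENNReal.ofReal_mul (by positivity), ← ENNReal.ofReal_mul (by positivity),
      show r + r * inner ℝ (e : E) (ω : E) = r * (1 + inner ℝ (e : E) (ω : E)) by ring,
      Real.mul_rpow hr.le h0]
    congr 1
    obtain ⟨k, hk⟩ : ∃ k, Module.finrank ℝ E = k + 2 := ⟨_, (Nat.sub_add_cancel hd).symm⟩
    rw [hk, show k + 2 - 1 = k + 1 by omega, show b + ((k + 2 : ℕ) : ℝ) - 1 - 1 = b + k by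
      push_cast; ring, Real.rpow_add hr, Real.rpow_natCast]
    field_simp
    rw [pow_succ]
    ring_nf
  simp only [h2] at h
  rw [lintegral_mul_const _ (by fun_prop)] at h
  rw [angularConst, ← mul_div_assoc, ENNReal.ofReal_div_of_pos hΓ, ← h,
    ENNReal.mul_div_cancel_right (by simpa using hΓ) ENNReal.ofReal_ne_top]

end Angular

/-! ### Schur test on the spheres of fixed total energy-momentum -/

section Schur

theorem two_mul_mul_le_sq_add_sq (u v : ℝ≥0∞) : 2 * (u * v) ≤ u ^ 2 + v ^ 2 := by
  rcases eq_or_ne u ∞ with rfl | hu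
  · simp
  rcases eq_or_ne v ∞ with rfl | hv
  · simp
  lift u to NNReal using hu
  lift v to NNReal using hv
  have := two_mul_le_add_sq (u : ℝ) v
  rw [mul_assoc] at this
  exact_mod_cast this

/-- The Schur test for a symmetric kernel with constant marginals. -/
theorem lintegral_lintegral_mul_le {α : Type*} [MeasurableSpace α] {μ : Measure α} [SFinite μ]
    {k : α → α → ℝ≥0∞} (hk : Measurable (Function.uncurry k)) (hsymm : ∀ x y, k x y = k y x)
    {c : ℝ≥0∞} (hc : ∀ x, ∫⁻ y, k x y ∂μ = c) {u : α → ℝ≥0∞} (hu : Measurable u) :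
    ∫⁻ x, ∫⁻ y, u x * u y * k x y ∂μ ∂μ ≤ c * ∫⁻ x, u x ^ 2 ∂μ := by
  have hk' : ∀ x, Measurable (k x) := fun x => hk.comp measurable_prodMk_left
  have hkk : Measurable fun p : α × α => k p.1 p.2 := hk
  have h1 : ∫⁻ x, ∫⁻ y, u x ^ 2 * k x y ∂μ ∂μ = c * ∫⁻ x, u x ^ 2 ∂μ := by
    rw [← lintegral_const_mul _ (by fun_prop)]
    refine lintegral_congr fun x => ?_
    rw [lintegral_const_mul _ (hk' x), hc, mul_comm]
  have h2 : ∫⁻ x, ∫⁻ y, u y ^ 2 * k x y ∂μ ∂μ = c * ∫⁻ x, u x ^ 2 ∂μ := by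
    rw [lintegral_lintegral_swap, ← h1]
    · exact lintegral_congr fun x => lintegral_congr fun y => by rw [hsymm]
    · exact Measurable.aemeasurable (by fun_prop)
  -- Bound `2 u(x) u(y)` by `u(x)² + u(y)²`; each of the two terms integrates to `c ∫ u²`, the
  -- second by symmetry of the kernel.
  refine (ENNReal.mul_le_mul_iff_right two_ne_zero ENNReal.ofNat_ne_top).1 ?_
  rw [two_mul (c * _)]
  nth_rewrite 1 [← h1]
  rw [← h2, ← lintegral_add_left (Measurable.lintegral_prod_right' (f := fun p : α × α =>
    u p.1 ^ 2 * k p.1 p.2) (by fun_prop)), ← lintegral_const_mul _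
    (Measurable.lintegral_prod_right' (f := fun p : α × α => u p.1 * u p.2 * k p.1 p.2)
      (by fun_prop))]
  refine lintegral_mono fun x => ?_
  have := hk' x
  dsimp only
  rw [← lintegral_add_left (by fun_prop), ← lintegral_const_mul _ (by fun_prop)]
  refine lintegral_mono fun y => ?_
  rw [← add_mul, ← mul_assoc]
  exact mul_le_mul_left (two_mul_mul_le_sq_add_sq _ _) _

/-- A constant function saturates the Schur test; this is the source of the extremisers. -/
theorem lintegral_lintegral_mul_eq {α : Type*} [MeasurableSpace α] {μ : Measure α}
    {k : α → α → ℝ≥0∞} (hk : Measurable (Function.uncurry k))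
    {c : ℝ≥0∞} (hc : ∀ x, ∫⁻ y, k x y ∂μ = c) {u : α → ℝ≥0∞} (hu : Measurable u)
    (hconst : ∀ x y, u x = u y) :
    ∫⁻ x, ∫⁻ y, u x * u y * k x y ∂μ ∂μ = c * ∫⁻ x, u x ^ 2 ∂μ := by
  rw [← lintegral_const_mul _ (by fun_prop)]
  refine lintegral_congr fun x => ?_
  have hkx : Measurable (k x) := hk.comp measurable_prodMk_left
  rw [← hc x, mul_comm, ← lintegral_const_mul _ hkx]
  refine lintegral_congr fun y => ?_
  rw [hconst y x, sq]

variable {d : ℕ}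

/-- The weight `|τ² - |ξ|²|^{2β}`. -/
def boxWeight (β : ℝ) (x : WithLp 2 (ℝ × EuclideanSpace ℝ (Fin d))) : ℝ≥0∞ :=
  ENNReal.ofReal (|x.fst ^ 2 - ‖x.snd‖ ^ 2| ^ (2 * β))

theorem measurable_boxWeight (β : ℝ) : Measurable (boxWeight (d := d) β) := by
  unfold boxWeight
  have h1 : Continuous fun x : WithLp 2 (ℝ × EuclideanSpace ℝ (Fin d)) => x.fst := by fun_prop
  have h2 : Continuous fun x : WithLp 2 (ℝ × EuclideanSpace ℝ (Fin d)) => x.snd := by fun_prop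
  have := h1.measurable
  have := h2.measurable
  fun_prop

theorem cmRadius_pos {s : ℝ} {q : ℝ × EuclideanSpace ℝ (Fin d)}
    (hq : √(‖q.2‖ ^ 2 + 4 * s ^ 2) < q.1) : 0 < cmRadius s q := by
  have h0 : 0 ≤ √(‖q.2‖ ^ 2 + 4 * s ^ 2) := Real.sqrt_nonneg _
  have h1 : ‖q.2‖ ^ 2 + 4 * s ^ 2 < q.1 ^ 2 := (Real.sqrt_lt' (by linarith)).1 hq
  exact Real.sqrt_pos.2 (by linarith)

theorem one_add_inner_nonneg (ω ω' : Metric.sphere (0 : EuclideanSpace ℝ (Fin d)) 1) :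
    0 ≤ 1 + inner ℝ (ω : EuclideanSpace ℝ (Fin d)) (ω' : EuclideanSpace ℝ (Fin d)) := by
  have := neg_le_of_abs_le (abs_real_inner_le_norm (ω : EuclideanSpace ℝ (Fin d)) ω')
  simp only [norm_eq_of_mem_sphere, mul_one] at this
  linarith

/-- By `minkowski_transfer` the weight depends only on the centre-of-mass vectors, through `‖rω +
rω'‖² = 2r²(1 + ω·ω')`. -/
theorem boxWeight_transfer_pair {s : ℝ} (hs : 0 < s) (β : ℝ)
    {q : ℝ × EuclideanSpace ℝ (Fin d)} (hq : √(‖q.2‖ ^ 2 + 4 * s ^ 2) < q.1)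
    (ω ω' : Metric.sphere (0 : EuclideanSpace ℝ (Fin d)) 1) :
    boxWeight β (transfer s (pairPlus s q ω, pairMinus s q ω')) =
      ENNReal.ofReal ((2 * cmRadius s q ^ 2) ^ (2 * β)) * ENNReal.ofReal
        ((1 + inner ℝ (ω : EuclideanSpace ℝ (Fin d)) (ω' : EuclideanSpace ℝ (Fin d))) ^
          (2 * β)) := by
  have hr := cmRadius_pos hq
  have h0 := one_add_inner_nonneg ω ω'
  have h := minkowski_transfer hs q.2 (cmRadius s q • (ω : EuclideanSpace ℝ (Fin d)))
    (cmRadius s q • (ω' : EuclideanSpace ℝ (Fin d))) (by simp [norm_smul])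
  have h2 : ‖cmRadius s q • (ω : EuclideanSpace ℝ (Fin d)) +
      cmRadius s q • (ω' : EuclideanSpace ℝ (Fin d))‖ ^ 2 = 2 * cmRadius s q ^ 2 *
      (1 + inner ℝ (ω : EuclideanSpace ℝ (Fin d)) (ω' : EuclideanSpace ℝ (Fin d))) := by
    rw [← smul_add, norm_smul, mul_pow, norm_add_sq_real]
    simp only [norm_eq_of_mem_sphere, Real.norm_eq_abs, sq_abs]
    ring
  rw [boxWeight, ← ENNReal.ofReal_mul (by positivity), ← Real.mul_rpow (by positivity) h0, ← h2]
  congr 2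
  have e : (transfer s (pairPlus s q ω, pairMinus s q ω')).fst ^ 2 -
      ‖(transfer s (pairPlus s q ω, pairMinus s q ω')).snd‖ ^ 2 =
      -‖cmRadius s q • (ω : EuclideanSpace ℝ (Fin d)) +
      cmRadius s q • (ω' : EuclideanSpace ℝ (Fin d))‖ ^ 2 := h
  rw [e, abs_neg, abs_of_nonneg (by positivity)]

/-- The constant in the bound for the weighted norm of the transfer density. -/
def schurConst (d : ℕ) (β : ℝ) : ℝ := 2 ^ (-((d : ℝ) - 1) / 2) * angularConst d (2 * β)

/-- On a pair of centre-of-mass radius `r` the two expressions in `kernel` are `2r²` and `2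
φ_s(r)²`, both independent of `ω`. The kernel is thus the radial part of the weight times the phase
space density, up to a power of `2`. -/
theorem kernel_pair {s : ℝ} (hs : 0 < s) (hd : 2 ≤ d) (β : ℝ)
    {q : ℝ × EuclideanSpace ℝ (Fin d)} (hq : √(‖q.2‖ ^ 2 + 4 * s ^ 2) < q.1)
    (ω : Metric.sphere (0 : EuclideanSpace ℝ (Fin d)) 1) :
    (2 * cmRadius s q ^ 2) ^ (2 * β) * cmDensity s q = 2 ^ (-((d : ℝ) - 1) / 2) *
      kernel s (1 / 2) (((d : ℝ) - 2) / 2 + 2 * β) (pairPlus s q ω) (pairMinus s q ω) := by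
  have hr := cmRadius_pos hq
  have hφ := phi_pos hs (cmRadius s q)
  have h := minkowski_legs hs q.2 (cmRadius s q • (ω : EuclideanSpace ℝ (Fin d)))
  have hn : ‖cmRadius s q • (ω : EuclideanSpace ℝ (Fin d))‖ = cmRadius s q := by
    simp [norm_smul, abs_of_pos hr]
  rw [hn] at h
  have h2 := phi_sq s (cmRadius s q)
  rw [kernel, pairPlus, pairMinus, h, show s ^ 2 + 2 * cmRadius s q ^ 2 - s ^ 2 =
    2 * cmRadius s q ^ 2 by ring, show s ^ 2 + 2 * cmRadius s q ^ 2 + s ^ 2 =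
    2 * phi s (cmRadius s q) ^ 2 by linarith, cmDensity, if_pos hq, ← phi_cmRadius hq,
    finrank_euclideanSpace_fin, add_comm (((d : ℝ) - 2) / 2), Real.rpow_add (by positivity)]
  have h3 : ∀ x : ℝ, 0 < x → ∀ e : ℝ, (2 * x ^ 2) ^ e = 2 ^ e * x ^ (2 * e) := fun x hx e => by
    rw [Real.mul_rpow (by positivity) (by positivity), ← Real.rpow_natCast x 2,
      ← Real.rpow_mul hx.le]
    norm_num
  rw [h3 _ hφ, h3 _ hr (((d : ℝ) - 2) / 2), show (2 : ℝ) * (1 / 2) = 1 by norm_num,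
    Real.rpow_one, show 2 * (((d : ℝ) - 2) / 2) = ((d - 2 : ℕ) : ℝ) by
      rw [Nat.cast_sub hd]; push_cast; ring, Real.rpow_natCast]
  have h4 : (2 : ℝ) ^ (-((d : ℝ) - 1) / 2) * 2 ^ (((d : ℝ) - 2) / 2) / 2 ^ (1 / 2 : ℝ) = 2⁻¹ := by
    rw [← Real.rpow_add two_pos, ← Real.rpow_sub two_pos, ← Real.rpow_neg_one]
    congr 1
    ring
  have h5 : (2 : ℝ) ^ (1 / 2 : ℝ) ≠ 0 := by positivity
  field_simp at h4 ⊢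
  linear_combination (-1) * h4

theorem measurable_kernel (s a b : ℝ) :
    Measurable fun η : EuclideanSpace ℝ (Fin d) × EuclideanSpace ℝ (Fin d) =>
      kernel s a b η.1 η.2 := by
  have := (continuous_phi s).measurable
  have h2 : Measurable fun η : EuclideanSpace ℝ (Fin d) × EuclideanSpace ℝ (Fin d) =>
      (inner ℝ η.1 η.2 : ℝ) := by fun_prop
  unfold kernel
  fun_prop

theorem angularConst_pos (hd : 2 ≤ d) {b : ℝ} (hb : 0 < b + ((d : ℝ) - 1) / 2) :
    0 < angularConst d b := by
  have hd' : (2 : ℝ) ≤ d := by exact_mod_cast hd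
  have h1 := Real.Gamma_pos_of_pos hb
  have h2 : 0 < Real.Gamma (b + d - 1) := Real.Gamma_pos_of_pos (by linarith)
  have := Real.pi_pos
  unfold angularConst
  positivity

variable {s β : ℝ} {f g : EuclideanSpace ℝ (Fin d) → ℝ≥0∞}

theorem quadIntegral_boxWeight_eq (hs : 0 < s) (hf : Measurable f) (hg : Measurable g) :
    quadIntegral s (boxWeight β) f g = ∫⁻ q : ℝ × EuclideanSpace ℝ (Fin d),
      ENNReal.ofReal ((2 * cmRadius s q ^ 2) ^ (2 * β)) * ∫⁻ ω, ∫⁻ ω',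
        (ENNReal.ofReal (pairWeight s q ω) * (f (pairPlus s q ω) * g (pairMinus s q ω))) *
        (ENNReal.ofReal (pairWeight s q ω') * (f (pairPlus s q ω') * g (pairMinus s q ω'))) *
        ENNReal.ofReal ((1 + inner ℝ (ω : EuclideanSpace ℝ (Fin d))
          (ω' : EuclideanSpace ℝ (Fin d))) ^ (2 * β))
        ∂(volume : Measure (EuclideanSpace ℝ (Fin d))).toSphere
        ∂(volume : Measure (EuclideanSpace ℝ (Fin d))).toSphere := by
  refine lintegral_congr fun q => ?_
  have hp := (measurable_pairPlus (E := EuclideanSpace ℝ (Fin d)) hs).comp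
    (measurable_prodMk_left (x := q))
  have hm := (measurable_pairMinus (E := EuclideanSpace ℝ (Fin d)) hs).comp
    (measurable_prodMk_left (x := q))
  have hw := (measurable_pairWeight (E := EuclideanSpace ℝ (Fin d)) hs).comp
    (measurable_prodMk_left (x := q))
  set u : Metric.sphere (0 : EuclideanSpace ℝ (Fin d)) 1 → ℝ≥0∞ := fun ω =>
    ENNReal.ofReal (pairWeight s q ω) * (f (pairPlus s q ω) * g (pairMinus s q ω)) with hu_def
  have hu : Measurable u := hw.ennreal_ofReal.mul ((hf.comp hp).mul (hg.comp hm))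
  have hu2 : Measurable fun p : Metric.sphere (0 : EuclideanSpace ℝ (Fin d)) 1 ×
      Metric.sphere (0 : EuclideanSpace ℝ (Fin d)) 1 => u p.1 * u p.2 * ENNReal.ofReal ((1 + inner ℝ
      (p.1 : EuclideanSpace ℝ (Fin d)) (p.2 : EuclideanSpace ℝ (Fin d))) ^ (2 * β)) := by
    fun_prop
  have h1 : ∀ ω, Measurable fun ω' : Metric.sphere (0 : EuclideanSpace ℝ (Fin d)) 1 =>
      u ω * u ω' * ENNReal.ofReal ((1 + inner ℝ (ω : EuclideanSpace ℝ (Fin d))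
        (ω' : EuclideanSpace ℝ (Fin d))) ^ (2 * β)) := fun ω => by fun_prop
  rw [← lintegral_const_mul _ hu2.lintegral_prod_right]
  refine lintegral_congr fun ω => ?_
  rw [← lintegral_const_mul _ (h1 ω)]
  refine lintegral_congr fun ω' => ?_
  by_cases h : pairWeight s q ω = 0
  · simp [h, hu_def]
  · rw [boxWeight_transfer_pair hs β (lt_of_pairWeight_ne_zero h)]
    simp only [hu_def]
    ring

/-- The right-hand side of the estimate in centre-of-mass variables. The change of variables
supplies one factor `pairWeight`, and the factors `φ φ 𝒦` supply a second one together with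
`(2r²)^{2β}`, which is the square that the Schur test produces. -/
theorem schurConst_mul_lintegral (hs : 0 < s) (hd : 2 ≤ d) (hβ : (1 - (d : ℝ)) / 4 < β)
    (hf : Measurable f) (hg : Measurable g) :
    ENNReal.ofReal (schurConst d β) * ∫⁻ η : EuclideanSpace ℝ (Fin d) × EuclideanSpace ℝ (Fin d),
      (f η.1 * g η.2) ^ 2 * ENNReal.ofReal (phi s ‖η.1‖ * phi s ‖η.2‖ *
        kernel s (1 / 2) (((d : ℝ) - 2) / 2 + 2 * β) η.1 η.2) =
    ∫⁻ q : ℝ × EuclideanSpace ℝ (Fin d),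
      ENNReal.ofReal ((2 * cmRadius s q ^ 2) ^ (2 * β)) *
        (ENNReal.ofReal (angularConst d (2 * β)) * ∫⁻ ω,
          (ENNReal.ofReal (pairWeight s q ω) * (f (pairPlus s q ω) * g (pairMinus s q ω))) ^ 2
          ∂(volume : Measure (EuclideanSpace ℝ (Fin d))).toSphere) := by
  have hdim : Module.finrank ℝ (EuclideanSpace ℝ (Fin d)) = d := finrank_euclideanSpace_fin
  have hA : 0 < angularConst d (2 * β) := angularConst_pos hd (by linarith)
  have hk := measurable_kernel (d := d) s (1 / 2) (((d : ℝ) - 2) / 2 + 2 * β)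
  have hφ := (continuous_phi s).measurable
  have hp := measurable_pairPlus (E := EuclideanSpace ℝ (Fin d)) hs
  have hm := measurable_pairMinus (E := EuclideanSpace ℝ (Fin d)) hs
  have hw := measurable_pairWeight (E := EuclideanSpace ℝ (Fin d)) hs
  have hH : Measurable fun η : EuclideanSpace ℝ (Fin d) × EuclideanSpace ℝ (Fin d) =>
      (f η.1 * g η.2) ^ 2 * ENNReal.ofReal (phi s ‖η.1‖ * phi s ‖η.2‖ *
        kernel s (1 / 2) (((d : ℝ) - 2) / 2 + 2 * β) η.1 η.2) := by fun_prop
  have hG : Measurable fun p : (ℝ × EuclideanSpace ℝ (Fin d)) ×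
      Metric.sphere (0 : EuclideanSpace ℝ (Fin d)) 1 => ENNReal.ofReal (cmDensity s p.1 *
      (phi s ‖pairPlus s p.1 p.2‖ * phi s ‖pairMinus s p.1 p.2‖)) *
      ((f (pairPlus s p.1 p.2) * g (pairMinus s p.1 p.2)) ^ 2 * ENNReal.ofReal
        (phi s ‖pairPlus s p.1 p.2‖ * phi s ‖pairMinus s p.1 p.2‖ *
        kernel s (1 / 2) (((d : ℝ) - 2) / 2 + 2 * β) (pairPlus s p.1 p.2)
          (pairMinus s p.1 p.2))) :=
    hw.ennreal_ofReal.mul (hH.comp (hp.prodMk hm))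
  rw [lintegral_pair hs (hdim.symm ▸ hd) hH, ← lintegral_const_mul _ hG.lintegral_prod_right']
  refine lintegral_congr fun q => ?_
  have hu : Measurable fun ω : Metric.sphere (0 : EuclideanSpace ℝ (Fin d)) 1 =>
      (ENNReal.ofReal (pairWeight s q ω) * (f (pairPlus s q ω) * g (pairMinus s q ω))) ^ 2 :=
    (((hw.comp (measurable_prodMk_left (x := q))).ennreal_ofReal.mul
      ((hf.comp (hp.comp (measurable_prodMk_left (x := q)))).mul
      (hg.comp (hm.comp (measurable_prodMk_left (x := q))))))).pow_const 2
  rw [← lintegral_const_mul _ hu, ← lintegral_const_mul _ (hu.const_mul _)]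
  refine Eq.trans (lintegral_const_mul _ (hG.comp (measurable_prodMk_left (x := q)))).symm ?_
  refine lintegral_congr fun ω => ?_
  simp only [Function.comp_apply]
  by_cases h : pairWeight s q ω = 0
  · have h' : cmDensity s q *
      (phi s ‖pairPlus s q ω‖ * phi s ‖pairMinus s q ω‖) = 0 := h
    simp [h, h']
  have hq := lt_of_pairWeight_ne_zero h
  have hK := kernel_pair hs hd β hq ω
  have h1 := phi_pos hs ‖pairPlus s q ω‖
  have h2 := phi_pos hs ‖pairMinus s q ω‖
  have hD := cmDensity_nonneg s q
  have hr := cmRadius_pos hq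
  set K := kernel s (1 / 2) (((d : ℝ) - 2) / 2 + 2 * β) (pairPlus s q ω) (pairMinus s q ω)
  set w := f (pairPlus s q ω) * g (pairMinus s q ω)
  rw [show cmDensity s q * (phi s ‖pairPlus s q ω‖ * phi s ‖pairMinus s q ω‖) =
    pairWeight s q ω from rfl]
  have hP := pairWeight_nonneg hs q ω
  have e : schurConst d β * pairWeight s q ω * (phi s ‖pairPlus s q ω‖ *
      phi s ‖pairMinus s q ω‖ * K) = (2 * cmRadius s q ^ 2) ^ (2 * β) *
      angularConst d (2 * β) * pairWeight s q ω ^ 2 := by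
    rw [schurConst, pairWeight]
    linear_combination (-(cmDensity s q * (phi s ‖pairPlus s q ω‖ * phi s ‖pairMinus s q ω‖) ^ 2 *
      angularConst d (2 * β))) * hK
  have hc : 0 ≤ schurConst d β := by unfold schurConst; positivity
  calc _ = ENNReal.ofReal (schurConst d β * pairWeight s q ω * (phi s ‖pairPlus s q ω‖ *
      phi s ‖pairMinus s q ω‖ * K)) * w ^ 2 := by
        rw [ENNReal.ofReal_mul (p := schurConst d β * _) (by positivity),
          ENNReal.ofReal_mul (p := schurConst d β) hc]
        ring
    _ = _ := by
        rw [e, ENNReal.ofReal_mul (by positivity), ENNReal.ofReal_mul (by positivity),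
          ENNReal.ofReal_pow hP]
        ring

/-- The Schur test for each `q`. The hypothesis on `β` is precisely the convergence condition `0 <
2β + (d-1)/2` of the angular integral. -/
theorem quadIntegral_boxWeight_le (hs : 0 < s) (hd : 2 ≤ d) (hβ : (1 - (d : ℝ)) / 4 < β)
    (hf : Measurable f) (hg : Measurable g) :
    quadIntegral s (boxWeight β) f g ≤ ENNReal.ofReal (schurConst d β) *
      ∫⁻ η : EuclideanSpace ℝ (Fin d) × EuclideanSpace ℝ (Fin d),
      (f η.1 * g η.2) ^ 2 * ENNReal.ofReal (phi s ‖η.1‖ * phi s ‖η.2‖ *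
        kernel s (1 / 2) (((d : ℝ) - 2) / 2 + 2 * β) η.1 η.2) := by
  have hdim : Module.finrank ℝ (EuclideanSpace ℝ (Fin d)) = d := finrank_euclideanSpace_fin
  rw [schurConst_mul_lintegral hs hd hβ hf hg, quadIntegral_boxWeight_eq hs hf hg]
  refine lintegral_mono fun q => ?_
  have hp := (measurable_pairPlus (E := EuclideanSpace ℝ (Fin d)) hs).comp
    (measurable_prodMk_left (x := q))
  have hm := (measurable_pairMinus (E := EuclideanSpace ℝ (Fin d)) hs).comp
    (measurable_prodMk_left (x := q))
  have hw := (measurable_pairWeight (E := EuclideanSpace ℝ (Fin d)) hs).comp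
    (measurable_prodMk_left (x := q))
  gcongr
  refine lintegral_lintegral_mul_le (μ := (volume : Measure (EuclideanSpace ℝ (Fin d))).toSphere)
    (k := fun ω ω' => ENNReal.ofReal ((1 + inner ℝ
    (ω : EuclideanSpace ℝ (Fin d)) (ω' : EuclideanSpace ℝ (Fin d))) ^ (2 * β))) ?_ ?_ ?_ ?_
  · unfold Function.uncurry
    fun_prop
  · intro ω ω'
    rw [real_inner_comm]
  · intro ω
    have := lintegral_sphere_one_add_inner (hdim.symm ▸ hd) ω (b := 2 * β) (by
      rw [hdim]; linarith)
    rwa [hdim] at this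
  · exact hw.ennreal_ofReal.mul ((hf.comp hp).mul (hg.comp hm))

theorem quadIntegral_boxWeight_eq_of_exp (hs : 0 < s) (hd : 2 ≤ d) (hβ : (1 - (d : ℝ)) / 4 < β)
    (a : ℝ) (hfe : ∀ η, f η = ENNReal.ofReal (Real.exp (-a * phi s ‖η‖) / phi s ‖η‖)) :
    quadIntegral s (boxWeight β) f f = ENNReal.ofReal (schurConst d β) *
      ∫⁻ η : EuclideanSpace ℝ (Fin d) × EuclideanSpace ℝ (Fin d),
      (f η.1 * f η.2) ^ 2 * ENNReal.ofReal (phi s ‖η.1‖ * phi s ‖η.2‖ *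
        kernel s (1 / 2) (((d : ℝ) - 2) / 2 + 2 * β) η.1 η.2) := by
  have hdim : Module.finrank ℝ (EuclideanSpace ℝ (Fin d)) = d := finrank_euclideanSpace_fin
  have hf : Measurable f := by
    have := (continuous_phi s).measurable
    rw [funext hfe]
    fun_prop
  rw [schurConst_mul_lintegral hs hd hβ hf hf, quadIntegral_boxWeight_eq hs hf hf]
  refine lintegral_congr fun q => ?_
  have hp := (measurable_pairPlus (E := EuclideanSpace ℝ (Fin d)) hs).comp
    (measurable_prodMk_left (x := q))
  have hm := (measurable_pairMinus (E := EuclideanSpace ℝ (Fin d)) hs).comp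
    (measurable_prodMk_left (x := q))
  have hw := (measurable_pairWeight (E := EuclideanSpace ℝ (Fin d)) hs).comp
    (measurable_prodMk_left (x := q))
  -- The factors `1/φ` cancel the energies in `pairWeight`, and the exponentials multiply to a
  -- function of the total energy; nothing depends on `ω`.
  have hval : ∀ ω, ENNReal.ofReal (pairWeight s q ω) * (f (pairPlus s q ω) *
      f (pairMinus s q ω)) = ENNReal.ofReal (cmDensity s q * Real.exp (-a * q.1)) := by
    intro ω
    have h1 := phi_pos hs ‖pairPlus s q ω‖
    have h2 := phi_pos hs ‖pairMinus s q ω‖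
    rw [hfe, hfe, ← ENNReal.ofReal_mul (by positivity),
      ← ENNReal.ofReal_mul (pairWeight_nonneg hs _ _)]
    congr 1
    by_cases h : √(‖q.2‖ ^ 2 + 4 * s ^ 2) < q.1
    · rw [← phi_pairPlus_add hs h ω, mul_add, Real.exp_add, pairWeight]
      field_simp
    · rw [pairWeight, cmDensity, if_neg h]
      simp
  congr 1
  refine lintegral_lintegral_mul_eq (μ := (volume : Measure (EuclideanSpace ℝ (Fin d))).toSphere)
    (k := fun ω ω' => ENNReal.ofReal ((1 + inner ℝ
    (ω : EuclideanSpace ℝ (Fin d)) (ω' : EuclideanSpace ℝ (Fin d))) ^ (2 * β))) ?_ ?_ ?_ ?_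
  · unfold Function.uncurry
    fun_prop
  · intro ω
    have := lintegral_sphere_one_add_inner (hdim.symm ▸ hd) ω (b := 2 * β) (by
      rw [hdim]; linarith)
    rwa [hdim] at this
  · exact hw.ennreal_ofReal.mul ((hf.comp hp).mul (hf.comp hm))
  · intro ω ω'
    rw [hval, hval]

end Schur

/-! ### Partial Fourier transform of test functions in time -/

section TimeSlices

variable {E : Type*} [NormedAddCommGroup E] [InnerProductSpace ℝ E] [FiniteDimensional ℝ E]
  [MeasurableSpace E] [BorelSpace E]

/-- The derivative of a Schwartz function in the time variable. -/
def timeDeriv (ψ : 𝓢(ℝ × E, ℂ)) : 𝓢(ℝ × E, ℂ) := LineDeriv.lineDerivOp ((1 : ℝ), (0 : E)) ψ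

theorem hasDerivAt_timeSlice (ψ : 𝓢(ℝ × E, ℂ)) (ξ : E) (τ : ℝ) :
    HasDerivAt (fun τ => ψ (τ, ξ)) (timeDeriv ψ (τ, ξ)) τ := by
  have h1 : HasDerivAt (fun τ : ℝ => (τ, ξ)) ((1 : ℝ), (0 : E)) τ :=
    (hasDerivAt_id τ).prodMk (hasDerivAt_const τ ξ)
  have h2 := (ψ.differentiableAt (x := (τ, ξ))).hasFDerivAt.comp_hasDerivAt τ h1
  rwa [← (ψ.differentiableAt (x := (τ, ξ))).lineDeriv_eq_fderiv,
    ← SchwartzMap.lineDerivOp_apply] at h2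

/-- The Fourier transform of a Schwartz function in the time variable. -/
def timeFourier (ψ : 𝓢(ℝ × E, ℂ)) (p : ℝ × E) : ℂ := ∫ τ, wave (-(p.1 * τ)) * ψ (τ, p.2)

theorem timeFourier_eq_fourier (ψ : 𝓢(ℝ × E, ℂ)) (ξ : E) (w : ℝ) :
    timeFourier ψ (w, ξ) = 𝓕 (fun τ => ψ (τ, ξ)) w := by
  rw [Real.fourier_eq]
  refine integral_congr_ae (Filter.Eventually.of_forall fun τ => ?_)
  simp [fourierChar_smul]

instance isAddHaarMeasure_prod : (volume : Measure (ℝ × E)).IsAddHaarMeasure :=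
  Measure.prod.instIsAddHaarMeasure _ _

theorem integrable_schwartz_prod (ψ : 𝓢(ℝ × E, ℂ)) :
    Integrable ψ ((volume : Measure ℝ).prod (volume : Measure E)) :=
  ψ.integrable (μ := volume)

theorem ae_integrable_timeSlice (ψ : 𝓢(ℝ × E, ℂ)) : ∀ᵐ ξ : E, Integrable fun τ => ψ (τ, ξ) :=
  (integrable_schwartz_prod ψ).prod_left_ae

theorem norm_timeFourier_le (ψ : 𝓢(ℝ × E, ℂ)) (p : ℝ × E) :
    ‖timeFourier ψ p‖ ≤ ∫ τ, ‖ψ (τ, p.2)‖ := by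
  refine (norm_integral_le_integral_norm _).trans_eq ?_
  simp

theorem ae_timeFourier_timeDeriv (ψ : 𝓢(ℝ × E, ℂ)) : ∀ᵐ ξ : E, ∀ w : ℝ,
    timeFourier (timeDeriv ψ) (w, ξ) = 2 * Real.pi * Complex.I * w * timeFourier ψ (w, ξ) := by
  filter_upwards [ae_integrable_timeSlice ψ, ae_integrable_timeSlice (timeDeriv ψ)] with ξ h1 h2 w
  have hd : deriv (fun τ => ψ (τ, ξ)) = fun τ => timeDeriv ψ (τ, ξ) :=
    funext fun τ => (hasDerivAt_timeSlice ψ ξ τ).deriv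
  have := Real.fourier_deriv h1 (fun τ => (hasDerivAt_timeSlice ψ ξ τ).differentiableAt)
    (by rwa [hd])
  rw [timeFourier_eq_fourier, timeFourier_eq_fourier, ← hd, this]
  rfl

/-- Two time derivatives multiply the transform by `-(2πw)²`, which gives decay integrable in `w`.
-/
theorem ae_one_add_sq_mul_norm_timeFourier_le (ψ : 𝓢(ℝ × E, ℂ)) : ∀ᵐ ξ : E, ∀ w : ℝ,
    ‖timeFourier ψ (w, ξ)‖ ≤ (1 + w ^ 2)⁻¹ *
      ((∫ τ, ‖ψ (τ, ξ)‖) + ∫ τ, ‖timeDeriv (timeDeriv ψ) (τ, ξ)‖) := by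
  filter_upwards [ae_timeFourier_timeDeriv ψ, ae_timeFourier_timeDeriv (timeDeriv ψ)]
    with ξ h1 h2 w
  have h3 := norm_timeFourier_le ψ (w, ξ)
  have h4 := norm_timeFourier_le (timeDeriv (timeDeriv ψ)) (w, ξ)
  rw [h2, h1, norm_mul (2 * Real.pi * Complex.I * w : ℂ), norm_mul (2 * Real.pi * Complex.I * w : ℂ)] at h4
  have h5 : ‖(2 * Real.pi * Complex.I * w : ℂ)‖ = 2 * Real.pi * |w| := by
    simp [abs_of_pos Real.pi_pos]
  rw [h5] at h4
  have h6 : w ^ 2 * ‖timeFourier ψ (w, ξ)‖ ≤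
      2 * Real.pi * |w| * (2 * Real.pi * |w| * ‖timeFourier ψ (w, ξ)‖) := by
    rw [← mul_assoc, show 2 * Real.pi * |w| * (2 * Real.pi * |w|) = 4 * Real.pi ^ 2 * |w| ^ 2 by ring,
      sq_abs]
    gcongr
    nlinarith [Real.pi_gt_three, sq_nonneg w, Real.pi_pos, mul_nonneg (sq_nonneg w) Real.pi_pos.le]
  rw [inv_mul_eq_div, le_div_iff₀ (by positivity)]
  linarith

theorem stronglyMeasurable_timeFourier (ψ : 𝓢(ℝ × E, ℂ)) :
    StronglyMeasurable (timeFourier ψ) := by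
  have h : Continuous (Function.uncurry fun (p : ℝ × E) (τ : ℝ) =>
      wave (-(p.1 * τ)) * ψ (τ, p.2)) := by
    have := ψ.continuous
    unfold Function.uncurry
    fun_prop
  exact StronglyMeasurable.integral_prod_right h.stronglyMeasurable

theorem integrable_timeFourier (ψ : 𝓢(ℝ × E, ℂ)) :
    Integrable (timeFourier ψ) ((volume : Measure ℝ).prod (volume : Measure E)) := by
  have h1 := (integrable_schwartz_prod ψ).norm.integral_prod_right
  have h2 := (integrable_schwartz_prod (timeDeriv (timeDeriv ψ))).norm.integral_prod_right
  have h3 := (integrable_inv_one_add_sq).mul_prod (h1.add h2)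
  refine h3.mono' (stronglyMeasurable_timeFourier ψ).aestronglyMeasurable ?_
  filter_upwards [Measure.quasiMeasurePreserving_snd.ae (ae_one_add_sq_mul_norm_timeFourier_le ψ)]
    with p hp
  exact hp p.1

/-- Fourier inversion in time, valid at every `c` because the slices are continuous. It will
evaluate the test function at the energy transfer. -/
theorem ae_integral_wave_mul_timeFourier (ψ : 𝓢(ℝ × E, ℂ)) : ∀ᵐ ξ : E, ∀ c : ℝ,
    ∫ w, wave (w * c) * timeFourier ψ (w, ξ) = ψ (c, ξ) := by
  filter_upwards [ae_integrable_timeSlice ψ, (integrable_timeFourier ψ).prod_left_ae]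
    with ξ h1 h2 c
  have h3 : (fun w => timeFourier ψ (w, ξ)) = 𝓕 (fun τ => ψ (τ, ξ)) :=
    funext fun w => timeFourier_eq_fourier ψ ξ w
  rw [h3] at h2
  have h4 := h1.fourierInv_fourier_eq h2 (v := c)
    (hasDerivAt_timeSlice ψ ξ c).continuousAt
  rw [← h4, Real.fourierInv_eq, ← h3]
  refine integral_congr_ae (Filter.Eventually.of_forall fun w => ?_)
  simp [fourierChar_smul, mul_comm]

end TimeSlices

/-! ### An integrability criterion on products -/

section Fubini

theorem integrable_mul_of_integral_norm_le {α β : Type*} [MeasurableSpace α] [MeasurableSpace β]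
    {μ : Measure α} {ν : Measure β} [SFinite μ] [SFinite ν] {k : α → ℂ} (hk : Integrable k μ)
    {A : α × β → ℂ} (hA : StronglyMeasurable A) (hi : ∀ a, Integrable (fun b => A (a, b)) ν)
    {C : ℝ} (hC : ∀ a, ∫ b, ‖A (a, b)‖ ∂ν ≤ C) :
    Integrable (fun p : α × β => k p.1 * A p) (μ.prod ν) := by
  have hm : AEStronglyMeasurable (fun p : α × β => k p.1 * A p) (μ.prod ν) :=
    hk.aestronglyMeasurable.comp_fst.mul hA.aestronglyMeasurable
  refine (integrable_prod_iff hm).2 ⟨Filter.Eventually.of_forall fun a => (hi a).const_mul (k a), ?_⟩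
  refine (hk.norm.mul_const C).mono' hm.norm.integral_prod_right' ?_
  refine Filter.Eventually.of_forall fun a => ?_
  simp only [norm_mul]
  rw [integral_const_mul, norm_mul, norm_norm, Real.norm_of_nonneg
    (integral_nonneg fun b => norm_nonneg _)]
  exact mul_le_mul_of_nonneg_left (hC a) (norm_nonneg _)

end Fubini

/-! ### Space-time Fourier transform of the product of two waves -/

section Bilinear

variable {d : ℕ}

theorem stronglyMeasurable_hat (f : Lp ℂ 2 (volume : Measure (EuclideanSpace ℝ (Fin d)))) :
    StronglyMeasurable (hat f) :=
  (Lp.stronglyMeasurable _).comp_measurable (measurable_const_smul _)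

theorem integrable_norm_hat_sq (f : Lp ℂ 2 (volume : Measure (EuclideanSpace ℝ (Fin d)))) :
    Integrable fun ξ => ‖hat f ξ‖ ^ 2 := by
  have h : Integrable fun ξ => ‖(𝓕 f : Lp ℂ 2 (volume : Measure (EuclideanSpace ℝ (Fin d)))) ξ‖ ^ 2 :=
    (memLp_two_iff_integrable_sq_norm (Lp.stronglyMeasurable _).aestronglyMeasurable).1 (Lp.memLp _)
  exact (integrable_comp_smul_iff volume _ (by have := Real.pi_pos; positivity)).2 h

/-- The product `f̂(ξ + η) · conj ĝ(η)`. -/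
def crossSpectrum (f g : Lp ℂ 2 (volume : Measure (EuclideanSpace ℝ (Fin d))))
    (p : EuclideanSpace ℝ (Fin d) × EuclideanSpace ℝ (Fin d)) : ℂ :=
  hat f (p.1 + p.2) * conj (hat g p.2)

/-- The energy transfer `φ_s(|ξ + η|) - φ_s(|η|)`. -/
def energyGap (s : ℝ) (p : EuclideanSpace ℝ (Fin d) × EuclideanSpace ℝ (Fin d)) : ℝ :=
  phi s ‖p.1 + p.2‖ - phi s ‖p.2‖

theorem continuous_energyGap (s : ℝ) : Continuous (energyGap (d := d) s) := by
  have := continuous_phi s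
  unfold energyGap
  fun_prop

variable (f g : Lp ℂ 2 (volume : Measure (EuclideanSpace ℝ (Fin d))))

theorem stronglyMeasurable_crossSpectrum : StronglyMeasurable (crossSpectrum f g) :=
  ((stronglyMeasurable_hat f).comp_measurable (by fun_prop)).mul
    (RCLike.continuous_conj.comp_stronglyMeasurable
      ((stronglyMeasurable_hat g).comp_measurable measurable_snd))

theorem norm_crossSpectrum_le (ξ η : EuclideanSpace ℝ (Fin d)) :
    ‖crossSpectrum f g (ξ, η)‖ ≤ 2⁻¹ * (‖hat f (ξ + η)‖ ^ 2 + ‖hat g η‖ ^ 2) := by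
  rw [crossSpectrum, norm_mul, RCLike.norm_conj]
  linarith [two_mul_le_add_sq ‖hat f (ξ + η)‖ ‖hat g η‖]

theorem integrable_norm_sq_add (ξ : EuclideanSpace ℝ (Fin d)) :
    Integrable fun η => 2⁻¹ * (‖hat f (ξ + η)‖ ^ 2 + ‖hat g η‖ ^ 2) :=
  (((integrable_norm_hat_sq f).comp_add_left ξ).add (integrable_norm_hat_sq g)).const_mul _

theorem integrable_crossSpectrum (ξ : EuclideanSpace ℝ (Fin d)) :
    Integrable fun η => crossSpectrum f g (ξ, η) :=
  (integrable_norm_sq_add f g ξ).mono'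
    ((stronglyMeasurable_crossSpectrum f g).comp_measurable
      measurable_prodMk_left).aestronglyMeasurable
    (Filter.Eventually.of_forall (norm_crossSpectrum_le f g ξ))

/-- Uniformity in `ξ` is the point: the cross spectrum need not be integrable in `(ξ, η)` jointly,
so all later uses of Fubini combine this bound with an integrable factor in `ξ`. -/
theorem integral_norm_crossSpectrum_le (ξ : EuclideanSpace ℝ (Fin d)) :
    ∫ η, ‖crossSpectrum f g (ξ, η)‖ ≤
      2⁻¹ * ((∫ η, ‖hat f η‖ ^ 2) + ∫ η, ‖hat g η‖ ^ 2) := by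
  refine (integral_mono (integrable_crossSpectrum f g ξ).norm (integrable_norm_sq_add f g ξ)
    (norm_crossSpectrum_le f g ξ)).trans_eq ?_
  rw [integral_const_mul, integral_add ((integrable_norm_hat_sq f).comp_add_left ξ)
    (integrable_norm_hat_sq g), integral_add_left_eq_self (fun η => ‖hat f η‖ ^ 2)]

theorem exp_eq_wave (t : ℝ) : Complex.exp ((t : ℂ) * Complex.I) = wave ((2 * Real.pi)⁻¹ * t) := by
  have := Real.pi_pos
  rw [wave, ← mul_assoc, mul_inv_cancel₀ (by positivity), one_mul]

theorem fourier_propagator (s w : ℝ) :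
    (𝓕 (propagator s (2 * Real.pi * w) f) : Lp ℂ 2 (volume : Measure (EuclideanSpace ℝ (Fin d))))
      =ᵐ[volume] fun κ => wave (w * phi s (2 * Real.pi * ‖κ‖)) *
        (𝓕 f : Lp ℂ 2 (volume : Measure (EuclideanSpace ℝ (Fin d)))) κ := by
  rw [propagator, fourier_fourierInv_eq]
  filter_upwards [(memLp_mul_phase s (2 * Real.pi * w) (𝓕 f)).coeFn_toLp] with κ hκ
  have := Real.pi_pos
  rw [hκ, exp_eq_wave]
  congr 2
  field_simp

theorem integrable_bilinear (s t : ℝ) : Integrable (bilinear s f g t) := by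
  have h : MemLp (fun x => conj (propagator s t g x)) 2 := (Lp.memLp (propagator s t g)).star
  exact (Lp.memLp (propagator s t f)).integrable_mul h

/-- Parseval at a fixed time, written `2πw` so that all phases become `wave`; the two propagators
contribute the phase of the energy difference, and `(2π)^{-d}` is the Jacobian of the dilation
relating `hat` to `𝓕`. -/
theorem integral_wave_mul_bilinear (s w : ℝ) (ξ : EuclideanSpace ℝ (Fin d)) :
    ∫ x, wave (-inner ℝ x ((2 * Real.pi)⁻¹ • ξ)) * bilinear s f g (2 * Real.pi * w) x =
      (((2 * Real.pi) ^ d)⁻¹ : ℝ) * ∫ η, wave (w * energyGap s (ξ, η)) * crossSpectrum f g (ξ, η) := by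
  have hpi := Real.pi_pos
  have h1 := fourier_propagator f s w
  have h2 := fourier_propagator g s w
  have h3 := (measurePreserving_add_right (volume : Measure (EuclideanSpace ℝ (Fin d)))
    ((2 * Real.pi)⁻¹ • ξ)).quasiMeasurePreserving.ae h1
  rw [show (fun x => wave (-inner ℝ x ((2 * Real.pi)⁻¹ • ξ)) * bilinear s f g (2 * Real.pi * w) x) =
    fun x => wave (-inner ℝ x ((2 * Real.pi)⁻¹ • ξ)) * (propagator s (2 * Real.pi * w) f x *
      conj (propagator s (2 * Real.pi * w) g x)) from rfl, integral_mul_conj_fourierChar]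
  obtain ⟨k, hk⟩ : ∃ k : EuclideanSpace ℝ (Fin d) → ℂ, k = fun κ => wave (w * (phi s
      (2 * Real.pi * ‖κ + (2 * Real.pi)⁻¹ • ξ‖) - phi s (2 * Real.pi * ‖κ‖))) *
      ((𝓕 f : Lp ℂ 2 (volume : Measure (EuclideanSpace ℝ (Fin d)))) (κ + (2 * Real.pi)⁻¹ • ξ) *
        conj ((𝓕 g : Lp ℂ 2 (volume : Measure (EuclideanSpace ℝ (Fin d)))) κ)) := ⟨_, rfl⟩
  have h4 : ∀ η : EuclideanSpace ℝ (Fin d), wave (w * energyGap s (ξ, η)) *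
      crossSpectrum f g (ξ, η) = k ((2 * Real.pi)⁻¹ • η) := by
    intro η
    have h5 : ∀ ζ : EuclideanSpace ℝ (Fin d), 2 * Real.pi * ‖(2 * Real.pi)⁻¹ • ζ‖ = ‖ζ‖ := by
      intro ζ
      rw [norm_smul, Real.norm_of_nonneg (by positivity)]
      field_simp
    rw [hk]
    dsimp only
    rw [← smul_add, h5, h5, add_comm η ξ]
    rfl
  rw [integral_congr_ae (Filter.Eventually.of_forall h4),
    Measure.integral_comp_smul volume k ((2 * Real.pi)⁻¹), finrank_euclideanSpace_fin,
    Complex.real_smul, ← mul_assoc, ← Complex.ofReal_mul]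
  have h6 : ((2 * Real.pi) ^ d)⁻¹ * |(((2 * Real.pi)⁻¹) ^ d)⁻¹| = 1 := by
    rw [inv_pow, inv_inv, abs_of_nonneg (by positivity), inv_mul_cancel₀ (by positivity)]
  rw [h6, Complex.ofReal_one, one_mul]
  refine integral_congr_ae ?_
  filter_upwards [h2, h3] with κ hκ hκ'
  rw [hκ, hκ', hk, map_mul, conj_wave]
  dsimp only
  rw [mul_sub, sub_eq_add_neg, wave_add]
  ring

theorem testFourier_eq (ψ : 𝓢(ℝ × EuclideanSpace ℝ (Fin d), ℂ)) (w : ℝ)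
    (x : EuclideanSpace ℝ (Fin d)) :
    testFourier ψ (2 * Real.pi * w) x = ∫ p : ℝ × EuclideanSpace ℝ (Fin d),
      wave (-(w * p.1)) * wave (-inner ℝ x ((2 * Real.pi)⁻¹ • p.2)) * ψ p := by
  have hpi := Real.pi_pos
  refine integral_congr_ae (Filter.Eventually.of_forall fun p => ?_)
  dsimp only
  rw [← neg_mul, ← Complex.ofReal_neg, exp_eq_wave, ← wave_add, real_inner_smul_right]
  congr 2
  field_simp
  ring

theorem integrable_bilinear_mul_testFourier (s : ℝ) (ψ : 𝓢(ℝ × EuclideanSpace ℝ (Fin d), ℂ))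
    (t : ℝ) : Integrable fun x => bilinear s f g t x * testFourier ψ t x := by
  have hψ := integrable_schwartz_prod ψ
  refine (integrable_bilinear f g s t).mul_bdd (c := ∫ p, ‖ψ p‖) ?_ ?_
  · have h : Continuous (Function.uncurry fun (x : EuclideanSpace ℝ (Fin d))
        (p : ℝ × EuclideanSpace ℝ (Fin d)) =>
        Complex.exp (-(((t * p.1 + inner ℝ x p.2 : ℝ) : ℂ) * Complex.I)) * ψ p) := by
      have := ψ.continuous
      unfold Function.uncurry
      fun_prop
    exact (StronglyMeasurable.integral_prod_right h.stronglyMeasurable).aestronglyMeasurable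
  · refine Filter.Eventually.of_forall fun x => (norm_integral_le_integral_norm _).trans_eq ?_
    refine integral_congr_ae (Filter.Eventually.of_forall fun p => ?_)
    dsimp only
    rw [norm_mul, ← neg_mul, ← Complex.ofReal_neg, Complex.norm_exp_ofReal_mul_I, one_mul]

theorem integrable_wave_mul_crossSpectrum (s w : ℝ) (ξ : EuclideanSpace ℝ (Fin d)) :
    Integrable fun η => wave (w * energyGap s (ξ, η)) * crossSpectrum f g (ξ, η) := by
  have := continuous_energyGap (d := d) s
  refine (integrable_crossSpectrum f g ξ).bdd_mul (c := 1) ?_ ?_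
  · exact Continuous.aestronglyMeasurable (by fun_prop)
  · exact Filter.Eventually.of_forall fun η => by simp

theorem stronglyMeasurable_wave_mul_crossSpectrum (s : ℝ) :
    StronglyMeasurable fun p : (ℝ × EuclideanSpace ℝ (Fin d)) × EuclideanSpace ℝ (Fin d) =>
      wave (p.1.1 * energyGap s (p.1.2, p.2)) * crossSpectrum f g (p.1.2, p.2) := by
  have := continuous_energyGap (d := d) s
  refine StronglyMeasurable.mul ?_ ?_
  · exact Continuous.stronglyMeasurable (by fun_prop)
  · exact (stronglyMeasurable_crossSpectrum f g).comp_measurable (by fun_prop)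

theorem integrable_timeFourier_mul (s : ℝ) (ψ : 𝓢(ℝ × EuclideanSpace ℝ (Fin d), ℂ)) :
    Integrable (fun p : (ℝ × EuclideanSpace ℝ (Fin d)) × EuclideanSpace ℝ (Fin d) =>
      timeFourier ψ p.1 * (wave (p.1.1 * energyGap s (p.1.2, p.2)) *
        crossSpectrum f g (p.1.2, p.2))) := by
  refine integrable_mul_of_integral_norm_le (integrable_timeFourier ψ)
    (stronglyMeasurable_wave_mul_crossSpectrum f g s)
    (fun a => integrable_wave_mul_crossSpectrum f g s a.1 a.2)
    (C := 2⁻¹ * ((∫ η, ‖hat f η‖ ^ 2) + ∫ η, ‖hat g η‖ ^ 2)) fun a => ?_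
  simp only [norm_mul, norm_wave, one_mul]
  exact integral_norm_crossSpectrum_le f g a.2

/-- Fubini carries the spatial transform from the test function to the product of waves, leaving
only the transform of `ψ` in time. -/
theorem integral_bilinear_mul_testFourier (s : ℝ) (ψ : 𝓢(ℝ × EuclideanSpace ℝ (Fin d), ℂ))
    (w : ℝ) :
    ∫ x, bilinear s f g (2 * Real.pi * w) x * testFourier ψ (2 * Real.pi * w) x =
      (((2 * Real.pi) ^ d)⁻¹ : ℝ) * ∫ ξ, ∫ η, timeFourier ψ (w, ξ) *
        (wave (w * energyGap s (ξ, η)) * crossSpectrum f g (ξ, η)) := by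
  have hψ := integrable_schwartz_prod ψ
  have hψc := ψ.continuous
  have hF := integrable_bilinear f g s (2 * Real.pi * w)
  set F := bilinear s f g (2 * Real.pi * w) with hF_def
  set B : EuclideanSpace ℝ (Fin d) → ℂ := fun ξ =>
    ∫ η, wave (w * energyGap s (ξ, η)) * crossSpectrum f g (ξ, η) with hB_def
  have hI : Integrable (Function.uncurry fun (x : EuclideanSpace ℝ (Fin d))
      (p : ℝ × EuclideanSpace ℝ (Fin d)) =>
      (wave (-(w * p.1)) * wave (-inner ℝ x ((2 * Real.pi)⁻¹ • p.2))) * (F x * ψ p))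
      (volume.prod volume) := by
    refine (hF.mul_prod hψ).bdd_mul (c := 1) ?_ ?_
    · exact Continuous.aestronglyMeasurable (by fun_prop)
    · exact Filter.Eventually.of_forall fun η => by simp
  have hB : StronglyMeasurable B := by
    have := (stronglyMeasurable_wave_mul_crossSpectrum f g s).comp_measurable
      (g := fun p : EuclideanSpace ℝ (Fin d) × EuclideanSpace ℝ (Fin d) => ((w, p.1), p.2))
      (by fun_prop)
    exact this.integral_prod_right'
  have hBle : ∀ ξ, ‖B ξ‖ ≤ 2⁻¹ * ((∫ η, ‖hat f η‖ ^ 2) + ∫ η, ‖hat g η‖ ^ 2) := fun ξ => by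
    refine (norm_integral_le_integral_norm _).trans ?_
    simp only [norm_mul, norm_wave, one_mul]
    exact integral_norm_crossSpectrum_le f g ξ
  have hI2 : Integrable (fun p : ℝ × EuclideanSpace ℝ (Fin d) =>
      (wave (-(w * p.1)) * ψ p) * B p.2)
      ((volume : Measure ℝ).prod (volume : Measure (EuclideanSpace ℝ (Fin d)))) := by
    refine Integrable.mul_bdd (c := 2⁻¹ * ((∫ η, ‖hat f η‖ ^ 2) + ∫ η, ‖hat g η‖ ^ 2)) ?_ ?_ ?_
    · refine hψ.bdd_mul (c := 1) ?_ ?_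
      · exact Continuous.aestronglyMeasurable (by fun_prop)
      · exact Filter.Eventually.of_forall fun η => by simp
    · exact (hB.comp_measurable measurable_snd).aestronglyMeasurable
    · exact Filter.Eventually.of_forall fun p => hBle p.2
  calc _ = ∫ x, ∫ p : ℝ × EuclideanSpace ℝ (Fin d),
        (wave (-(w * p.1)) * wave (-inner ℝ x ((2 * Real.pi)⁻¹ • p.2))) * (F x * ψ p) := by
        refine integral_congr_ae (Filter.Eventually.of_forall fun x => ?_)
        dsimp only
        rw [testFourier_eq, ← integral_const_mul]
        refine integral_congr_ae (Filter.Eventually.of_forall fun p => ?_)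
        dsimp only
        ring
    _ = ∫ p : ℝ × EuclideanSpace ℝ (Fin d), ∫ x,
        (wave (-(w * p.1)) * wave (-inner ℝ x ((2 * Real.pi)⁻¹ • p.2))) * (F x * ψ p) :=
        integral_integral_swap hI
    _ = ∫ p : ℝ × EuclideanSpace ℝ (Fin d), (((2 * Real.pi) ^ d)⁻¹ : ℝ) *
          ((wave (-(w * p.1)) * ψ p) * B p.2) := by
        refine integral_congr_ae (Filter.Eventually.of_forall fun p => ?_)
        dsimp only
        rw [hB_def]
        dsimp only
        rw [mul_left_comm, ← integral_wave_mul_bilinear, ← integral_const_mul]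
        refine integral_congr_ae (Filter.Eventually.of_forall fun x => ?_)
        dsimp only
        rw [← hF_def]
        ring
    _ = _ := by
        rw [integral_const_mul, Measure.volume_eq_prod, integral_prod_symm _ hI2]
        congr 1
        refine integral_congr_ae (Filter.Eventually.of_forall fun ξ => ?_)
        dsimp only
        rw [integral_mul_const, integral_const_mul]
        rfl

/-- The space-time Fourier transform of a product of two waves. -/
theorem isSpaceTimeFourier_bilinear (s : ℝ) {m : ℝ × EuclideanSpace ℝ (Fin d) → ℂ}
    (hm : ∀ ψ : 𝓢(ℝ × EuclideanSpace ℝ (Fin d), ℂ), (Integrable fun p => m p * ψ p) ∧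
      ∫ p, m p * ψ p = ∫ η : EuclideanSpace ℝ (Fin d) × EuclideanSpace ℝ (Fin d),
        hat f η.1 * conj (hat g η.2) * ψ (phi s ‖η.1‖ - phi s ‖η.2‖, η.1 - η.2)) :
    IsSpaceTimeFourier (bilinear s f g)
      fun p => ((2 * Real.pi * ((2 * Real.pi) ^ d)⁻¹ : ℝ) : ℂ) * m p := by
  intro ψ
  have hpi := Real.pi_pos
  have hI := integrable_timeFourier_mul f g s ψ
  set J : ℝ → ℂ := fun t => ∫ x, bilinear s f g t x * testFourier ψ t x with hJ
  have hJw : (fun w => J (2 * Real.pi * w)) = fun w => (((2 * Real.pi) ^ d)⁻¹ : ℝ) *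
      ∫ ξ, ∫ η, timeFourier ψ (w, ξ) *
        (wave (w * energyGap s (ξ, η)) * crossSpectrum f g (ξ, η)) :=
    funext fun w => integral_bilinear_mul_testFourier f g s ψ w
  have hI' : Integrable (fun p : (ℝ × EuclideanSpace ℝ (Fin d)) => ∫ η, timeFourier ψ p *
      (wave (p.1 * energyGap s (p.2, η)) * crossSpectrum f g (p.2, η)))
      ((volume : Measure ℝ).prod (volume : Measure (EuclideanSpace ℝ (Fin d)))) :=
    hI.integral_prod_left
  have hJi : Integrable fun w => J (2 * Real.pi * w) := by
    rw [hJw]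
    exact hI'.integral_prod_left.const_mul _
  refine ⟨Filter.Eventually.of_forall (integrable_bilinear_mul_testFourier f g s ψ), ?_, ?_, ?_⟩
  · exact (integrable_comp_smul_iff volume J (R := 2 * Real.pi) (by positivity)).1 hJi
  · simpa only [mul_assoc] using (hm ψ).1.const_mul _
  · have h1 : ∫ t, J t = (2 * Real.pi : ℝ) * ∫ w, J (2 * Real.pi * w) := by
      have := Measure.integral_comp_smul (volume : Measure ℝ) J (2 * Real.pi)
      simp only [smul_eq_mul] at this
      rw [this, Module.finrank_self, pow_one, abs_of_pos (by positivity), Complex.real_smul,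
        ← mul_assoc, ← Complex.ofReal_mul, mul_inv_cancel₀ (by positivity), Complex.ofReal_one,
        one_mul]
    have hA : MeasurePreserving (MeasurableEquiv.prodAssoc (α := ℝ)
      (β := EuclideanSpace ℝ (Fin d)) (γ := EuclideanSpace ℝ (Fin d))).symm volume volume :=
      volume_preserving_prodAssoc.symm _
    have hI3 : Integrable (fun p : ℝ × (EuclideanSpace ℝ (Fin d) × EuclideanSpace ℝ (Fin d)) =>
        timeFourier ψ (p.1, p.2.1) * (wave (p.1 * energyGap s p.2) * crossSpectrum f g p.2))
        (volume.prod volume) := hA.integrable_comp_of_integrable hI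
    -- Integrating in `w` first, Fourier inversion replaces the time variable of `ψ` by the energy
    -- gap.
    have h2 : ∫ w, ∫ ξ, ∫ η, timeFourier ψ (w, ξ) *
        (wave (w * energyGap s (ξ, η)) * crossSpectrum f g (ξ, η)) =
        ∫ p : EuclideanSpace ℝ (Fin d) × EuclideanSpace ℝ (Fin d),
          crossSpectrum f g p * ψ (energyGap s p, p.1) := by
      calc _ = ∫ p : (ℝ × EuclideanSpace ℝ (Fin d)) × EuclideanSpace ℝ (Fin d),
            timeFourier ψ p.1 * (wave (p.1.1 * energyGap s (p.1.2, p.2)) *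
              crossSpectrum f g (p.1.2, p.2)) := by
            rw [Measure.volume_eq_prod, integral_prod _ hI, Measure.volume_eq_prod,
              integral_prod _ hI']
        _ = ∫ p : ℝ × (EuclideanSpace ℝ (Fin d) × EuclideanSpace ℝ (Fin d)),
            timeFourier ψ (p.1, p.2.1) * (wave (p.1 * energyGap s p.2) * crossSpectrum f g p.2) :=
            (hA.integral_comp (MeasurableEquiv.measurableEmbedding _) _).symm
        _ = ∫ p : EuclideanSpace ℝ (Fin d) × EuclideanSpace ℝ (Fin d), ∫ w,
            timeFourier ψ (w, p.1) * (wave (w * energyGap s p) * crossSpectrum f g p) := by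
            rw [Measure.volume_eq_prod, integral_prod_symm _ hI3]
        _ = _ := by
            refine integral_congr_ae ?_
            filter_upwards [Measure.quasiMeasurePreserving_fst.ae
              (ae_integral_wave_mul_timeFourier ψ)] with p hp
            rw [← hp, ← integral_const_mul]
            refine integral_congr_ae (Filter.Eventually.of_forall fun w => ?_)
            dsimp only
            ring
    -- The shear `(ξ, η) ↦ (ξ + η, η)` returns to the two individual momenta.
    have hB := measurePreserving_add_prod (volume : Measure (EuclideanSpace ℝ (Fin d)))
      (volume : Measure (EuclideanSpace ℝ (Fin d)))
    have hemb : MeasurableEmbedding fun z : EuclideanSpace ℝ (Fin d) × EuclideanSpace ℝ (Fin d) =>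
        (z.1 + z.2, z.2) := by
      let e : (EuclideanSpace ℝ (Fin d) × EuclideanSpace ℝ (Fin d)) ≃ᵐ
          (EuclideanSpace ℝ (Fin d) × EuclideanSpace ℝ (Fin d)) :=
        { toFun := fun z => (z.1 + z.2, z.2)
          invFun := fun z => (z.1 - z.2, z.2)
          left_inv := fun z => by simp
          right_inv := fun z => by simp
          measurable_toFun := by dsimp; fun_prop
          measurable_invFun := by dsimp; fun_prop }
      exact e.measurableEmbedding
    have h3 := hB.integral_comp hemb (fun η => hat f η.1 * conj (hat g η.2) *
      ψ (phi s ‖η.1‖ - phi s ‖η.2‖, η.1 - η.2))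
    simp only [add_sub_cancel_right] at h3
    change ∫ t, J t = _
    rw [show (fun p => ((2 * Real.pi * ((2 * Real.pi) ^ d)⁻¹ : ℝ) : ℂ) * m p * ψ p) =
      fun p => ((2 * Real.pi * ((2 * Real.pi) ^ d)⁻¹ : ℝ) : ℂ) * (m p * ψ p) from
      funext fun p => mul_assoc _ _ _, integral_const_mul, (hm ψ).2, h1, hJw, integral_const_mul, h2, ← mul_assoc,
      ← Complex.ofReal_mul, Measure.volume_eq_prod, ← h3]
    rfl

end Bilinear

/-! ### Plancherel in space-time with the normalisation of `IsSpaceTimeFourier` -/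

section Plancherel

theorem eLpNorm_two_sq {α : Type*} [MeasurableSpace α] {μ : Measure α} (f : α → ℂ) :
    eLpNorm f 2 μ ^ 2 = ∫⁻ x, ‖f x‖ₑ ^ 2 ∂μ := by
  have := eLpNorm_nnreal_pow_eq_lintegral (f := f) (μ := μ) (p := 2) two_ne_zero
  simpa using this

theorem lintegral_comp_const_smul {V : Type*} [NormedAddCommGroup V] [NormedSpace ℝ V]
    [FiniteDimensional ℝ V] [MeasurableSpace V] [BorelSpace V] (μ : Measure V) [μ.IsAddHaarMeasure]
    {r : ℝ} (hr : 0 < r) {g : V → ℝ≥0∞} :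
    ∫⁻ x, g (r⁻¹ • x) ∂μ = ENNReal.ofReal (r ^ Module.finrank ℝ V) * ∫⁻ x, g x ∂μ := by
  have h := Measure.map_addHaar_smul μ (inv_ne_zero hr.ne')
  have he : MeasurableEmbedding fun x : V => r⁻¹ • x :=
    (Homeomorph.smulOfNeZero r⁻¹ (inv_ne_zero hr.ne')).measurableEmbedding
  rw [← he.lintegral_map, h, lintegral_smul_measure, smul_eq_mul]
  congr 2
  rw [inv_pow, inv_inv, abs_of_pos (by positivity)]

variable {d : ℕ}

theorem finrank_spaceTime :
    Module.finrank ℝ (WithLp 2 (ℝ × EuclideanSpace ℝ (Fin d))) = d + 1 := by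
  rw [LinearEquiv.finrank_eq (WithLp.linearEquiv 2 ℝ _), Module.finrank_prod]
  simp [add_comm]

theorem IsSpaceTimeFourier.congr_left {F F' : ℝ → EuclideanSpace ℝ (Fin d) → ℂ}
    {m : ℝ × EuclideanSpace ℝ (Fin d) → ℂ} (h : IsSpaceTimeFourier F m)
    (hF : ∀ᵐ p : ℝ × EuclideanSpace ℝ (Fin d), F p.1 p.2 = F' p.1 p.2) :
    IsSpaceTimeFourier F' m := by
  intro ψ
  obtain ⟨h1, h2, h3, h4⟩ := h ψ
  have hF' : ∀ᵐ t : ℝ, ∀ᵐ x : EuclideanSpace ℝ (Fin d), F t x = F' t x :=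
    Measure.ae_ae_of_ae_prod hF
  have h5 : ∀ᵐ t : ℝ, ∫ x, F t x * testFourier ψ t x = ∫ x, F' t x * testFourier ψ t x := by
    filter_upwards [hF'] with t ht
    refine integral_congr_ae ?_
    filter_upwards [ht] with x hx
    rw [hx]
  refine ⟨?_, h2.congr h5, h3, by rw [← h4, integral_congr_ae h5]⟩
  filter_upwards [h1, hF'] with t ht ht'
  refine ht.congr ?_
  filter_upwards [ht'] with x hx
  rw [hx]

theorem IsSpaceTimeFourier.congr_right {F : ℝ → EuclideanSpace ℝ (Fin d) → ℂ}
    {m m' : ℝ × EuclideanSpace ℝ (Fin d) → ℂ} (h : IsSpaceTimeFourier F m) (hm : m =ᵐ[volume] m') :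
    IsSpaceTimeFourier F m' := by
  intro ψ
  obtain ⟨h1, h2, h3, h4⟩ := h ψ
  have h5 : (fun p => m p * ψ p) =ᵐ[volume] fun p => m' p * ψ p := by
    filter_upwards [hm] with p hp
    rw [hp]
  exact ⟨h1, h2, h3.congr h5, h4.trans (integral_congr_ae h5)⟩

/-- Uniqueness of the transform, needed for the lower bound: it controls every competitor in the
infimum defining `boxNormSq`. -/
theorem IsSpaceTimeFourier.ae_eq {F : ℝ → EuclideanSpace ℝ (Fin d) → ℂ}
    {m m' : ℝ × EuclideanSpace ℝ (Fin d) → ℂ} (h : IsSpaceTimeFourier F m)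
    (h' : IsSpaceTimeFourier F m') : m =ᵐ[volume] m' :=
  ae_eq_of_integral_schwartz (locallyIntegrable_of_schwartz fun ψ => (h ψ).2.2.1)
    (locallyIntegrable_of_schwartz fun ψ => (h' ψ).2.2.1)
    fun ψ => (h ψ).2.2.2.symm.trans (h' ψ).2.2.2

/-- Dilation by `2π` from the Euclidean to the product model of space-time. -/
def spaceTimeDilation (d : ℕ) :
    WithLp 2 (ℝ × EuclideanSpace ℝ (Fin d)) ≃L[ℝ] ℝ × EuclideanSpace ℝ (Fin d) :=
  (ContinuousLinearEquiv.smulLeft (Units.mk0 (2 * Real.pi) (by have := Real.pi_pos; positivity) :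
    ℝˣ)).trans (WithLp.prodContinuousLinearEquiv 2 ℝ ℝ (EuclideanSpace ℝ (Fin d)))

theorem spaceTimeDilation_apply (v : WithLp 2 (ℝ × EuclideanSpace ℝ (Fin d))) :
    spaceTimeDilation d v = WithLp.ofLp ((2 * Real.pi) • v) := rfl

theorem testFourier_eq_fourier (ψ : 𝓢(ℝ × EuclideanSpace ℝ (Fin d), ℂ)) (t : ℝ)
    (x : EuclideanSpace ℝ (Fin d)) :
    testFourier ψ t x = ((2 * Real.pi) ^ (d + 1) : ℝ) *
      (𝓕 (SchwartzMap.compCLMOfContinuousLinearEquiv ℂ (spaceTimeDilation d) ψ) :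
        𝓢(WithLp 2 (ℝ × EuclideanSpace ℝ (Fin d)), ℂ)) (WithLp.toLp 2 (t, x)) := by
  have hpi := Real.pi_pos
  obtain ⟨k, hk⟩ : ∃ k : WithLp 2 (ℝ × EuclideanSpace ℝ (Fin d)) → ℂ, k = fun v =>
    Complex.exp (-(((t * v.fst + inner ℝ x v.snd : ℝ) : ℂ) * Complex.I)) * ψ (WithLp.ofLp v) :=
    ⟨_, rfl⟩
  have h1 : ∀ v, Real.fourierChar (-inner ℝ v (WithLp.toLp 2 (t, x))) •
      (SchwartzMap.compCLMOfContinuousLinearEquiv ℂ (spaceTimeDilation d) ψ) v =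
      k ((2 * Real.pi) • v) := by
    intro v
    rw [SchwartzMap.compCLMOfContinuousLinearEquiv_apply, fourierChar_smul, hk, wave,
      Function.comp_apply, spaceTimeDilation_apply, WithLp.prod_inner_apply]
    dsimp only
    rw [← neg_mul, ← Complex.ofReal_neg]
    congr 4
    simp [inner_smul_right, real_inner_comm]
    ring
  rw [SchwartzMap.fourier_coe, Real.fourier_eq, integral_congr_ae (Filter.Eventually.of_forall h1),
    Measure.integral_comp_smul volume k (2 * Real.pi), finrank_spaceTime, Complex.real_smul,
    ← mul_assoc, ← Complex.ofReal_mul, abs_of_pos (by positivity), mul_inv_cancel₀ (by positivity),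
    Complex.ofReal_one, one_mul, testFourier,
    ← (WithLp.volume_preserving_ofLp ℝ (EuclideanSpace ℝ (Fin d))).integral_comp
      (MeasurableEquiv.toLp 2 (ℝ × EuclideanSpace ℝ (Fin d))).symm.measurableEmbedding, hk]
  rfl

/-- For `L²` functions the distributional transform is Mathlib's `𝓕` dilated by `2π`; the Jacobian
`(2π)^(d+1)` cancels against that in `testFourier_eq_fourier`. -/
theorem isSpaceTimeFourier_Lp
    (h : Lp ℂ 2 (volume : Measure (WithLp 2 (ℝ × EuclideanSpace ℝ (Fin d))))) :
    IsSpaceTimeFourier (fun t x => h (WithLp.toLp 2 (t, x))) fun p =>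
      (𝓕 h : Lp ℂ 2 (volume : Measure (WithLp 2 (ℝ × EuclideanSpace ℝ (Fin d)))))
        ((2 * Real.pi)⁻¹ • WithLp.toLp 2 p) := by
  intro ψ
  have hpi := Real.pi_pos
  set Ψ := SchwartzMap.compCLMOfContinuousLinearEquiv ℂ (spaceTimeDilation d) ψ with hΨ
  have hto := WithLp.volume_preserving_toLp ℝ (EuclideanSpace ℝ (Fin d))
  have hemb := (MeasurableEquiv.toLp 2 (ℝ × EuclideanSpace ℝ (Fin d))).measurableEmbedding
  have hint : ∀ (u : Lp ℂ 2 (volume : Measure (WithLp 2 (ℝ × EuclideanSpace ℝ (Fin d)))))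
      (χ : 𝓢(WithLp 2 (ℝ × EuclideanSpace ℝ (Fin d)), ℂ)), Integrable fun v => u v * χ v :=
    fun u χ => (Lp.memLp u).integrable_mul (χ.memLp 2)
  have h1 : Integrable (fun p : ℝ × EuclideanSpace ℝ (Fin d) => h (WithLp.toLp 2 (p.1, p.2)) *
      testFourier ψ p.1 p.2) (volume.prod volume) := by
    have := (hto.integrable_comp_of_integrable (hint h (𝓕 Ψ))).const_mul
      (((2 * Real.pi) ^ (d + 1) : ℝ) : ℂ)
    refine this.congr (Filter.Eventually.of_forall fun p => ?_)
    simp only [Function.comp_apply]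
    rw [testFourier_eq_fourier]
    ring
  have h2 : ∀ p : ℝ × EuclideanSpace ℝ (Fin d), Ψ ((2 * Real.pi)⁻¹ • WithLp.toLp 2 p) = ψ p := by
    intro p
    rw [hΨ, SchwartzMap.compCLMOfContinuousLinearEquiv_apply, Function.comp_apply,
      spaceTimeDilation_apply, smul_smul, mul_inv_cancel₀ (by positivity), one_smul]
  obtain ⟨k, hk⟩ : ∃ k : WithLp 2 (ℝ × EuclideanSpace ℝ (Fin d)) → ℂ, k = fun v =>
    (𝓕 h : Lp ℂ 2 (volume : Measure (WithLp 2 (ℝ × EuclideanSpace ℝ (Fin d))))) v * Ψ v :=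
    ⟨_, rfl⟩
  have h3 : ∀ p : ℝ × EuclideanSpace ℝ (Fin d),
      (𝓕 h : Lp ℂ 2 (volume : Measure (WithLp 2 (ℝ × EuclideanSpace ℝ (Fin d)))))
        ((2 * Real.pi)⁻¹ • WithLp.toLp 2 p) * ψ p =
      (fun v => k ((2 * Real.pi)⁻¹ • v)) (WithLp.toLp 2 p) := by
    intro p
    rw [hk]
    dsimp only
    rw [h2]
  have hki : Integrable fun v => k ((2 * Real.pi)⁻¹ • v) :=
    (integrable_comp_smul_iff volume k (by positivity)).2 (hk ▸ hint _ _)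
  refine ⟨h1.prod_right_ae, h1.integral_prod_left, ?_, ?_⟩
  · simp only [h3]
    exact hto.integrable_comp_of_integrable hki
  · rw [← integral_prod _ h1, integral_congr_ae (Filter.Eventually.of_forall h3),
      hto.integral_comp hemb (fun v => k ((2 * Real.pi)⁻¹ • v)),
      Measure.integral_comp_smul volume k, finrank_spaceTime, hk,
      integral_fourier_Lp_mul, inv_pow, inv_inv, abs_of_pos (by positivity), Complex.real_smul,
      ← integral_const_mul, ← hto.integral_comp hemb]
    refine integral_congr_ae (Filter.Eventually.of_forall fun p => ?_)
    dsimp only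
    rw [testFourier_eq_fourier]
    ring

theorem lintegral_fourier_Lp_sq
    (h : Lp ℂ 2 (volume : Measure (WithLp 2 (ℝ × EuclideanSpace ℝ (Fin d))))) :
    ∫⁻ p : ℝ × EuclideanSpace ℝ (Fin d),
      ‖(𝓕 h : Lp ℂ 2 (volume : Measure (WithLp 2 (ℝ × EuclideanSpace ℝ (Fin d)))))
        ((2 * Real.pi)⁻¹ • WithLp.toLp 2 p)‖ₑ ^ 2 =
      ENNReal.ofReal ((2 * Real.pi) ^ (d + 1)) * ∫⁻ v, ‖h v‖ₑ ^ 2 := by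
  have hpi := Real.pi_pos
  have hto := WithLp.volume_preserving_toLp ℝ (EuclideanSpace ℝ (Fin d))
  have hemb := (MeasurableEquiv.toLp 2 (ℝ × EuclideanSpace ℝ (Fin d))).measurableEmbedding
  obtain ⟨k, hk⟩ : ∃ k : WithLp 2 (ℝ × EuclideanSpace ℝ (Fin d)) → ℝ≥0∞, k = fun v =>
    ‖(𝓕 h : Lp ℂ 2 (volume : Measure (WithLp 2 (ℝ × EuclideanSpace ℝ (Fin d))))) v‖ₑ ^ 2 :=
    ⟨_, rfl⟩
  have h1 : ∫⁻ p : ℝ × EuclideanSpace ℝ (Fin d),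
      ‖(𝓕 h : Lp ℂ 2 (volume : Measure (WithLp 2 (ℝ × EuclideanSpace ℝ (Fin d)))))
        ((2 * Real.pi)⁻¹ • WithLp.toLp 2 p)‖ₑ ^ 2 =
      ∫⁻ p : ℝ × EuclideanSpace ℝ (Fin d), (fun v => k ((2 * Real.pi)⁻¹ • v)) (WithLp.toLp 2 p) := by
    rw [hk]
  rw [h1, hto.lintegral_comp_emb hemb (fun v => k ((2 * Real.pi)⁻¹ • v)), lintegral_comp_const_smul volume (by positivity),
    finrank_spaceTime, hk, ← eLpNorm_two_sq, ← eLpNorm_two_sq, ← Lp.enorm_def, ← Lp.enorm_def,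
    ← ofReal_norm, Lp.norm_fourier_eq, ofReal_norm]

/-- Uniqueness identifies `n` with the dilated `L²` transform of `G`, so Plancherel applies to any
admissible representative. -/
theorem lintegral_sq_eq_of_isSpaceTimeFourier {G : ℝ → EuclideanSpace ℝ (Fin d) → ℂ}
    (hG : MemLp (Function.uncurry G) 2 volume) {n : ℝ × EuclideanSpace ℝ (Fin d) → ℂ}
    (hn : IsSpaceTimeFourier G n) :
    ∫⁻ p, ‖n p‖ₑ ^ 2 =
      ENNReal.ofReal ((2 * Real.pi) ^ (d + 1)) * eLpNorm (Function.uncurry G) 2 volume ^ 2 := by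
  have hof := WithLp.volume_preserving_ofLp ℝ (EuclideanSpace ℝ (Fin d))
  have hto := WithLp.volume_preserving_toLp ℝ (EuclideanSpace ℝ (Fin d))
  have hemb := (MeasurableEquiv.toLp 2 (ℝ × EuclideanSpace ℝ (Fin d))).measurableEmbedding
  have hG' : MemLp (fun v : WithLp 2 (ℝ × EuclideanSpace ℝ (Fin d)) =>
      Function.uncurry G (WithLp.ofLp v)) 2 volume := hG.comp_measurePreserving hof
  have hae := hto.quasiMeasurePreserving.ae hG'.coeFn_toLp
  have h1 := (isSpaceTimeFourier_Lp (hG'.toLp _)).congr_left (F' := G) hae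
  have h2 : ∫⁻ v, ‖hG'.toLp _ v‖ₑ ^ 2 = eLpNorm (Function.uncurry G) 2 volume ^ 2 := by
    rw [eLpNorm_two_sq, ← hto.lintegral_comp_emb hemb]
    refine lintegral_congr_ae ?_
    filter_upwards [hae] with p hp
    rw [hp]
  rw [← h2, ← lintegral_fourier_Lp_sq]
  refine lintegral_congr_ae ?_
  filter_upwards [hn.ae_eq h1] with p hp
  rw [hp]

/-- Surjectivity of the `L²` Fourier transform: this is what produces `|□|^β F` once its transform
is known to be square integrable. -/
theorem exists_isSpaceTimeFourier {n : ℝ × EuclideanSpace ℝ (Fin d) → ℂ} (hn : MemLp n 2 volume) :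
    ∃ G : ℝ → EuclideanSpace ℝ (Fin d) → ℂ, MemLp (Function.uncurry G) 2 volume ∧
      IsSpaceTimeFourier G n := by
  have hpi := Real.pi_pos
  have hof := WithLp.volume_preserving_ofLp ℝ (EuclideanSpace ℝ (Fin d))
  have hto := WithLp.volume_preserving_toLp ℝ (EuclideanSpace ℝ (Fin d))
  have hn1 : MemLp (fun v : WithLp 2 (ℝ × EuclideanSpace ℝ (Fin d)) => n (WithLp.ofLp v)) 2 volume :=
    hn.comp_measurePreserving hof
  have hq : ∀ r : ℝ, r ≠ 0 → Measure.QuasiMeasurePreserving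
      (fun v : WithLp 2 (ℝ × EuclideanSpace ℝ (Fin d)) => r • v) volume volume := fun r hr =>
    ⟨measurable_const_smul r, by
      rw [Measure.map_addHaar_smul volume hr]
      exact Measure.smul_absolutelyContinuous⟩
  have hn2 : MemLp (fun v : WithLp 2 (ℝ × EuclideanSpace ℝ (Fin d)) =>
      n (WithLp.ofLp ((2 * Real.pi) • v))) 2 volume := by
    have hm := hn1.aestronglyMeasurable.comp_quasiMeasurePreserving
      (hq (2 * Real.pi) (by positivity))
    refine (memLp_two_iff_integrable_sq_norm hm).2 ?_
    exact (integrable_comp_smul_iff volume (fun v : WithLp 2 (ℝ × EuclideanSpace ℝ (Fin d)) =>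
      ‖n (WithLp.ofLp v)‖ ^ 2) (by positivity)).2
      ((memLp_two_iff_integrable_sq_norm hn1.aestronglyMeasurable).1 hn1)
  set h : Lp ℂ 2 (volume : Measure (WithLp 2 (ℝ × EuclideanSpace ℝ (Fin d)))) :=
    𝓕⁻ (hn2.toLp _) with hh
  refine ⟨fun t x => h (WithLp.toLp 2 (t, x)), (Lp.memLp h).comp_measurePreserving hto,
    (isSpaceTimeFourier_Lp h).congr_right ?_⟩
  rw [hh, fourier_fourierInv_eq]
  have h1 := hto.quasiMeasurePreserving.ae ((hq (2 * Real.pi)⁻¹ (by positivity)).ae hn2.coeFn_toLp)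
  filter_upwards [h1] with p hp
  rw [hp, smul_smul, mul_inv_cancel₀ (by positivity), one_smul]

end Plancherel

/-! ### Densities of images of complex measures -/

section ComplexDensity

theorem exists_nnreal_density {α : Type*} [MeasurableSpace α] {μ ν : Measure α} [SigmaFinite μ]
    [SigmaFinite ν] (h : μ ≪ ν) :
    ∃ D : α → NNReal, Measurable D ∧ μ = ν.withDensity fun a => (D a : ℝ≥0∞) := by
  refine ⟨fun a => (μ.rnDeriv ν a).toNNReal, (Measure.measurable_rnDeriv μ ν).ennreal_toNNReal, ?_⟩
  conv_lhs => rw [← Measure.withDensity_rnDeriv_eq μ ν h]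
  refine withDensity_congr_ae ?_
  filter_upwards [Measure.rnDeriv_lt_top μ ν] with a ha
  rw [ENNReal.coe_toNNReal ha.ne]

theorem enorm_nnreal_smul (c : NNReal) (z : ℂ) : ‖c • z‖ₑ = c * ‖z‖ₑ := by
  rw [NNReal.smul_def, enorm_smul, Real.enorm_of_nonneg c.coe_nonneg, ENNReal.ofReal_coe_nnreal]

/-- If the image of a measure has a density, then so has the image of any complex measure
dominated by it, with domination of the densities. -/
theorem exists_complex_density {α V : Type*} [MeasurableSpace α] [StandardBorelSpace α] [Nonempty α]
    [MeasurableSpace V] {ν : Measure α} [SigmaFinite ν] {l : Measure V} [SigmaFinite l]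
    {T : α → V} (hT : Measurable T) {M : V → ℝ≥0∞} (hM : Measurable M)
    (h : ν.map T = l.withDensity M) {u : α → ℂ} (hu : Measurable u) (hu1 : ∀ a, ‖u a‖ ≤ 1) :
    ∃ m : V → ℂ, StronglyMeasurable m ∧ (∀ᵐ v ∂l, ‖m v‖ₑ ≤ M v) ∧
      ∀ ψ : V → ℂ, Measurable ψ → Integrable (fun a => ψ (T a)) ν →
        Integrable (fun v => m v * ψ v) l ∧ ∫ v, m v * ψ v ∂l = ∫ a, u a * ψ (T a) ∂ν := by
  -- Disintegration is applied to a finite measure, so `ν` is replaced by an equivalent finite one,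
  -- with density `D` put back as a weight.
  set ν' := ν.toFinite
  obtain ⟨D, hD, hνD⟩ := exists_nnreal_density (absolutelyContinuous_toFinite ν)
  change ν = ν'.withDensity _ at hνD
  have hac : ν'.map T ≪ l :=
    ((toFinite_absolutelyContinuous ν).map hT).trans (h ▸ withDensity_absolutelyContinuous l M)
  obtain ⟨N, hN, hνN⟩ := exists_nnreal_density hac
  have hTid : Measurable fun a => (T a, a) := hT.prodMk measurable_id
  -- The graph of `T`, whose conditional kernel disintegrates `ν'` over the fibres of `T`.
  set ρ := ν'.map fun a => (T a, a) with hρ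
  have hfst : ρ.fst = l.withDensity fun v => (N v : ℝ≥0∞) := by
    rw [hρ, ← hνN]
    exact Measure.fst_map_prodMk measurable_id
  have hI : Measurable fun v => ∫⁻ a, (D a : ℝ≥0∞) ∂ρ.condKernel v :=
    Measurable.lintegral_kernel (by fun_prop)
  -- `M` is the fibre integral of `D`; the complex density is the fibre integral of `D • u`, and
  -- `‖u‖ ≤ 1` gives the domination.
  have hMI : (fun v => (N v : ℝ≥0∞) * ∫⁻ a, (D a : ℝ≥0∞) ∂ρ.condKernel v) =ᵐ[l] M := by
    refine (withDensity_eq_iff_of_sigmaFinite (by fun_prop) hM.aemeasurable).1 ?_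
    have e := withDensity_mul l (f := fun v => (N v : ℝ≥0∞)) (by fun_prop) hI
    refine e.trans ?_
    rw [← hfst, ← h]
    ext A hA
    rw [withDensity_apply _ hA, Measure.setLIntegral_condKernel_univ_right
      (f := fun p : V × α => (D p.2 : ℝ≥0∞)) (by fun_prop) hA, hρ,
      setLIntegral_map (hA.prod MeasurableSet.univ) (by fun_prop) hTid, Measure.map_apply hT hA, hνD,
      withDensity_apply _ (hT hA)]
    congr 2
    ext a
    simp
  refine ⟨fun v => N v • ∫ a, (D a • u a) ∂ρ.condKernel v, ?_, ?_, fun ψ hψ hψi => ?_⟩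
  · have h1 : Measurable fun p : V × α => D p.2 • u p.2 := by fun_prop
    have h2 : StronglyMeasurable fun v => ∫ a, (D a • u a) ∂ρ.condKernel v :=
      h1.stronglyMeasurable.integral_kernel_prod_right'
    exact (hN.smul h2.measurable).stronglyMeasurable
  · filter_upwards [hMI] with v hv
    rw [← hv, enorm_nnreal_smul]
    refine mul_le_mul' le_rfl ((enorm_integral_le_lintegral_enorm (fun a => D a • u a)).trans ?_)
    refine lintegral_mono fun a => ?_
    dsimp only
    rw [enorm_nnreal_smul]
    refine mul_le_of_le_one_right' ?_
    rw [← ofReal_norm]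
    exact ENNReal.ofReal_le_one.2 (hu1 a)
  · have h1 : Integrable (fun a => ψ (T a) * (D a • u a)) ν' := by
      rw [hνD, integrable_withDensity_iff_integrable_smul hD] at hψi
      refine (hψi.bdd_mul (c := 1) hu.aestronglyMeasurable (Filter.Eventually.of_forall hu1)).congr
        (Filter.Eventually.of_forall fun a => ?_)
      simp only [NNReal.smul_def, Complex.real_smul]
      ring
    have hf : Measurable fun p : V × α => ψ p.1 * (D p.2 • u p.2) := by fun_prop
    have h2 : Integrable (fun p : V × α => ψ p.1 * (D p.2 • u p.2)) ρ := by
      rw [hρ, integrable_map_measure hf.aestronglyMeasurable hTid.aemeasurable]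
      exact h1
    have h3 := h2.integral_condKernel
    have h4 := Measure.integral_condKernel h2
    have h5 : ∀ v, ((N v • ∫ a, (D a • u a) ∂ρ.condKernel v) * ψ v) =
        N v • ∫ a, ψ v * (D a • u a) ∂ρ.condKernel v := by
      intro v
      rw [integral_const_mul, smul_mul_assoc, mul_comm (ψ v)]
    rw [hfst] at h3 h4
    rw [integrable_withDensity_iff_integrable_smul hN] at h3
    rw [integral_withDensity_eq_integral_smul hN] at h4
    simp only [h5]
    refine ⟨h3, h4.trans ?_⟩
    rw [hρ, integral_map hTid.aemeasurable hf.aestronglyMeasurable, hνD,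
      integral_withDensity_eq_integral_smul hD]
    refine integral_congr_ae (Filter.Eventually.of_forall fun a => ?_)
    simp only [NNReal.smul_def, Complex.real_smul]
    ring

end ComplexDensity

/-! ### Integrability against weights decaying in the momentum transfer -/

section Decay

variable {d : ℕ}

/-- A weight with integrable decay. -/
def decayWeight (ξ : EuclideanSpace ℝ (Fin d)) : ℝ := (1 + ‖ξ‖) ^ (-((d : ℝ) + 1))

theorem decayWeight_pos (ξ : EuclideanSpace ℝ (Fin d)) : 0 < decayWeight ξ := by
  unfold decayWeight
  positivity

theorem measurable_decayWeight : Measurable (decayWeight (d := d)) := by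
  unfold decayWeight
  fun_prop

theorem integrable_decayWeight : Integrable (decayWeight (d := d)) :=
  integrable_one_add_norm (by rw [finrank_euclideanSpace_fin]; linarith)

theorem exists_norm_le_decayWeight (ψ : 𝓢(ℝ × EuclideanSpace ℝ (Fin d), ℂ)) :
    ∃ C : ℝ, ∀ p, ‖ψ p‖ ≤ C * decayWeight p.2 := by
  refine ⟨2 ^ (d + 1) * ((Finset.Iic (d + 1, 0)).sup fun m => SchwartzMap.seminorm ℝ m.1 m.2) ψ,
    fun p => ?_⟩
  have h := SchwartzMap.one_add_le_sup_seminorm_apply (𝕜 := ℝ) (m := (d + 1, 0)) le_rfl le_rfl ψ p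
  rw [norm_iteratedFDeriv_zero] at h
  have h1 : (1 + ‖p.2‖) ^ (d + 1) ≤ (1 + ‖p‖) ^ (d + 1) := by
    gcongr
    exact norm_snd_le p
  have h2 : decayWeight p.2 = ((1 + ‖p.2‖) ^ (d + 1))⁻¹ := by
    rw [decayWeight, Real.rpow_neg (by positivity), ← Real.rpow_natCast]
    push_cast
    rfl
  rw [h2, ← div_eq_mul_inv, le_div_iff₀ (by positivity), mul_comm]
  exact (mul_le_mul_of_nonneg_right h1 (norm_nonneg _)).trans h

variable (f g : Lp ℂ 2 (volume : Measure (EuclideanSpace ℝ (Fin d))))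

/-- In the variable `ξ = η₁ - η₂` the weight is integrable, and the product of the transforms is
integrable in `η₂` uniformly in `ξ`. -/
theorem integrable_hat_mul_hat_mul_decayWeight :
    Integrable fun η : EuclideanSpace ℝ (Fin d) × EuclideanSpace ℝ (Fin d) =>
      hat f η.1 * conj (hat g η.2) * (decayWeight (η.1 - η.2) : ℂ) := by
  have h := integrable_mul_of_integral_norm_le (μ := (volume : Measure (EuclideanSpace ℝ (Fin d))))
    (ν := (volume : Measure (EuclideanSpace ℝ (Fin d)))) (integrable_decayWeight (d := d)).ofReal
    (stronglyMeasurable_crossSpectrum f g) (integrable_crossSpectrum f g)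
    (integral_norm_crossSpectrum_le f g)
  refine ((measurePreserving_sub_prod (volume : Measure (EuclideanSpace ℝ (Fin d)))
    (volume : Measure (EuclideanSpace ℝ (Fin d)))).integrable_comp_of_integrable h).congr
    (Filter.Eventually.of_forall fun η => ?_)
  simp only [Function.comp_apply, crossSpectrum, sub_add_cancel]
  rw [mul_comm]
  rfl

end Decay

/-! ### The sharp estimate and the case of equality -/

section Estimate

variable {d : ℕ} (f g : Lp ℂ 2 (volume : Measure (EuclideanSpace ℝ (Fin d))))

theorem measurable_hat : Measurable (hat f) := (stronglyMeasurable_hat f).measurable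

theorem measurable_enorm_hat : Measurable fun η => ‖hat f η‖ₑ := (measurable_hat f).enorm

theorem ofLp_transfer (s : ℝ) (η : EuclideanSpace ℝ (Fin d) × EuclideanSpace ℝ (Fin d)) :
    WithLp.ofLp (transfer s η) = (phi s ‖η.1‖ - phi s ‖η.2‖, η.1 - η.2) := rfl

theorem lintegral_transferMeasure_hat (s : ℝ)
    {w : WithLp 2 (ℝ × EuclideanSpace ℝ (Fin d)) → ℝ≥0∞} (hw : Measurable w) :
    ∫⁻ x, w x ∂(transferMeasure s (fun η => ‖hat f η‖ₑ) fun η => ‖hat g η‖ₑ) =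
      ∫⁻ η : EuclideanSpace ℝ (Fin d) × EuclideanSpace ℝ (Fin d),
        (‖hat f η.1‖ₑ * ‖hat g η.2‖ₑ) * w (transfer s η) := by
  have hT := (continuous_transfer (E := EuclideanSpace ℝ (Fin d)) s).measurable
  have hf := measurable_enorm_hat f
  have hg := measurable_enorm_hat g
  rw [transferMeasure, lintegral_map hw hT]
  exact lintegral_withDensity_eq_lintegral_mul _
    ((hf.comp measurable_fst).mul (hg.comp measurable_snd)) (hw.comp hT)

theorem lintegral_decayWeight_transferMeasure (s : ℝ) :
    ∫⁻ x, ENNReal.ofReal (decayWeight x.snd) ∂(transferMeasure s (fun η => ‖hat f η‖ₑ)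
      fun η => ‖hat g η‖ₑ) < ∞ := by
  have h1 : Continuous fun x : WithLp 2 (ℝ × EuclideanSpace ℝ (Fin d)) => x.snd := by fun_prop
  have h2 : Measurable fun x : WithLp 2 (ℝ × EuclideanSpace ℝ (Fin d)) =>
    ENNReal.ofReal (decayWeight x.snd) := (measurable_decayWeight.comp h1.measurable).ennreal_ofReal
  rw [lintegral_transferMeasure_hat f g s h2]
  refine lt_of_eq_of_lt (lintegral_congr fun η => ?_)
    (integrable_hat_mul_hat_mul_decayWeight f g).hasFiniteIntegral
  rw [enorm_mul, enorm_mul, RCLike.enorm_conj]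
  congr 1
  rw [← ofReal_norm, Complex.norm_real, Real.norm_of_nonneg (decayWeight_pos _).le]
  rfl

/-- The transfer measure, possibly infinite, has finite integral against a strictly positive weight.
Finiteness of `M` ensures that `toReal` loses nothing. -/
theorem ae_lt_top_of_transferMeasure_eq (s : ℝ)
    {M : WithLp 2 (ℝ × EuclideanSpace ℝ (Fin d)) → ℝ≥0∞} (hM : Measurable M)
    (h : transferMeasure s (fun η => ‖hat f η‖ₑ) (fun η => ‖hat g η‖ₑ) = volume.withDensity M) :
    ∀ᵐ x, M x < ∞ := by
  have h1 : Continuous fun x : WithLp 2 (ℝ × EuclideanSpace ℝ (Fin d)) => x.snd := by fun_prop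
  have h2 : Measurable fun x : WithLp 2 (ℝ × EuclideanSpace ℝ (Fin d)) =>
    ENNReal.ofReal (decayWeight x.snd) := (measurable_decayWeight.comp h1.measurable).ennreal_ofReal
  have h3 := lintegral_decayWeight_transferMeasure f g s
  rw [h, lintegral_withDensity_eq_lintegral_mul _ hM h2] at h3
  filter_upwards [ae_lt_top (hM.mul h2) h3.ne] with x hx
  by_contra hx'
  rw [not_lt, top_le_iff] at hx'
  have h4 : ENNReal.ofReal (decayWeight x.snd) ≠ 0 := by simpa using decayWeight_pos x.snd
  simp only [Pi.mul_apply, hx', ENNReal.top_mul h4, lt_self_iff_false] at hx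

theorem integrable_hat_mul_hat_mul_schwartz (s : ℝ) (ψ : 𝓢(ℝ × EuclideanSpace ℝ (Fin d), ℂ)) :
    Integrable fun η : EuclideanSpace ℝ (Fin d) × EuclideanSpace ℝ (Fin d) =>
      hat f η.1 * conj (hat g η.2) * ψ (WithLp.ofLp (transfer s η)) := by
  obtain ⟨C, hC⟩ := exists_norm_le_decayWeight ψ
  have hT := continuous_transfer (E := EuclideanSpace ℝ (Fin d)) s
  have hψ : Continuous fun η : EuclideanSpace ℝ (Fin d) × EuclideanSpace ℝ (Fin d) =>
      ψ (WithLp.ofLp (transfer s η)) :=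
    ψ.continuous.comp ((WithLp.prod_continuous_ofLp 2 _ _).comp hT)
  have hf := measurable_hat f
  have hg := measurable_hat g
  refine ((integrable_hat_mul_hat_mul_decayWeight f g).norm.const_mul C).mono' ?_
    (Filter.Eventually.of_forall fun η => ?_)
  · refine Measurable.aestronglyMeasurable ?_
    exact ((hf.comp measurable_fst).mul (continuous_star.measurable.comp
      (hg.comp measurable_snd))).mul hψ.measurable
  · rw [norm_mul, norm_mul _ (decayWeight _ : ℂ), Complex.norm_real,
      Real.norm_of_nonneg (decayWeight_pos _).le, mul_left_comm]
    exact mul_le_mul_of_nonneg_left (hC _) (norm_nonneg _)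

/-- The Fourier density of the product of two waves, dominated by the density of the transfer. -/
theorem exists_bilinear_density {s : ℝ} (hs : 0 < s) (hd : 2 ≤ d) :
    ∃ (M : WithLp 2 (ℝ × EuclideanSpace ℝ (Fin d)) → ℝ≥0∞) (m : ℝ × EuclideanSpace ℝ (Fin d) → ℂ),
      Measurable M ∧
      transferMeasure s (fun η => ‖hat f η‖ₑ) (fun η => ‖hat g η‖ₑ) = volume.withDensity M ∧
      (∀ w : WithLp 2 (ℝ × EuclideanSpace ℝ (Fin d)) → ℝ≥0∞, Measurable w →
        ∫⁻ x, w x * M x ^ 2 = quadIntegral s w (fun η => ‖hat f η‖ₑ) fun η => ‖hat g η‖ₑ) ∧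
      AEStronglyMeasurable m volume ∧ (∀ᵐ p, ‖m p‖ₑ ≤ M (WithLp.toLp 2 p)) ∧
      IsSpaceTimeFourier (bilinear s f g)
        fun p => ((2 * Real.pi * ((2 * Real.pi) ^ d)⁻¹ : ℝ) : ℂ) * m p := by
  have hdim : Module.finrank ℝ (EuclideanSpace ℝ (Fin d)) = d := finrank_euclideanSpace_fin
  have hf := measurable_hat f
  have hg := measurable_hat g
  obtain ⟨M, hM, hTM, hquad⟩ := exists_transferDensity (E := EuclideanSpace ℝ (Fin d)) hs
    (hdim.symm ▸ hd) (measurable_enorm_hat f) (measurable_enorm_hat g) (fun η => enorm_ne_top)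
    (fun η => enorm_ne_top)
  have hT := (continuous_transfer (E := EuclideanSpace ℝ (Fin d)) s).measurable
  set δ : EuclideanSpace ℝ (Fin d) × EuclideanSpace ℝ (Fin d) → NNReal := fun η =>
    ‖hat f η.1‖₊ * ‖hat g η.2‖₊ with hδ
  have hδm : Measurable δ := by fun_prop
  have hδe : (fun η : EuclideanSpace ℝ (Fin d) × EuclideanSpace ℝ (Fin d) =>
      ‖hat f η.1‖ₑ * ‖hat g η.2‖ₑ) = fun η => (δ η : ℝ≥0∞) := by
    ext η
    simp [hδ, enorm]
  set F : EuclideanSpace ℝ (Fin d) × EuclideanSpace ℝ (Fin d) → ℂ := fun η =>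
    hat f η.1 * conj (hat g η.2) with hF
  have hFm : Measurable F := (hf.comp measurable_fst).mul
    (continuous_star.measurable.comp (hg.comp measurable_snd))
  have hFδ : ∀ η, ‖F η‖ = δ η := fun η => by simp [hF, hδ]
  -- The phase of `F`, of modulus at most one: the complex measure is `u` times the positive measure
  -- with density `δ`.
  set u : EuclideanSpace ℝ (Fin d) × EuclideanSpace ℝ (Fin d) → ℂ := fun η => F η / ‖F η‖ with hu
  have huδ : ∀ η, δ η • u η = F η := by
    intro η
    rw [NNReal.smul_def, ← hFδ, Complex.real_smul, hu]
    by_cases h0 : F η = 0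
    · simp [h0]
    · have : (‖F η‖ : ℂ) ≠ 0 := by simpa using h0
      field_simp
  have hsig : SigmaFinite ((volume : Measure (EuclideanSpace ℝ (Fin d) ×
      EuclideanSpace ℝ (Fin d))).withDensity fun η => (δ η : ℝ≥0∞)) :=
    SigmaFinite.withDensity_of_ne_top (Filter.Eventually.of_forall fun η => ENNReal.coe_ne_top)
  have hTδ : ((volume : Measure (EuclideanSpace ℝ (Fin d) × EuclideanSpace ℝ (Fin d))).withDensity
      fun η => (δ η : ℝ≥0∞)).map (transfer s) = volume.withDensity M := by
    rw [← hδe]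
    exact hTM
  obtain ⟨m, hm, hmM, hmψ⟩ := exists_complex_density (u := u) hT hM hTδ (by fun_prop) (fun η => by
      rw [hu, norm_div, Complex.norm_real, norm_norm]
      exact div_self_le_one _)
  have hto := WithLp.volume_preserving_toLp ℝ (EuclideanSpace ℝ (Fin d))
  have hemb := (MeasurableEquiv.toLp 2 (ℝ × EuclideanSpace ℝ (Fin d))).measurableEmbedding
  refine ⟨M, fun p => m (WithLp.toLp 2 p), hM, hTM, hquad,
    hm.aestronglyMeasurable.comp_measurePreserving hto, hto.quasiMeasurePreserving.ae hmM,
    isSpaceTimeFourier_bilinear f g s fun ψ => ?_⟩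
  have hψm : Measurable fun v : WithLp 2 (ℝ × EuclideanSpace ℝ (Fin d)) => ψ (WithLp.ofLp v) :=
    (ψ.continuous.comp (WithLp.prod_continuous_ofLp 2 _ _)).measurable
  have hi := integrable_hat_mul_hat_mul_schwartz f g s ψ
  have hψi : Integrable (fun η => ψ (WithLp.ofLp (transfer s η)))
      ((volume : Measure (EuclideanSpace ℝ (Fin d) ×
      EuclideanSpace ℝ (Fin d))).withDensity fun η => (δ η : ℝ≥0∞)) := by
    rw [integrable_withDensity_iff_integrable_smul hδm]
    refine hi.norm.mono' ?_ (Filter.Eventually.of_forall fun η => ?_)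
    · have : Measurable fun η => ψ (WithLp.ofLp (transfer s η)) := hψm.comp hT
      exact Measurable.aestronglyMeasurable (by fun_prop)
    · rw [NNReal.smul_def, norm_smul, norm_mul, ← hFδ, norm_norm]
  obtain ⟨h1, h2⟩ := hmψ _ hψm hψi
  refine ⟨hto.integrable_comp_of_integrable h1, ?_⟩
  rw [integral_withDensity_eq_integral_smul hδm] at h2
  refine (hto.integral_comp hemb (fun v => m v * ψ (WithLp.ofLp v))).trans (h2.trans ?_)
  refine integral_congr_ae (Filter.Eventually.of_forall fun η => ?_)
  dsimp only
  rw [← smul_mul_assoc, huδ, ofLp_transfer]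

/-- For nonnegative Fourier transforms the Fourier density is the density of the transfer. -/
theorem isSpaceTimeFourier_bilinear_of_nonneg {s : ℝ}
    (hf : ∀ᵐ η, hat f η = (‖hat f η‖ : ℂ)) (hg : ∀ᵐ η, hat g η = (‖hat g η‖ : ℂ))
    {M : WithLp 2 (ℝ × EuclideanSpace ℝ (Fin d)) → ℝ≥0∞} (hM : Measurable M)
    (h : transferMeasure s (fun η => ‖hat f η‖ₑ) (fun η => ‖hat g η‖ₑ) = volume.withDensity M) :
    IsSpaceTimeFourier (bilinear s f g)
      fun p => ((2 * Real.pi * ((2 * Real.pi) ^ d)⁻¹ : ℝ) : ℂ) *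
        ((M (WithLp.toLp 2 p)).toReal : ℂ) := by
  have hfm := measurable_hat f
  have hgm := measurable_hat g
  have hT := (continuous_transfer (E := EuclideanSpace ℝ (Fin d)) s).measurable
  have hto := WithLp.volume_preserving_toLp ℝ (EuclideanSpace ℝ (Fin d))
  have hemb := (MeasurableEquiv.toLp 2 (ℝ × EuclideanSpace ℝ (Fin d))).measurableEmbedding
  have hMfin := ae_lt_top_of_transferMeasure_eq f g s hM h
  refine isSpaceTimeFourier_bilinear f g s fun ψ => ?_
  have hψm : Measurable fun v : WithLp 2 (ℝ × EuclideanSpace ℝ (Fin d)) => ψ (WithLp.ofLp v) :=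
    (ψ.continuous.comp (WithLp.prod_continuous_ofLp 2 _ _)).measurable
  have hi := integrable_hat_mul_hat_mul_schwartz f g s ψ
  have hD : Measurable fun η : EuclideanSpace ℝ (Fin d) × EuclideanSpace ℝ (Fin d) =>
    ‖hat f η.1‖ₑ * ‖hat g η.2‖ₑ := by fun_prop
  have hDfin : ∀ᵐ η : EuclideanSpace ℝ (Fin d) × EuclideanSpace ℝ (Fin d),
      ‖hat f η.1‖ₑ * ‖hat g η.2‖ₑ < ∞ :=
    Filter.Eventually.of_forall fun η => ENNReal.mul_lt_top enorm_lt_top enorm_lt_top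
  have hFD : ∀ᵐ η : EuclideanSpace ℝ (Fin d) × EuclideanSpace ℝ (Fin d),
      (‖hat f η.1‖ₑ * ‖hat g η.2‖ₑ).toReal • ψ (WithLp.ofLp (transfer s η)) =
        hat f η.1 * conj (hat g η.2) * ψ (WithLp.ofLp (transfer s η)) := by
    filter_upwards [Measure.quasiMeasurePreserving_fst.ae hf,
      Measure.quasiMeasurePreserving_snd.ae hg] with η h1 h2
    rw [h1, h2, Complex.conj_ofReal, ENNReal.toReal_mul, toReal_enorm, toReal_enorm]
    simp
  have h1 : Integrable (fun v : WithLp 2 (ℝ × EuclideanSpace ℝ (Fin d)) => ψ (WithLp.ofLp v))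
      (transferMeasure s (fun η => ‖hat f η‖ₑ) (fun η => ‖hat g η‖ₑ)) := by
    rw [transferMeasure, integrable_map_measure hψm.aestronglyMeasurable hT.aemeasurable,
      integrable_withDensity_iff_integrable_smul' hD hDfin]
    refine hi.congr ?_
    filter_upwards [hFD] with η hη using hη.symm
  have h2 : ∫ v, ψ (WithLp.ofLp v) ∂(transferMeasure s (fun η => ‖hat f η‖ₑ)
      (fun η => ‖hat g η‖ₑ)) = ∫ η : EuclideanSpace ℝ (Fin d) × EuclideanSpace ℝ (Fin d),
        hat f η.1 * conj (hat g η.2) * ψ (WithLp.ofLp (transfer s η)) := by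
    rw [transferMeasure, integral_map hT.aemeasurable hψm.aestronglyMeasurable,
      integral_withDensity_eq_integral_toReal_smul hD hDfin]
    exact integral_congr_ae hFD
  rw [h, integrable_withDensity_iff_integrable_smul' hM hMfin] at h1
  rw [h, integral_withDensity_eq_integral_toReal_smul hM hMfin] at h2
  simp only [Complex.real_smul] at h1 h2
  exact ⟨hto.integrable_comp_of_integrable h1, (hto.integral_comp hemb (fun v =>
    ((M v).toReal : ℂ) * ψ (WithLp.ofLp v))).trans h2⟩

theorem lintegral_box_sq (β : ℝ) (m : ℝ × EuclideanSpace ℝ (Fin d) → ℂ) :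
    ∫⁻ p, ‖((|p.1 ^ 2 - ‖p.2‖ ^ 2| ^ β : ℝ) : ℂ) *
        (((2 * Real.pi * ((2 * Real.pi) ^ d)⁻¹ : ℝ) : ℂ) * m p)‖ₑ ^ 2 =
      ENNReal.ofReal ((2 * Real.pi * ((2 * Real.pi) ^ d)⁻¹) ^ 2) *
        ∫⁻ p, boxWeight β (WithLp.toLp 2 p) * ‖m p‖ₑ ^ 2 := by
  have hpi := Real.pi_pos
  rw [← lintegral_const_mul' _ _ ENNReal.ofReal_ne_top]
  refine lintegral_congr fun p => ?_
  have h1 : 0 ≤ |p.1 ^ 2 - ‖p.2‖ ^ 2| ^ β := by positivity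
  have h2 : ∀ x : ℝ, 0 ≤ x → ‖(x : ℂ)‖ₑ ^ 2 = ENNReal.ofReal (x ^ 2) := fun x hx => by
    rw [← ofReal_norm, Complex.norm_real, Real.norm_of_nonneg hx, ENNReal.ofReal_pow hx]
  have h3 : (|p.1 ^ 2 - ‖p.2‖ ^ 2| ^ β) ^ 2 = |p.1 ^ 2 - ‖p.2‖ ^ 2| ^ (2 * β) := by
    rw [← Real.rpow_natCast, ← Real.rpow_mul (abs_nonneg _), mul_comm β]
    norm_num
  rw [enorm_mul, enorm_mul, mul_pow, mul_pow, h2 _ h1, h2 _ (by positivity), h3, boxWeight,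
    mul_left_comm]
  rfl

theorem kernelIntegral_eq (s β : ℝ) : kernelIntegral s β f g =
    ∫⁻ η : EuclideanSpace ℝ (Fin d) × EuclideanSpace ℝ (Fin d),
      (‖hat f η.1‖ₑ * ‖hat g η.2‖ₑ) ^ 2 * ENNReal.ofReal (phi s ‖η.1‖ * phi s ‖η.2‖ *
        kernel s (1 / 2) (((d : ℝ) - 2) / 2 + 2 * β) η.1 η.2) := by
  refine lintegral_congr fun η => ?_
  rw [mul_assoc, mul_assoc, ENNReal.ofReal_mul (by positivity), ← mul_pow,
    ENNReal.ofReal_pow (by positivity), ENNReal.ofReal_mul (norm_nonneg _), ofReal_norm,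
    ofReal_norm, mul_assoc]

/-- Bookkeeping of constants: the left side collects the normalisation of the Fourier density and
the Schur bound, and `(2π)^(d+1)` is the Plancherel factor, so `KG` is what remains for the norm in
physical space. -/
theorem sq_mul_schurConst (β : ℝ) :
    (2 * Real.pi * ((2 * Real.pi) ^ d)⁻¹) ^ 2 * schurConst d β = (2 * Real.pi) ^ (d + 1) * KG β d := by
  have hpi := Real.pi_pos
  have h2pi : 0 < 2 * Real.pi := by positivity
  have e1 : (2 : ℝ) ^ (-((d : ℝ) - 1) / 2) * 2 ^ (2 * β + ((d : ℝ) - 1) / 2) = 2 ^ (2 * β) := by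
    rw [← Real.rpow_add two_pos]
    congr 1
    ring
  have e2 : (2 : ℝ) ^ ((-5 * (d : ℝ) + 1) / 2 + 2 * β) * Real.pi ^ ((-5 * (d : ℝ) + 1) / 2) =
      (2 * Real.pi) ^ ((-5 * (d : ℝ) + 1) / 2) * 2 ^ (2 * β) := by
    rw [Real.rpow_add two_pos, Real.mul_rpow two_pos.le hpi.le]
    ring
  have e3 : (2 * Real.pi * ((2 * Real.pi) ^ d)⁻¹) ^ 2 * (2 * Real.pi) ^ (((d : ℝ) - 1) / 2) =
      (2 * Real.pi) ^ (d + 1) * (2 * Real.pi) ^ ((-5 * (d : ℝ) + 1) / 2) := by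
    rw [mul_pow, inv_pow, ← pow_mul, ← Real.rpow_natCast _ 2, ← Real.rpow_natCast _ (d * 2),
      ← Real.rpow_natCast _ (d + 1), ← Real.rpow_neg h2pi.le, ← Real.rpow_add h2pi,
      ← Real.rpow_add h2pi, ← Real.rpow_add h2pi]
    congr 1
    push_cast
    ring
  have e4 : Real.Gamma (2 * β + ((d : ℝ) - 1) / 2) / Real.Gamma (2 * β + d - 1) =
      Real.Gamma (((d : ℝ) - 1) / 2 + 2 * β) / Real.Gamma ((d : ℝ) - 1 + 2 * β) := by
    congr 2 <;> ring
  rw [KG, e2, schurConst, angularConst, e4]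
  linear_combination (2 ^ (2 * β) * (Real.Gamma (((d : ℝ) - 1) / 2 + 2 * β) /
    Real.Gamma ((d : ℝ) - 1 + 2 * β))) * e3 + ((2 * Real.pi * ((2 * Real.pi) ^ d)⁻¹) ^ 2 *
    (2 * Real.pi) ^ (((d : ℝ) - 1) / 2) * (Real.Gamma (((d : ℝ) - 1) / 2 + 2 * β) /
    Real.Gamma ((d : ℝ) - 1 + 2 * β))) * e1

theorem KG_pos (hd : 2 ≤ d) {β : ℝ} (hβ : (1 - (d : ℝ)) / 4 < β) : 0 < KG β d := by
  have hd' : (2 : ℝ) ≤ d := by exact_mod_cast hd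
  have h1 : 0 < Real.Gamma (((d : ℝ) - 1) / 2 + 2 * β) := Real.Gamma_pos_of_pos (by linarith)
  have h2 : 0 < Real.Gamma ((d : ℝ) - 1 + 2 * β) := Real.Gamma_pos_of_pos (by linarith)
  have := Real.pi_pos
  unfold KG
  positivity

theorem boxNormSq_bilinear_le {s : ℝ} (hs : 0 < s) (hd : 2 ≤ d) {β : ℝ}
    (hβ : (1 - (d : ℝ)) / 4 < β) :
    boxNormSq β (bilinear s f g) ≤ ENNReal.ofReal (KG β d) * kernelIntegral s β f g := by
  have hpi := Real.pi_pos
  -- When the right side is infinite there is nothing to prove, since `KG` is not zero. Otherwise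
  -- finiteness provides the square integrability needed to construct `|□|^β`.
  rcases eq_or_ne (kernelIntegral s β f g) ∞ with hinf | hfin
  · rw [hinf, ENNReal.mul_top (by simpa using KG_pos hd hβ)]
    exact le_top
  obtain ⟨M, m, hM, -, hquad, hm, hmM, hF⟩ := exists_bilinear_density f g hs hd
  have hto := WithLp.volume_preserving_toLp ℝ (EuclideanSpace ℝ (Fin d))
  have hemb := (MeasurableEquiv.toLp 2 (ℝ × EuclideanSpace ℝ (Fin d))).measurableEmbedding
  set n : ℝ × EuclideanSpace ℝ (Fin d) → ℂ := fun p => ((|p.1 ^ 2 - ‖p.2‖ ^ 2| ^ β : ℝ) : ℂ) *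
    (((2 * Real.pi * ((2 * Real.pi) ^ d)⁻¹ : ℝ) : ℂ) * m p) with hn
  have hle : ∫⁻ p, ‖n p‖ₑ ^ 2 ≤ ENNReal.ofReal ((2 * Real.pi) ^ (d + 1)) *
      (ENNReal.ofReal (KG β d) * kernelIntegral s β f g) := by
    calc _ = _ := lintegral_box_sq β m
      _ ≤ ENNReal.ofReal ((2 * Real.pi * ((2 * Real.pi) ^ d)⁻¹) ^ 2) *
          ∫⁻ p, boxWeight β (WithLp.toLp 2 p) * M (WithLp.toLp 2 p) ^ 2 := by
          refine mul_le_mul' le_rfl (lintegral_mono_ae ?_)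
          filter_upwards [hmM] with p hp
          gcongr
      _ = ENNReal.ofReal ((2 * Real.pi * ((2 * Real.pi) ^ d)⁻¹) ^ 2) *
          quadIntegral s (boxWeight β) (fun η => ‖hat f η‖ₑ) (fun η => ‖hat g η‖ₑ) := by
          rw [hto.lintegral_comp_emb hemb (fun v => boxWeight β v * M v ^ 2),
            hquad _ (measurable_boxWeight β)]
      _ ≤ ENNReal.ofReal ((2 * Real.pi * ((2 * Real.pi) ^ d)⁻¹) ^ 2) *
          (ENNReal.ofReal (schurConst d β) * kernelIntegral s β f g) := by
          rw [kernelIntegral_eq f g s β]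
          exact mul_le_mul' le_rfl (quadIntegral_boxWeight_le hs hd hβ (measurable_enorm_hat f)
            (measurable_enorm_hat g))
      _ = _ := by
          rw [← mul_assoc, ← mul_assoc, ← ENNReal.ofReal_mul (by positivity), sq_mul_schurConst,
            ENNReal.ofReal_mul (by positivity)]
  have hnm : AEStronglyMeasurable n volume := by
    refine AEStronglyMeasurable.mul ?_ (hm.const_mul _)
    exact Measurable.aestronglyMeasurable (by fun_prop)
  have hn2 : MemLp n 2 volume := by
    refine ⟨hnm, ?_⟩
    have h1 : eLpNorm n 2 volume ^ 2 < ∞ := by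
      rw [eLpNorm_two_sq]
      exact hle.trans_lt (ENNReal.mul_lt_top ENNReal.ofReal_lt_top
        (ENNReal.mul_lt_top ENNReal.ofReal_lt_top hfin.lt_top))
    exact (ENNReal.pow_lt_top_iff.1 h1).resolve_right two_ne_zero
  obtain ⟨G, hG, hGn⟩ := exists_isSpaceTimeFourier hn2
  refine (iInf₂_le_of_le G hG (iInf_le_of_le ⟨_, hF, hGn⟩ le_rfl)).trans ?_
  rw [lintegral_sq_eq_of_isSpaceTimeFourier hG hGn] at hle
  exact (ENNReal.mul_le_mul_iff_right (by simp; positivity) ENNReal.ofReal_ne_top).1 hle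

theorem boxNormSq_bilinear_eq {s : ℝ} (hs : 0 < s) (hd : 2 ≤ d) {β : ℝ}
    (hβ : (1 - (d : ℝ)) / 4 < β) {a : ℝ} (hf : ∀ᵐ ξ : EuclideanSpace ℝ (Fin d), hat f ξ =
      ((Real.exp (-a * phi s ‖ξ‖) / phi s ‖ξ‖ : ℝ) : ℂ)) :
    boxNormSq β (bilinear s f f) = ENNReal.ofReal (KG β d) * kernelIntegral s β f f := by
  have hpi := Real.pi_pos
  refine le_antisymm (boxNormSq_bilinear_le f f hs hd hβ) ?_
  have hdim : Module.finrank ℝ (EuclideanSpace ℝ (Fin d)) = d := finrank_euclideanSpace_fin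
  have hto := WithLp.volume_preserving_toLp ℝ (EuclideanSpace ℝ (Fin d))
  have hemb := (MeasurableEquiv.toLp 2 (ℝ × EuclideanSpace ℝ (Fin d))).measurableEmbedding
  set e : EuclideanSpace ℝ (Fin d) → ℝ≥0∞ := fun η =>
    ENNReal.ofReal (Real.exp (-a * phi s ‖η‖) / phi s ‖η‖) with he
  have hem : Measurable e := by
    have := (continuous_phi s).measurable
    fun_prop
  have hfe : ∀ᵐ η, ‖hat f η‖ₑ = e η := by
    filter_upwards [hf] with η hη
    have := phi_pos hs ‖η‖
    rw [hη, ← ofReal_norm, Complex.norm_real, Real.norm_of_nonneg (by positivity)]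
  have hf' : ∀ᵐ η, hat f η = (‖hat f η‖ : ℂ) := by
    filter_upwards [hf] with η hη
    have := phi_pos hs ‖η‖
    rw [hη, Complex.norm_real, Real.norm_of_nonneg (by positivity)]
  have hfe2 : ∀ᵐ η : EuclideanSpace ℝ (Fin d) × EuclideanSpace ℝ (Fin d),
      ‖hat f η.1‖ₑ * ‖hat f η.2‖ₑ = e η.1 * e η.2 := by
    filter_upwards [Measure.quasiMeasurePreserving_fst.ae hfe,
      Measure.quasiMeasurePreserving_snd.ae hfe] with η h1 h2
    rw [h1, h2]
  obtain ⟨M, hM, hTM, hquad⟩ := exists_transferDensity (E := EuclideanSpace ℝ (Fin d)) hs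
    (hdim.symm ▸ hd) hem hem (fun η => ENNReal.ofReal_ne_top) (fun η => ENNReal.ofReal_ne_top)
  have hTe : transferMeasure s (fun η => ‖hat f η‖ₑ) (fun η => ‖hat f η‖ₑ) =
      transferMeasure s e e := by
    rw [transferMeasure, transferMeasure, withDensity_congr_ae hfe2]
  have hMfin := ae_lt_top_of_transferMeasure_eq f f s hM (hTe.trans hTM)
  have hF := isSpaceTimeFourier_bilinear_of_nonneg f f hf' hf' hM (hTe.trans hTM)
  -- Any admissible `G` has the same transform almost everywhere, so its norm is forced. As `hat f`
  -- is nonnegative, the complex density is the transfer density itself and nothing is lost by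
  -- domination.
  refine le_iInf fun G => le_iInf fun hG => le_iInf fun hbox => ?_
  obtain ⟨m, hm, hGm⟩ := hbox
  have hGn := hGm.congr_right (m' := fun p => ((|p.1 ^ 2 - ‖p.2‖ ^ 2| ^ β : ℝ) : ℂ) *
    (((2 * Real.pi * ((2 * Real.pi) ^ d)⁻¹ : ℝ) : ℂ) * ((M (WithLp.toLp 2 p)).toReal : ℂ))) (by
    filter_upwards [hm.ae_eq hF] with p hp
    rw [hp])
  have hnorm := lintegral_sq_eq_of_isSpaceTimeFourier hG hGn
  refine (ENNReal.mul_le_mul_iff_right (a := ENNReal.ofReal ((2 * Real.pi) ^ (d + 1)))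
    (by simp; positivity) ENNReal.ofReal_ne_top).1 ?_
  rw [← hnorm, lintegral_box_sq]
  have h1 : ∫⁻ p, boxWeight β (WithLp.toLp 2 p) * ‖((M (WithLp.toLp 2 p)).toReal : ℂ)‖ₑ ^ 2 =
      quadIntegral s (boxWeight β) e e := by
    rw [← hquad _ (measurable_boxWeight β), ← hto.lintegral_comp_emb hemb]
    refine lintegral_congr_ae ?_
    filter_upwards [hto.quasiMeasurePreserving.ae hMfin] with p hp
    rw [← ofReal_norm, Complex.norm_real, Real.norm_of_nonneg ENNReal.toReal_nonneg,
      ENNReal.ofReal_toReal hp.ne]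
  have h2 : kernelIntegral s β f f = ∫⁻ η : EuclideanSpace ℝ (Fin d) × EuclideanSpace ℝ (Fin d),
      (e η.1 * e η.2) ^ 2 * ENNReal.ofReal (phi s ‖η.1‖ * phi s ‖η.2‖ *
        kernel s (1 / 2) (((d : ℝ) - 2) / 2 + 2 * β) η.1 η.2) := by
    rw [kernelIntegral_eq f f s β]
    refine lintegral_congr_ae ?_
    filter_upwards [hfe2] with η hη
    rw [hη]
  rw [h1, quadIntegral_boxWeight_eq_of_exp hs hd hβ a (fun η => rfl), ← h2, ← mul_assoc,
    ← mul_assoc, ← ENNReal.ofReal_mul (by positivity), ← ENNReal.ofReal_mul (by positivity),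
    sq_mul_schurConst]

end Estimate

/-! ### Existence, positivity and finiteness for the extremisers -/

section Extremiser

/-- The exponent `p` may be negative, as it is in the kernel for small `β`; `hp` is integrability at
the origin. -/
theorem lintegral_norm_rpow_mul_exp_lt_top {E : Type*} [NormedAddCommGroup E]
    [InnerProductSpace ℝ E] [FiniteDimensional ℝ E] [MeasurableSpace E] [BorelSpace E]
    [Nontrivial E] {p c : ℝ} (hc : 0 < c) (hp : 0 < p + Module.finrank ℝ E) :
    ∫⁻ y : E, ENNReal.ofReal (‖y‖ ^ p * Real.exp (-(c * ‖y‖))) < ∞ := by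
  rw [lintegral_polar (by fun_prop)]
  have h : ∀ ω : Metric.sphere (0 : E) 1, ∫⁻ r in Set.Ioi (0 : ℝ),
      ENNReal.ofReal (r ^ (Module.finrank ℝ E - 1)) *
        ENNReal.ofReal (‖r • (ω : E)‖ ^ p * Real.exp (-(c * ‖r • (ω : E)‖))) =
      ENNReal.ofReal ((1 / c) ^ (p + Module.finrank ℝ E) *
        Real.Gamma (p + Module.finrank ℝ E)) := by
    intro ω
    rw [← lintegral_rpow_mul_exp_neg_mul hp hc]
    refine setLIntegral_congr_fun measurableSet_Ioi fun r hr => ?_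
    have hr : (0 : ℝ) < r := hr
    have h1 : ‖r • (ω : E)‖ = r := by
      rw [norm_smul, norm_eq_of_mem_sphere, mul_one, Real.norm_of_nonneg hr.le]
    have hn : 1 ≤ Module.finrank ℝ E := Module.finrank_pos
    rw [h1, ← ENNReal.ofReal_mul (by positivity), ← mul_assoc, ← Real.rpow_natCast,
      ← Real.rpow_add hr, Nat.cast_sub hn, Nat.cast_one, add_comm, add_sub_assoc]
  simp only [h]
  rw [lintegral_const]
  exact ENNReal.mul_lt_top ENNReal.ofReal_lt_top (measure_lt_top _ _)

variable {d : ℕ} {s a : ℝ}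

theorem le_phi (s r : ℝ) : s ≤ phi s r :=
  Real.le_sqrt_of_sq_le (by nlinarith [sq_nonneg r])

theorem exists_hat_eq_exp (hs : 0 < s) (ha : 0 < a) (hd : 2 ≤ d) :
    ∃ f : Lp ℂ 2 (volume : Measure (EuclideanSpace ℝ (Fin d))),
      ∀ᵐ ξ : EuclideanSpace ℝ (Fin d), hat f ξ =
        ((Real.exp (-a * phi s ‖ξ‖) / phi s ‖ξ‖ : ℝ) : ℂ) := by
  have hpi := Real.pi_pos
  have hdim : Module.finrank ℝ (EuclideanSpace ℝ (Fin d)) = d := finrank_euclideanSpace_fin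
  have : Nontrivial (EuclideanSpace ℝ (Fin d)) :=
    Module.nontrivial_of_finrank_pos (R := ℝ) (by omega)
  have hφ := continuous_phi s
  set h : EuclideanSpace ℝ (Fin d) → ℂ := fun κ =>
    ((Real.exp (-a * phi s (2 * Real.pi * ‖κ‖)) / phi s (2 * Real.pi * ‖κ‖) : ℝ) : ℂ) with hh
  have hm : AEStronglyMeasurable h volume := by
    have := hφ.measurable
    exact Measurable.aestronglyMeasurable (by fun_prop)
  have hL : MemLp h 2 volume := by
    refine ⟨hm, ?_⟩
    have h1 : eLpNorm h 2 volume ^ 2 < ∞ := by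
      rw [eLpNorm_two_sq]
      have h2 := lintegral_norm_rpow_mul_exp_lt_top (E := EuclideanSpace ℝ (Fin d)) (p := 0)
        (c := 2 * a * (2 * Real.pi)) (by positivity) (by rw [hdim, zero_add]; positivity)
      refine lt_of_le_of_lt ?_ (ENNReal.mul_lt_top (ENNReal.ofReal_lt_top (r := s⁻¹ ^ 2)) h2)
      rw [← lintegral_const_mul' _ _ ENNReal.ofReal_ne_top]
      refine lintegral_mono fun κ => ?_
      have hp := phi_pos hs (2 * Real.pi * ‖κ‖)
      have hs' := le_phi s (2 * Real.pi * ‖κ‖)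
      have hlt := (lt_phi hs (2 * Real.pi * ‖κ‖)).le
      rw [hh]
      dsimp only
      rw [← ofReal_norm, Complex.norm_real, Real.norm_of_nonneg (by positivity),
        ← ENNReal.ofReal_pow (by positivity), ← ENNReal.ofReal_mul (by positivity),
        Real.rpow_zero, one_mul, div_pow, ← Real.exp_nat_mul, div_eq_inv_mul, ← inv_pow]
      refine ENNReal.ofReal_le_ofReal ?_
      have h3 : (2 : ℕ) * (-a * phi s (2 * Real.pi * ‖κ‖)) ≤ -(2 * a * (2 * Real.pi) * ‖κ‖) := by
        push_cast
        nlinarith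
      gcongr
    exact (ENNReal.pow_lt_top_iff.1 h1).resolve_right two_ne_zero
  refine ⟨𝓕⁻ (hL.toLp h), ?_⟩
  have hq : Measure.QuasiMeasurePreserving
      (fun v : EuclideanSpace ℝ (Fin d) => (2 * Real.pi)⁻¹ • v) volume volume :=
    ⟨measurable_const_smul _, by
      rw [Measure.map_addHaar_smul volume (by positivity)]
      exact Measure.smul_absolutelyContinuous⟩
  filter_upwards [hq.ae hL.coeFn_toLp] with ξ hξ
  have h4 : 2 * Real.pi * ‖(2 * Real.pi)⁻¹ • ξ‖ = ‖ξ‖ := by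
    rw [norm_smul, Real.norm_of_nonneg (by positivity)]
    field_simp
  rw [hat, fourier_fourierInv_eq, hξ, hh]
  dsimp only
  rw [h4]

variable {β : ℝ} {f : Lp ℂ 2 (volume : Measure (EuclideanSpace ℝ (Fin d)))}

/-- The kernel integral of an exponential in centre-of-mass variables. -/
theorem kernelIntegral_exp_eq (hs : 0 < s) (hf : ∀ᵐ ξ : EuclideanSpace ℝ (Fin d), hat f ξ =
      ((Real.exp (-a * phi s ‖ξ‖) / phi s ‖ξ‖ : ℝ) : ℂ)) :
    kernelIntegral s β f f = ∫⁻ ξ : EuclideanSpace ℝ (Fin d), ∫⁻ y : EuclideanSpace ℝ (Fin d),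
      ENNReal.ofReal (2 / (totalEnergy s ξ y * phi s ‖y‖) *
        Real.exp (-(2 * a * totalEnergy s ξ y)) *
        ((2 * ‖y‖ ^ 2) ^ (((d : ℝ) - 2) / 2 + 2 * β) / (2 * phi s ‖y‖ ^ 2) ^ (1 / 2 : ℝ))) := by
  set H : EuclideanSpace ℝ (Fin d) × EuclideanSpace ℝ (Fin d) → ℝ≥0∞ := fun η => ENNReal.ofReal
    ((Real.exp (-a * phi s ‖η.1‖) / phi s ‖η.1‖ * (Real.exp (-a * phi s ‖η.2‖) / phi s ‖η.2‖)) ^ 2 *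
      (phi s ‖η.1‖ * phi s ‖η.2‖ * kernel s (1 / 2) (((d : ℝ) - 2) / 2 + 2 * β) η.1 η.2)) with hH
  have hHm : Measurable H := by
    have := (continuous_phi s).measurable
    have := measurable_kernel (d := d) s (1 / 2) (((d : ℝ) - 2) / 2 + 2 * β)
    fun_prop
  calc _ = ∫⁻ η, H η := by
        rw [kernelIntegral_eq]
        refine lintegral_congr_ae ?_
        filter_upwards [Measure.quasiMeasurePreserving_fst.ae hf,
          Measure.quasiMeasurePreserving_snd.ae hf] with η h1 h2
        have p1 := phi_pos hs ‖η.1‖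
        have p2 := phi_pos hs ‖η.2‖
        rw [h1, h2, ← ofReal_norm, ← ofReal_norm, Complex.norm_real, Complex.norm_real,
          Real.norm_of_nonneg (by positivity), Real.norm_of_nonneg (by positivity),
          ← ENNReal.ofReal_mul (by positivity), ← ENNReal.ofReal_pow (by positivity),
          ← ENNReal.ofReal_mul (by positivity)]
    _ = _ := by
        rw [lintegral_pair_eq_lintegral_legs hs hHm]
        refine lintegral_congr fun ξ => lintegral_congr fun y => ?_
        have p1 := phi_pos hs ‖legPlus s ξ y‖
        have p2 := phi_pos hs ‖legMinus s ξ y‖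
        have p3 := phi_pos hs ‖y‖
        have p4 := totalEnergy_pos hs ξ y
        have hm := minkowski_legs hs ξ y
        have hφ := phi_sq s ‖y‖
        have hK : kernel s (1 / 2) (((d : ℝ) - 2) / 2 + 2 * β) (legPlus s ξ y) (legMinus s ξ y) =
            (2 * ‖y‖ ^ 2) ^ (((d : ℝ) - 2) / 2 + 2 * β) / (2 * phi s ‖y‖ ^ 2) ^ (1 / 2 : ℝ) := by
          rw [kernel, hm]
          congr 2 <;> linarith
        rw [hH]
        dsimp only
        rw [hK, ← ENNReal.ofReal_mul (by positivity)]
        congr 1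
        have he : Real.exp (-(2 * a * totalEnergy s ξ y)) =
            (Real.exp (-a * phi s ‖legPlus s ξ y‖) * Real.exp (-a * phi s ‖legMinus s ξ y‖)) ^ 2 := by
          rw [← Real.exp_add, ← Real.exp_nat_mul, ← phi_legPlus_add_phi_legMinus hs]
          congr 1
          push_cast
          ring
        rw [he]
        field_simp
        ring

/-- In centre-of-mass variables the integrand is positive off `y = 0`, a null set. -/
theorem kernelIntegral_exp_pos (hs : 0 < s) (hd : 2 ≤ d)
    (hf : ∀ᵐ ξ : EuclideanSpace ℝ (Fin d), hat f ξ =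
      ((Real.exp (-a * phi s ‖ξ‖) / phi s ‖ξ‖ : ℝ) : ℂ)) :
    0 < kernelIntegral s β f f := by
  have hdim : Module.finrank ℝ (EuclideanSpace ℝ (Fin d)) = d := finrank_euclideanSpace_fin
  have : Nontrivial (EuclideanSpace ℝ (Fin d)) :=
    Module.nontrivial_of_finrank_pos (R := ℝ) (by omega)
  rw [pos_iff_ne_zero, kernelIntegral_exp_eq hs hf]
  intro h0
  have hφ := (continuous_phi s).measurable
  have hτ := (continuous_totalEnergy (E := EuclideanSpace ℝ (Fin d)) s).measurable
  have hG : Measurable fun p : EuclideanSpace ℝ (Fin d) × EuclideanSpace ℝ (Fin d) =>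
      ENNReal.ofReal (2 / (totalEnergy s p.1 p.2 * phi s ‖p.2‖) *
        Real.exp (-(2 * a * totalEnergy s p.1 p.2)) *
        ((2 * ‖p.2‖ ^ 2) ^ (((d : ℝ) - 2) / 2 + 2 * β) /
          (2 * phi s ‖p.2‖ ^ 2) ^ (1 / 2 : ℝ))) := by fun_prop
  have h1 := (lintegral_eq_zero_iff hG.lintegral_prod_right').1 h0
  have h2 : ∀ᵐ ξ : EuclideanSpace ℝ (Fin d), False := by
    filter_upwards [h1] with ξ hξ
    have h3 := (lintegral_eq_zero_iff (hG.comp measurable_prodMk_left)).1 hξ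
    have h4 : ∀ᵐ y : EuclideanSpace ℝ (Fin d), y ≠ 0 := by simp [ae_iff]
    have h5 : ∀ᵐ y : EuclideanSpace ℝ (Fin d), False := by
      filter_upwards [h3, h4] with y hy hy0
      have p3 := phi_pos hs ‖y‖
      have p4 := totalEnergy_pos hs ξ y
      have p5 := norm_pos_iff.2 hy0
      have hy' : ENNReal.ofReal _ = 0 := hy
      rw [ENNReal.ofReal_eq_zero] at hy'
      exact absurd hy' (not_le.2 (by positivity))
    exact h5.exists.elim fun _ h => h
  exact h2.exists.elim fun _ h => h

/-- The total energy dominates both `‖ξ‖` and `2‖y‖`, so half of the exponential decay goes to each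
variable and the double integral is bounded by a product; the remaining power of `‖y‖` is integrable
at the origin by the hypothesis on `β`. -/
theorem kernelIntegral_exp_lt_top (hs : 0 < s) (ha : 0 < a) (hd : 2 ≤ d)
    (hβ : (1 - (d : ℝ)) / 4 < β)
    (hf : ∀ᵐ ξ : EuclideanSpace ℝ (Fin d), hat f ξ =
      ((Real.exp (-a * phi s ‖ξ‖) / phi s ‖ξ‖ : ℝ) : ℂ)) :
    kernelIntegral s β f f < ∞ := by
  have hd' : (2 : ℝ) ≤ d := by exact_mod_cast hd
  have hdim : Module.finrank ℝ (EuclideanSpace ℝ (Fin d)) = d := finrank_euclideanSpace_fin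
  have : Nontrivial (EuclideanSpace ℝ (Fin d)) :=
    Module.nontrivial_of_finrank_pos (R := ℝ) (by omega)
  set b := ((d : ℝ) - 2) / 2 + 2 * β with hb
  have h1 := lintegral_norm_rpow_mul_exp_lt_top (E := EuclideanSpace ℝ (Fin d)) (p := 0)
    (c := a) ha (by rw [hdim]; linarith)
  have h2 := lintegral_norm_rpow_mul_exp_lt_top (E := EuclideanSpace ℝ (Fin d)) (p := 2 * b)
    (c := 2 * a) (by positivity) (by rw [hdim, hb]; linarith)
  rw [kernelIntegral_exp_eq hs hf]
  have h3 : 0 ≤ 2 / (2 * s * s) * (2 ^ b / (2 * s ^ 2) ^ (1 / 2 : ℝ)) := by positivity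
  refine lt_of_le_of_lt ?_ (ENNReal.mul_lt_top (ENNReal.mul_lt_top (ENNReal.ofReal_lt_top
    (r := 2 / (2 * s * s) * (2 ^ b / (2 * s ^ 2) ^ (1 / 2 : ℝ)))) h1) h2)
  rw [← lintegral_const_mul' _ _ ENNReal.ofReal_ne_top, ← lintegral_mul_const' _ _ h2.ne]
  refine lintegral_mono fun ξ => ?_
  rw [← lintegral_const_mul' _ _ (ENNReal.mul_ne_top ENNReal.ofReal_ne_top ENNReal.ofReal_ne_top)]
  refine lintegral_mono fun y => ?_
  have p3 := phi_pos hs ‖y‖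
  have p4 := totalEnergy_pos hs ξ y
  have hsq := totalEnergy_sq s ξ y
  have q1 : s ≤ phi s ‖y‖ := le_phi s _
  have q2 : ‖ξ‖ ≤ totalEnergy s ξ y :=
    abs_le_of_sq_le_sq' (by nlinarith [sq_nonneg (phi s ‖y‖)]) p4.le |>.2
  have q3 : 2 * phi s ‖y‖ ≤ totalEnergy s ξ y :=
    abs_le_of_sq_le_sq' (by nlinarith [sq_nonneg ‖ξ‖]) p4.le |>.2
  have q4 := (lt_phi hs ‖y‖).le
  dsimp only
  rw [← ENNReal.ofReal_mul h3, ← ENNReal.ofReal_mul (by positivity)]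
  refine ENNReal.ofReal_le_ofReal ?_
  have e1 : (2 * ‖y‖ ^ 2) ^ b = 2 ^ b * ‖y‖ ^ (2 * b) := by
    rw [Real.mul_rpow two_pos.le (by positivity), ← Real.rpow_natCast ‖y‖ 2,
      ← Real.rpow_mul (norm_nonneg _)]
    norm_num
  have e2 : Real.exp (-(2 * a * totalEnergy s ξ y)) ≤
      Real.exp (-(a * ‖ξ‖)) * Real.exp (-(2 * a * ‖y‖)) := by
    rw [← Real.exp_add]
    refine Real.exp_le_exp.2 ?_
    nlinarith
  calc _ ≤ 2 / (2 * s * s) * (Real.exp (-(a * ‖ξ‖)) * Real.exp (-(2 * a * ‖y‖))) *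
        ((2 * ‖y‖ ^ 2) ^ b / (2 * s ^ 2) ^ (1 / 2 : ℝ)) := by
        gcongr
        linarith
    _ = _ := by
        rw [e1, Real.rpow_zero]
        ring

end Extremiser

end KleinGordon

end

theorem theorem1 (d : ℕ) (hd : 2 ≤ d) (s : ℝ) (hs : 0 < s) (β : ℝ)
    (hβ : (1 - (d : ℝ)) / 4 < β) :
    -- the estimate
    (∀ f g : Lp ℂ 2 (volume : Measure (EuclideanSpace ℝ (Fin d))),
      KleinGordon.boxNormSq β (KleinGordon.bilinear s f g) ≤
        ENNReal.ofReal (KleinGordon.KG β d) * KleinGordon.kernelIntegral s β f g) ∧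
    -- no smaller constant is admissible
    (∀ C : ℝ≥0∞,
      (∀ f g : Lp ℂ 2 (volume : Measure (EuclideanSpace ℝ (Fin d))),
        KleinGordon.boxNormSq β (KleinGordon.bilinear s f g) ≤
          C * KleinGordon.kernelIntegral s β f g) →
      ENNReal.ofReal (KleinGordon.KG β d) ≤ C) ∧
    -- extremisers
    (∀ a : ℝ, 0 < a → ∃ f : Lp ℂ 2 (volume : Measure (EuclideanSpace ℝ (Fin d))),
      (∀ᵐ ξ : EuclideanSpace ℝ (Fin d), KleinGordon.hat f ξ =
        ((Real.exp (-a * KleinGordon.phi s ‖ξ‖) / KleinGordon.phi s ‖ξ‖ : ℝ) : ℂ)) ∧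
      0 < KleinGordon.kernelIntegral s β f f ∧ KleinGordon.kernelIntegral s β f f < ∞ ∧
      KleinGordon.boxNormSq β (KleinGordon.bilinear s f f) =
        ENNReal.ofReal (KleinGordon.KG β d) * KleinGordon.kernelIntegral s β f f) := by
  have hext : ∀ a : ℝ, 0 < a → ∃ f : Lp ℂ 2 (volume : Measure (EuclideanSpace ℝ (Fin d))),
      (∀ᵐ ξ : EuclideanSpace ℝ (Fin d), KleinGordon.hat f ξ =
        ((Real.exp (-a * KleinGordon.phi s ‖ξ‖) / KleinGordon.phi s ‖ξ‖ : ℝ) : ℂ)) ∧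
      0 < KleinGordon.kernelIntegral s β f f ∧ KleinGordon.kernelIntegral s β f f < ∞ ∧
      KleinGordon.boxNormSq β (KleinGordon.bilinear s f f) =
        ENNReal.ofReal (KleinGordon.KG β d) * KleinGordon.kernelIntegral s β f f := by
    intro a ha
    obtain ⟨f, hf⟩ := KleinGordon.exists_hat_eq_exp hs ha hd
    exact ⟨f, hf, KleinGordon.kernelIntegral_exp_pos hs hd hf,
      KleinGordon.kernelIntegral_exp_lt_top hs ha hd hβ hf,
      KleinGordon.boxNormSq_bilinear_eq f hs hd hβ hf⟩
  refine ⟨fun f g => KleinGordon.boxNormSq_bilinear_le f g hs hd hβ, fun C hC => ?_, hext⟩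
  -- Optimality follows from any single extremiser; finiteness and positivity allow division by the
  -- kernel integral.
  obtain ⟨f, -, hpos, hfin, heq⟩ := hext 1 one_pos
  have h := hC f f
  rw [heq] at h
  exact (ENNReal.mul_le_mul_iff_left hpos.ne' hfin.ne).1 h
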